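/- **Setting.** For each $k\in\mathbb N$ consider a bipartite network with $m=m_k$ actors and $n=n_k$ events, $m\ge n$, $m\to\infty$, $m/n=O(1)$ (the index $k$ is suppressed below). Let $f(\cdot\,|\,t)$, $t\in\mathbb R$, be a known family of probability distributions on $\mathbb R$ with finite mean $\mu(t)$. Let $z_{ij}\in\mathbb R^p$ ($p\ge1$ fixed) be covariates with $\max_{i,j}\|z_{ij}\|_\infty\le C_z$ for a constant $C_z$. For $\theta=(\alpha_1,\dots,\alpha_m,\beta_1,\dots,\beta_{n-1})$, $\beta_n:=0$ and $\gamma\in\mathbb R^p$ put $\pi_{ij}=\alpha_i+\beta_j+z_{ij}^\top\gamma$. The edge weights $x_{ij}$, $1\le i\le m$, $1\le j\le n$, are independent, $x_{ij}\sim f(\cdot\,|\,\pi_{ij}^*)$, where $\pi^*_{ij}$ is $\pi_{ij}$ at the true parameter $(\theta^*,\gamma^*)$. Let $d_i=\sum_j x_{ij}$, $b_j=\sum_i x_{ij}$, $g=(d_1,\dots,d_m,b_1,\dots,b_{n-1})^\top$ and $g_{m+n}=\sum_i d_i-\sum_{j<n}b_j=b_n$. Put $$F_i=\sum_{k=1}^n\mu(\pi_{ik})-d_i\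 (i\le m),\qquad F_{m+j}=\sum_{k=1}^m\mu(\pi_{kj})-b_j\ (j\le n-1),\qquad Q=\sum_{i,j}z_{ij}\big(\mu(\pi_{ij})-x_{ij}\big).$$ The moment equations are $F(\theta,\gamma)=0$, $Q(\theta,\gamma)=0$. Let $B(x,\epsilon)$ denote the closed $\ell_\infty$-ball, $\|A\|_\infty$ the largest absolute row sum and $\|A\|_{\max}$ the largest absolute entry of a matrix $A$. Let $V=(v_{ij})=\partial F(\theta^*,\gamma^*)/\partial\theta^\top$, $v_{m+n,i}=v_{ii}-\sum_{j\ne i}v_{ij}$, $v_{m+n,m+n}=\sum_{i=1}^{m+n-1}v_{m+n,i}$, and let $S=(s_{ij})$ be the $(m+n-1)\times(m+n-1)$ matrix with $s_{ij}=\delta_{ij}/v_{ii}+1/v_{m+n,m+n}$ if $i,j\le m$ or $i,j>m$, and $s_{ij}=-1/v_{m+n,m+n}$ otherwise. Further let $$H=\frac{\partial Q}{\partial\gamma^\top}-\frac{\partial Q}{\partial\theta^\top}\Big[\frac{\partial F}{\partial\theta^\top}\Big]^{-1}\frac{\partial F}{\partial\gamma^\top},\qquad \kappa=\sup_{\theta\in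 B(\theta^*,\epsilon_1)}\|mn\,H^{-1}(\theta,\gamma^*)\|_\infty,$$ $$\sigma^2=(m+n-1)^2\,\|(V^{-1}-S)\,\mathrm{Cov}(g)\,(V^{-1}-S)\|_{\max}.$$ **Assumptions.** (i) There are $\epsilon_1,\epsilon_2>0$ with $\epsilon_1,\epsilon_2\to0$ and $b_0,b_1,b_2,b_3>0$ (all may depend on $k$), with $b_1$ bounded away from $0$, such that for all $\theta\in B(\theta^*,\epsilon_1)$ and $\gamma\in B(\gamma^*,\epsilon_2)$ the function $\mu$ is three times differentiable at every $\pi_{ij}$, $\min_{i,j}\mu'(\pi_{ij})\cdot\max_{i,j}\mu'(\pi_{ij})>0$, $b_0\le|\mu'(\pi_{ij})|\le b_1$, $|\mu''(\pi_{ij})|\le b_2$ and $|\mu'''(\pi_{ij})|\le b_3$. (ii) $H(\theta,\gamma^*)$ is nonsingular for $\theta\in B(\theta^*,\epsilon_1)$. (iii) $x_{ij}$ is sub-exponential with parameter $h_{ij}>0$, i.e. $\mathbb E e^{s(x_{ij}-\mathbb Ex_{ij})}\le e^{s^2h_{ij}^2/2}$ for $|s|<1/h_{ij}$; $h_{\max}=\max_{i,j}h_{ij}$.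 (iv) With $A=\frac{b_2h_{\max}^2}{b_0^9}+\sigma$, $$\frac{\kappa^2b_1^{16}b_2}{b_0^9}A=o\Big(\frac m{\log m}\Big),\qquad \frac{b_1^4b_2h_{\max}}{b_0^6}=o\Big(\sqrt{\frac m{\log m}}\Big),\qquad \frac{\kappa^2b_1^{14}\log m}{m}A^2=o\Big(\frac m{\log m}\Big).$$ **Theorem.** Let $R=\frac{\kappa\,b_1^{10}\log m}{b_0^3\,m}A$. Let $(\hat\theta,\hat\gamma)$ be the moment estimator, that is, with probability tending to one it solves the moment equations and lies in $B(\theta^*,\epsilon_1)\times B(\gamma^*,\epsilon_2)$. Then $$\hat\theta_i-\theta_i^*=[S(g-\mathbb Eg)]_i+O_p(R),$$ uniformly over the index $i\in\{1,\dots,m+n-1\}$ (the constants in $O_p$ do not depend on $i$), in particular for every fixed $i$, where $$[S(g-\mathbb Eg)]_i=\begin{cases}\dfrac{g_i-\mathbb Eg_i}{v_{ii}}+\dfrac{g_{m+n}-\mathbb Eg_{m+n}}{v_{m+n,m+n}},&1\le i\le m,\\[2ex]\dfrac{g_i-\mathbb Eg_i}{v_{ii}}-\dfrac{g_{m+n}-\mathbb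 Eg_{m+n}}{v_{m+n,m+n}},&m+1\le i\le m+n-1.\end{cases}$$ Moreover, the moment estimator exists: if $\frac{b_1^2h_{\max}}{b_0^3}\sqrt{\frac{\log m}m}+R=o(\epsilon_1)$ and $R=o(\epsilon_2)$, then with probability tending to one the moment equations have exactly one solution in $B(\theta^*,\epsilon_1)\times B(\gamma^*,\epsilon_2)$. -/

import Mathlib

open Filter Topology MeasureTheory ProbabilityTheory Asymptotics
open scoped Matrix

noncomputable section

namespace BipartiteNetwork

/-! A bipartite network has `m` actors and `n = q + 1` events.  The last event has degree parameter
`0`, so the free degree parameters form a vector `θ = (α_1, …, α_m, β_1, …, β_{n-1})`, indexed by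
`Fin m ⊕ Fin q`.  Vectors carry the sup norm, so `Metric.closedBall` is the `ℓ_∞` ball. -/

variable {m q p : ℕ}

/-- The event parameters `(β_1, …, β_{n-1}, β_n)` with `β_n = 0`. -/
def eventParam (θ : Fin m ⊕ Fin q → ℝ) : Fin (q + 1) → ℝ :=
  Fin.snoc (α := fun _ => ℝ) (fun j => θ (Sum.inr j)) 0

/-- `π_{ij} = α_i + β_j + z_{ij}ᵀ γ`. -/
def linPred (z : Fin m → Fin (q + 1) → Fin p → ℝ) (θ : Fin m ⊕ Fin q → ℝ) (γ : Fin p → ℝ)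
    (i : Fin m) (j : Fin (q + 1)) : ℝ :=
  θ (Sum.inl i) + eventParam θ j + z i j ⬝ᵥ γ

/-- The mean of a family `ν` of distributions on the line, as a function of the parameter. -/
def meanFun (ν : ℝ → Measure ℝ) (t : ℝ) : ℝ := ∫ y, y ∂(ν t)

/-- `μ_{ij}(θ, γ) = μ(π_{ij})`. -/
def meanMatrix (μ : ℝ → ℝ) (z : Fin m → Fin (q + 1) → Fin p → ℝ) (θ : Fin m ⊕ Fin q → ℝ)
    (γ : Fin p → ℝ) (i : Fin m) (j : Fin (q + 1)) : ℝ :=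
  μ (linPred z θ γ i j)

/-- The degree vector `g = (d_1, …, d_m, b_1, …, b_{n-1})` of a weight matrix. -/
def degreeVec (X : Fin m → Fin (q + 1) → ℝ) : Fin m ⊕ Fin q → ℝ
  | Sum.inl i => ∑ j, X i j
  | Sum.inr j => ∑ i, X i j.castSucc

/-- The remaining degree `g_{m+n} = b_n`. -/
def lastDegree (X : Fin m → Fin (q + 1) → ℝ) : ℝ := ∑ i, X i (Fin.last q)

/-- `F(θ, γ)`: expected minus observed degrees. -/
def momentF (μ : ℝ → ℝ) (z : Fin m → Fin (q + 1) → Fin p → ℝ) (X : Fin m → Fin (q + 1) → ℝ)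
    (θ : Fin m ⊕ Fin q → ℝ) (γ : Fin p → ℝ) : Fin m ⊕ Fin q → ℝ :=
  degreeVec (meanMatrix μ z θ γ) - degreeVec X

/-- `Q(θ, γ) = ∑_{i,j} z_{ij} (μ_{ij}(θ, γ) - x_{ij})`. -/
def momentQ (μ : ℝ → ℝ) (z : Fin m → Fin (q + 1) → Fin p → ℝ) (X : Fin m → Fin (q + 1) → ℝ)
    (θ : Fin m ⊕ Fin q → ℝ) (γ : Fin p → ℝ) : Fin p → ℝ :=
  ∑ i, ∑ j, (meanMatrix μ z θ γ i j - X i j) • z i j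

/-- `(θ, γ)` solves the moment equations for the data `X`. -/
def IsMomentSolution (μ : ℝ → ℝ) (z : Fin m → Fin (q + 1) → Fin p → ℝ)
    (X : Fin m → Fin (q + 1) → ℝ) (θ : Fin m ⊕ Fin q → ℝ) (γ : Fin p → ℝ) : Prop :=
  momentF μ z X θ γ = 0 ∧ momentQ μ z X θ γ = 0

/-- The matrix of partial derivatives `∂G_a/∂x_l`. -/
def jacobian {ι κ : Type*} [DecidableEq ι] (G : (ι → ℝ) → κ → ℝ) (x : ι → ℝ) : Matrix κ ι ℝ :=
  Matrix.of fun a l => deriv (fun t => G (Function.update x l t) a) (x l)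

/-- `V(θ, γ) = ∂F/∂θᵀ`.  The data enter `F` and `Q` only through an additive term that is free of
the parameters, so all Jacobians are computed with the data set to `0`. -/
def jacV (μ : ℝ → ℝ) (z : Fin m → Fin (q + 1) → Fin p → ℝ) (θ : Fin m ⊕ Fin q → ℝ)
    (γ : Fin p → ℝ) : Matrix (Fin m ⊕ Fin q) (Fin m ⊕ Fin q) ℝ :=
  jacobian (fun θ' => momentF μ z 0 θ' γ) θ

/-- `H(θ, γ) = ∂Q/∂γᵀ - ∂Q/∂θᵀ (∂F/∂θᵀ)⁻¹ ∂F/∂γᵀ`. -/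
def matH (μ : ℝ → ℝ) (z : Fin m → Fin (q + 1) → Fin p → ℝ) (θ : Fin m ⊕ Fin q → ℝ)
    (γ : Fin p → ℝ) : Matrix (Fin p) (Fin p) ℝ :=
  jacobian (fun γ' => momentQ μ z 0 θ γ') γ -
    jacobian (fun θ' => momentQ μ z 0 θ' γ) θ * (jacV μ z θ γ)⁻¹ *
      jacobian (fun γ' => momentF μ z 0 θ γ') γ

/-- The matrix norm induced by the `ℓ_∞` norm: the largest absolute row sum. -/
def rowSumNorm {ι κ : Type*} [Fintype κ] (A : Matrix ι κ ℝ) : ℝ := ⨆ i, ∑ j, |A i j|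

/-- The largest absolute entry. -/
def maxNorm {ι κ : Type*} (A : Matrix ι κ ℝ) : ℝ := ⨆ ij : ι × κ, |A ij.1 ij.2|

/-- `κ = sup_{θ ∈ B(θ*, ε)} ‖mn · H(θ, γ*)⁻¹‖_∞`. -/
def kappa (μ : ℝ → ℝ) (z : Fin m → Fin (q + 1) → Fin p → ℝ) (θs : Fin m ⊕ Fin q → ℝ)
    (γs : Fin p → ℝ) (ε : ℝ) : ℝ :=
  sSup ((fun θ => rowSumNorm (((m : ℝ) * ((q + 1 : ℕ) : ℝ)) • (matH μ z θ γs)⁻¹)) ''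
    Metric.closedBall θs ε)

/-- `v_{m+n,i} = v_{i,i} - ∑_{j ≠ i} v_{i,j}`. -/
def lastEntry (V : Matrix (Fin m ⊕ Fin q) (Fin m ⊕ Fin q) ℝ) (i : Fin m ⊕ Fin q) : ℝ :=
  V i i - ∑ j ∈ Finset.univ.erase i, V i j

/-- `v_{m+n,m+n} = ∑_i v_{m+n,i}`. -/
def lastDiag (V : Matrix (Fin m ⊕ Fin q) (Fin m ⊕ Fin q) ℝ) : ℝ := ∑ i, lastEntry V i

/-- The explicit approximation `S` of `V⁻¹`. -/
def matS (V : Matrix (Fin m ⊕ Fin q) (Fin m ⊕ Fin q) ℝ) :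
    Matrix (Fin m ⊕ Fin q) (Fin m ⊕ Fin q) ℝ :=
  Matrix.of fun
    | Sum.inl i, Sum.inl j =>
        (if i = j then 1 else 0) / V (Sum.inl i) (Sum.inl i) + 1 / lastDiag V
    | Sum.inl _, Sum.inr _ => -(1 / lastDiag V)
    | Sum.inr _, Sum.inl _ => -(1 / lastDiag V)
    | Sum.inr i, Sum.inr j =>
        (if i = j then 1 else 0) / V (Sum.inr i) (Sum.inr i) + 1 / lastDiag V

section Random

variable {Ω : Type*} [MeasurableSpace Ω]

/-- The degree vector of the random weight matrix at `ω`. -/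
def degreeAt (x : Fin m → Fin (q + 1) → Ω → ℝ) (ω : Ω) : Fin m ⊕ Fin q → ℝ :=
  degreeVec fun i j => x i j ω

/-- `E g`. -/
def meanDegree (x : Fin m → Fin (q + 1) → Ω → ℝ) (P : Measure Ω) (l : Fin m ⊕ Fin q) : ℝ :=
  ∫ ω, degreeAt x ω l ∂P

/-- `g_{m+n} - E g_{m+n}` at `ω`. -/
def lastDegreeCentered (x : Fin m → Fin (q + 1) → Ω → ℝ) (P : Measure Ω) (ω : Ω) : ℝ :=
  lastDegree (fun i j => x i j ω) - ∫ ω', lastDegree (fun i j => x i j ω') ∂P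

/-- `Cov(g)`. -/
def covDegree (x : Fin m → Fin (q + 1) → Ω → ℝ) (P : Measure Ω) :
    Matrix (Fin m ⊕ Fin q) (Fin m ⊕ Fin q) ℝ :=
  Matrix.of fun a b => covariance (fun ω => degreeAt x ω a) (fun ω => degreeAt x ω b) P

/-- `σ`, where `σ² = (m+n-1)² ‖(V⁻¹ - S) Cov(g) (V⁻¹ - S)‖_max`; here `m + n - 1 = m + q`. -/
def sigma (V : Matrix (Fin m ⊕ Fin q) (Fin m ⊕ Fin q) ℝ) (x : Fin m → Fin (q + 1) → Ω → ℝ)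
    (P : Measure Ω) : ℝ :=
  Real.sqrt (((m : ℝ) + q) ^ 2 * maxNorm ((V⁻¹ - matS V) * covDegree x P * (V⁻¹ - matS V)))

/-- `Y` is sub-exponential with parameter `h`:
`E exp(s (Y - E Y)) ≤ exp(s² h² / 2)` for `|s| < 1 / h`. -/
def IsSubExponential (Y : Ω → ℝ) (h : ℝ) (P : Measure Ω) : Prop :=
  0 < h ∧ Integrable Y P ∧ ∀ s : ℝ, |s| < 1 / h →
    Integrable (fun ω => Real.exp (s * (Y ω - ∫ ω', Y ω' ∂P))) P ∧
      ∫ ω, Real.exp (s * (Y ω - ∫ ω', Y ω' ∂P)) ∂P ≤ Real.exp (s ^ 2 * h ^ 2 / 2)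

end Random

/-- The conditions on the derivatives of the mean function over `B(θ*, ε₁) × B(γ*, ε₂)`: `μ` is
three times differentiable at all the `π_{ij}`, the `μ'(π_{ij})` are nonzero with a common sign
(equivalently, the product of their minimum and maximum is positive), and the derivatives are
bounded by `b₀, b₁, b₂, b₃`. -/
def DerivBounds (μ : ℝ → ℝ) (z : Fin m → Fin (q + 1) → Fin p → ℝ) (θs : Fin m ⊕ Fin q → ℝ)
    (γs : Fin p → ℝ) (ε₁ ε₂ b₀ b₁ b₂ b₃ : ℝ) : Prop :=
  ∀ θ ∈ Metric.closedBall θs ε₁, ∀ γ ∈ Metric.closedBall γs ε₂,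
    (∀ i j, ∀ r < 3, DifferentiableAt ℝ (iteratedDeriv r μ) (linPred z θ γ i j)) ∧
    (∀ i j i' j', 0 < deriv μ (linPred z θ γ i j) * deriv μ (linPred z θ γ i' j')) ∧
    ∀ i j, b₀ ≤ |deriv μ (linPred z θ γ i j)| ∧ |deriv μ (linPred z θ γ i j)| ≤ b₁ ∧
      |iteratedDeriv 2 μ (linPred z θ γ i j)| ≤ b₂ ∧
      |iteratedDeriv 3 μ (linPred z θ γ i j)| ≤ b₃

/-- `(θ, γ)` solves the moment equations and lies in `B(θ*, ε₁) × B(γ*, ε₂)`. -/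
def IsLocalMomentSolution (μ : ℝ → ℝ) (z : Fin m → Fin (q + 1) → Fin p → ℝ)
    (θs : Fin m ⊕ Fin q → ℝ) (γs : Fin p → ℝ) (ε₁ ε₂ : ℝ) (X : Fin m → Fin (q + 1) → ℝ)
    (θ : Fin m ⊕ Fin q → ℝ) (γ : Fin p → ℝ) : Prop :=
  IsMomentSolution μ z X θ γ ∧ θ ∈ Metric.closedBall θs ε₁ ∧ γ ∈ Metric.closedBall γs ε₂

end BipartiteNetwork

end

open BipartiteNetwork

/-!
Write `π*` for the true linear predictors, `w = μ'(π*)`, and `ε_{ij} = x_{ij} - E x_{ij}`.  Up to the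
common sign of the derivatives, all the weights `μ'(π_{ij})` in the box lie in `[b₀, b₁]`.

*A weighted least squares problem.*  By the mean value theorem, a solution `(θ, γ)` of the moment
equations in the box satisfies the *linear* equations
`∑ w̄_{ij} (π_{ij} - π*_{ij}) y_{ij} = ∑ ε_{ij} y_{ij}`, for `y` an array `α_i + β_j` or a covariate,
with mean value weights `w̄` that differ from `w` by at most `b₂ |π - π*|`.  These are the normal
equations of a weighted least squares problem on the complete bipartite graph, and `H` is the Gram
matrix of the covariates after the additive arrays have been projected out.

*Degrees.*  The operator that averages over rows and then over columns with weights in `[b₀, b₁]`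
contracts oscillations, because every weighted average contains a multiple `b₀ / b₁` of the plain
average (`weighted_sum_le`).  This gives a sup-norm bound for `V⁻¹`, of the order of `b₁ / b₀` times
the largest degree divided by its weight (`abs_le_of_weighted_degrees`).

*Covariates.*  By the Cauchy--Schwarz inequality `κ` controls the quadratic form of `H` at the truth
(`sq_le_kappa_mul`); the supremum that defines `κ` is finite as the matrices `H(θ, γ*)` are mutually
comparable in the Loewner order.  In the resulting bound for `γ - γ*` (`norm_snd_le`) the difference
between `w̄` and `w` enters only multiplied by the size of the noise, so that the bound holds for
every solution in the box, with no preliminary localization.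

*Noise.*  The row and column sums of `ε` are at most `2 h_max √(m log m)` with high probability, by
the Chernoff bound (`measure_not_degrees_le`).  The scores, that is the inner products of `ε` with
the projected covariates, are controlled by Chebyshev's inequality.  Their variances are bounded by
`σ²`: the identity `total_mul_addArr_error` expresses the sum of all `ε_{ij}` through the vector
`(V⁻¹ - S)(g - E g)`, whose coordinates have variance at most `σ² / (m + n - 1)²`, and so
`total_variance_le` bounds the sum of the edge variances.  The difference between `V⁻¹ (g - E g)` and
the leading term `S (g - E g)` is treated by Chebyshev's inequality as well.

*Existence and uniqueness.*  Two solutions in the box differ by an element of the kernel of a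
positive definite matrix (`moment_unique`).  For existence the noise is scaled by `t ∈ [0, 1]`.  At
`t = 0` the truth is a solution; the set of solvable `t` is closed by compactness, and open because
the a priori bounds keep every solution in the interior of the box, where the moment map is a local
homeomorphism (`exists_moment_solution`).
-/

namespace BipartiteNetwork

variable {m q p : ℕ}

/-! ### Additive arrays, degrees and weighted Laplacians -/

/-- The additive array `(i, j) ↦ α_i + β_j` (with `β_n = 0`) of a parameter vector. -/
def addArr : (Fin m ⊕ Fin q → ℝ) →ₗ[ℝ] (Fin m → Fin (q + 1) → ℝ) where
  toFun u i j := u (Sum.inl i) + eventParam u j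
  map_add' u v := by
    ext i j
    refine Fin.lastCases ?_ (fun j => ?_) j <;> simp [eventParam]
    ring
  map_smul' c u := by
    ext i j
    refine Fin.lastCases ?_ (fun j => ?_) j <;> simp [eventParam]
    ring

/-- `degreeVec` as a linear map. -/
def degreeLin : (Fin m → Fin (q + 1) → ℝ) →ₗ[ℝ] (Fin m ⊕ Fin q → ℝ) where
  toFun := degreeVec
  map_add' X Y := by
    ext (i | j) <;> simp [degreeVec, Finset.sum_add_distrib]
  map_smul' c X := by
    ext (i | j) <;> simp [degreeVec, Finset.mul_sum]

/-- The sum of all entries of an array, as a linear map. -/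
def total : (Fin m → Fin (q + 1) → ℝ) →ₗ[ℝ] ℝ where
  toFun X := ∑ i, ∑ j, X i j
  map_add' X Y := by simp [Finset.sum_add_distrib]
  map_smul' c X := by simp [Finset.mul_sum]

theorem addArr_castSucc (u : Fin m ⊕ Fin q → ℝ) (i : Fin m) (j : Fin q) :
    addArr u i j.castSucc = u (Sum.inl i) + u (Sum.inr j) := by
  simp [addArr, eventParam]

theorem addArr_last (u : Fin m ⊕ Fin q → ℝ) (i : Fin m) :
    addArr u i (Fin.last q) = u (Sum.inl i) := by
  simp [addArr, eventParam]

theorem total_apply (X : Fin m → Fin (q + 1) → ℝ) : total X = ∑ i, ∑ j, X i j := rfl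

theorem degreeLin_apply (X : Fin m → Fin (q + 1) → ℝ) : degreeLin X = degreeVec X := rfl

theorem linPred_eq (z : Fin m → Fin (q + 1) → Fin p → ℝ) (θ : Fin m ⊕ Fin q → ℝ)
    (γ : Fin p → ℝ) (i : Fin m) (j : Fin (q + 1)) :
    linPred z θ γ i j = addArr θ i j + z i j ⬝ᵥ γ := rfl

theorem total_eq_sum_castSucc (X : Fin m → Fin (q + 1) → ℝ) :
    total X = ∑ j : Fin q, ∑ i, X i j.castSucc + ∑ i, X i (Fin.last q) := by
  rw [total_apply, Finset.sum_comm, Fin.sum_univ_castSucc]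

theorem sum_last_col (X : Fin m → Fin (q + 1) → ℝ) :
    ∑ i, X i (Fin.last q) =
      ∑ i, degreeVec X (Sum.inl i) - ∑ j, degreeVec X (Sum.inr j) := by
  have := total_eq_sum_castSucc X
  rw [total_apply] at this
  simp only [degreeVec]
  linarith

/-- Taking degrees is the transpose of forming additive arrays. -/
theorem degreeVec_dotProduct (X : Fin m → Fin (q + 1) → ℝ) (u : Fin m ⊕ Fin q → ℝ) :
    degreeVec X ⬝ᵥ u = total (X * addArr u) := by
  rw [total_apply]
  simp only [dotProduct, Fintype.sum_sum_type, degreeVec, Pi.mul_apply, Fin.sum_univ_castSucc,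
    addArr_castSucc, addArr_last, Finset.sum_add_distrib, mul_add, Finset.sum_mul, add_mul]
  rw [Finset.sum_comm (s := (Finset.univ : Finset (Fin q)))]
  ring

theorem row_col_eq_zero {X : Fin m → Fin (q + 1) → ℝ} (h : degreeVec X = 0) :
    (∀ i, ∑ j, X i j = 0) ∧ ∀ j, ∑ i, X i j = 0 := by
  refine ⟨fun i => congrFun h (Sum.inl i), fun j => ?_⟩
  refine Fin.lastCases ?_ (fun j => congrFun h (Sum.inr j)) j
  rw [sum_last_col, h]; simp

/-- The weighted Laplacian of the complete bipartite graph, grounded at the last event and with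
the signs of the events flipped: the Jacobian of the degrees when `μ'` takes the values `w`. -/
def lapMat (w : Fin m → Fin (q + 1) → ℝ) : Matrix (Fin m ⊕ Fin q) (Fin m ⊕ Fin q) ℝ :=
  LinearMap.toMatrix' (degreeLin ∘ₗ LinearMap.mulLeft ℝ w ∘ₗ addArr)

theorem lapMat_mulVec (w : Fin m → Fin (q + 1) → ℝ) (u : Fin m ⊕ Fin q → ℝ) :
    lapMat w *ᵥ u = degreeVec (w * addArr u) := by
  rw [lapMat, LinearMap.toMatrix'_mulVec]; rfl

theorem lapMat_apply (w : Fin m → Fin (q + 1) → ℝ) (a l : Fin m ⊕ Fin q) :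
    lapMat w a l = degreeVec (w * addArr (Pi.single l 1)) a := by
  rw [← lapMat_mulVec, Matrix.mulVec_single_one]; rfl

theorem lapMat_inl_inl (w : Fin m → Fin (q + 1) → ℝ) (i i' : Fin m) :
    lapMat w (Sum.inl i) (Sum.inl i') = if i = i' then ∑ j, w i j else 0 := by
  rw [lapMat_apply]
  simp only [degreeVec, Pi.mul_apply, Fin.sum_univ_castSucc, addArr_castSucc, addArr_last]
  by_cases h : i = i' <;> simp [h]

theorem lapMat_inl_inr (w : Fin m → Fin (q + 1) → ℝ) (i : Fin m) (j : Fin q) :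
    lapMat w (Sum.inl i) (Sum.inr j) = w i j.castSucc := by
  rw [lapMat_apply]
  simp [degreeVec, Pi.mul_apply, Fin.sum_univ_castSucc, addArr_castSucc, addArr_last,
    Pi.single_apply]

theorem lapMat_inr_inl (w : Fin m → Fin (q + 1) → ℝ) (i : Fin m) (j : Fin q) :
    lapMat w (Sum.inr j) (Sum.inl i) = w i j.castSucc := by
  rw [lapMat_apply]
  simp [degreeVec, Pi.mul_apply, addArr_castSucc, Pi.single_apply]

theorem lapMat_inr_inr (w : Fin m → Fin (q + 1) → ℝ) (j j' : Fin q) :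
    lapMat w (Sum.inr j) (Sum.inr j') = if j = j' then ∑ i, w i j.castSucc else 0 := by
  rw [lapMat_apply]
  simp only [degreeVec, Pi.mul_apply, addArr_castSucc]
  by_cases h : j = j' <;> simp [h]

theorem lapMat_isSymm (w : Fin m → Fin (q + 1) → ℝ) : (lapMat w).IsSymm := by
  ext (i | i) (j | j)
  · simp only [Matrix.transpose_apply, lapMat_inl_inl]
    by_cases h : i = j
    · simp [h]
    · simp [h, Ne.symm h]
  · simp only [Matrix.transpose_apply, lapMat_inl_inr, lapMat_inr_inl]
  · simp only [Matrix.transpose_apply, lapMat_inl_inr, lapMat_inr_inl]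
  · simp only [Matrix.transpose_apply, lapMat_inr_inr]
    by_cases h : i = j
    · simp [h]
    · simp [h, Ne.symm h]

theorem matS_isSymm (V : Matrix (Fin m ⊕ Fin q) (Fin m ⊕ Fin q) ℝ) : (matS V).IsSymm := by
  ext (i | i) (j | j)
  · by_cases h : i = j
    · simp [h]
    · simp [matS, h, Ne.symm h]
  · simp [matS]
  · simp [matS]
  · by_cases h : i = j
    · simp [h]
    · simp [matS, h, Ne.symm h]

theorem addArr_injective (hm : 0 < m) :
    Function.Injective (addArr : (Fin m ⊕ Fin q → ℝ) →ₗ[ℝ] _) := by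
  rw [← LinearMap.ker_eq_bot, LinearMap.ker_eq_bot']
  intro u hu
  have hl : ∀ i, u (Sum.inl i) = 0 := fun i => by
    rw [← addArr_last u i, hu]; rfl
  ext (i | j)
  · exact hl i
  · have := addArr_castSucc u ⟨0, hm⟩ j
    rw [hu, hl] at this
    simpa using this.symm

theorem total_mul_sq_nonneg {w : Fin m → Fin (q + 1) → ℝ} (hw : ∀ i j, 0 < w i j)
    (y : Fin m → Fin (q + 1) → ℝ) : 0 ≤ total (w * y * y) := by
  rw [total_apply]
  refine Finset.sum_nonneg fun i _ => Finset.sum_nonneg fun j _ => ?_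
  have := hw i j
  simp only [Pi.mul_apply, mul_assoc]
  exact mul_nonneg this.le (mul_self_nonneg _)

theorem eq_zero_of_total_mul_sq {w : Fin m → Fin (q + 1) → ℝ} (hw : ∀ i j, 0 < w i j)
    {y : Fin m → Fin (q + 1) → ℝ} (h : total (w * y * y) = 0) : y = 0 := by
  have hn : ∀ i j, 0 ≤ (w * y * y) i j := fun i j => by
    simp only [Pi.mul_apply, mul_assoc]
    exact mul_nonneg (hw i j).le (mul_self_nonneg _)
  rw [total_apply, Finset.sum_eq_zero_iff_of_nonneg
    (fun i _ => Finset.sum_nonneg fun j _ => hn i j)] at h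
  ext i j
  have h1 := h i (Finset.mem_univ _)
  rw [Finset.sum_eq_zero_iff_of_nonneg (fun j _ => hn i j)] at h1
  have h2 := h1 j (Finset.mem_univ _)
  have := (hw i j).ne'
  simp only [Pi.mul_apply] at h2
  simpa [this] using h2

theorem lapMat_isUnit_det (hm : 0 < m) {w : Fin m → Fin (q + 1) → ℝ} (hw : ∀ i j, 0 < w i j) :
    IsUnit (lapMat w).det := by
  rw [← Matrix.isUnit_iff_isUnit_det, ← Matrix.mulVec_injective_iff_isUnit]
  intro u v huv
  have h : lapMat w *ᵥ (u - v) = 0 := by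
    rw [Matrix.mulVec_sub]; exact sub_eq_zero.2 huv
  rw [lapMat_mulVec] at h
  have h2 := degreeVec_dotProduct (w * addArr (u - v)) (u - v)
  rw [h, zero_dotProduct] at h2
  have h3 := eq_zero_of_total_mul_sq hw h2.symm
  have := addArr_injective hm (h3.trans (map_zero addArr).symm)
  exact sub_eq_zero.1 this

theorem lapMat_smul (s : ℝ) (w : Fin m → Fin (q + 1) → ℝ) : lapMat (s • w) = s • lapMat w := by
  ext a l
  rw [Matrix.smul_apply, lapMat_apply, lapMat_apply, ← degreeLin_apply, ← degreeLin_apply,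
    smul_mul_assoc, map_smul]; rfl

theorem lastEntry_eq (V : Matrix (Fin m ⊕ Fin q) (Fin m ⊕ Fin q) ℝ) (a : Fin m ⊕ Fin q) :
    lastEntry V a = 2 * V a a - ∑ l, V a l := by
  rw [lastEntry, ← Finset.add_sum_erase _ _ (Finset.mem_univ a)]; ring

theorem lastDiag_lapMat (w : Fin m → Fin (q + 1) → ℝ) :
    lastDiag (lapMat w) = ∑ i, w i (Fin.last q) := by
  simp only [lastDiag, lastEntry_eq, Fintype.sum_sum_type, lapMat_inl_inl, lapMat_inl_inr,
    lapMat_inr_inl, lapMat_inr_inr, if_true]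
  simp only [Finset.sum_ite_eq, Finset.mem_univ, if_true, Finset.sum_sub_distrib,
    Finset.sum_add_distrib, Fin.sum_univ_castSucc, ← Finset.mul_sum]
  rw [Finset.sum_comm (s := (Finset.univ : Finset (Fin q)))]
  ring

/-- The explicit form of `S g`, where the last degree is expressed through the free ones. -/
theorem matS_mulVec_inl (V : Matrix (Fin m ⊕ Fin q) (Fin m ⊕ Fin q) ℝ) (g : Fin m ⊕ Fin q → ℝ)
    (i : Fin m) : (matS V *ᵥ g) (Sum.inl i) = g (Sum.inl i) / V (Sum.inl i) (Sum.inl i) +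
      (∑ i, g (Sum.inl i) - ∑ j, g (Sum.inr j)) / lastDiag V := by
  simp only [Matrix.mulVec, dotProduct, matS, Matrix.of_apply, Fintype.sum_sum_type, add_mul,
    Finset.sum_add_distrib, ite_div, ite_mul, zero_div, zero_mul, Finset.sum_ite_eq,
    Finset.mem_univ, if_true, ← Finset.mul_sum]
  ring

theorem matS_mulVec_inr (V : Matrix (Fin m ⊕ Fin q) (Fin m ⊕ Fin q) ℝ) (g : Fin m ⊕ Fin q → ℝ)
    (j : Fin q) : (matS V *ᵥ g) (Sum.inr j) = g (Sum.inr j) / V (Sum.inr j) (Sum.inr j) -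
      (∑ i, g (Sum.inl i) - ∑ j, g (Sum.inr j)) / lastDiag V := by
  simp only [Matrix.mulVec, dotProduct, matS, Matrix.of_apply, Fintype.sum_sum_type, add_mul,
    Finset.sum_add_distrib, ite_div, ite_mul, zero_div, zero_mul, Finset.sum_ite_eq,
    Finset.mem_univ, if_true, ← Finset.mul_sum]
  ring

/-- The additive array of `S g` is balanced: it treats the last event like all the others. -/
theorem addArr_matS_mulVec (w X : Fin m → Fin (q + 1) → ℝ) (i : Fin m) (j : Fin (q + 1)) :
    addArr (matS (lapMat w) *ᵥ degreeVec X) i j =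
      (∑ j, X i j) / ∑ j, w i j + (∑ i, X i j) / ∑ i, w i j := by
  refine Fin.lastCases ?_ (fun j => ?_) j
  · rw [addArr_last, matS_mulVec_inl, ← sum_last_col, lastDiag_lapMat, lapMat_inl_inl, if_pos rfl]
    rfl
  · rw [addArr_castSucc, matS_mulVec_inl, matS_mulVec_inr, lapMat_inl_inl, if_pos rfl,
      lapMat_inr_inr, if_pos rfl]
    simp only [degreeVec]
    ring

/-- The error `V⁻¹ - S` does not annihilate any edge: tested against the weights, it returns minus
the sum of the array.  This is what bounds the edge variances by `σ²`. -/
theorem total_mul_addArr_error (hm : 0 < m) {w : Fin m → Fin (q + 1) → ℝ}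
    (hw : ∀ i j, 0 < w i j) (X : Fin m → Fin (q + 1) → ℝ) :
    total (w * addArr (((lapMat w)⁻¹ - matS (lapMat w)) *ᵥ degreeVec X)) = -total X := by
  have hne : Nonempty (Fin m) := ⟨⟨0, hm⟩⟩
  have h1 : total (w * addArr ((lapMat w)⁻¹ *ᵥ degreeVec X)) = total X := by
    have h := lapMat_mulVec w ((lapMat w)⁻¹ *ᵥ degreeVec X)
    rw [Matrix.mulVec_mulVec, Matrix.mul_nonsing_inv _ (lapMat_isUnit_det hm hw),
      Matrix.one_mulVec] at h
    rw [total_apply, total_apply]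
    exact Finset.sum_congr rfl fun i _ => (congrFun h (Sum.inl i)).symm
  have h2 : total (w * addArr (matS (lapMat w) *ᵥ degreeVec X)) = total X + total X := by
    have hr : ∀ i, ∑ j, w i j ≠ 0 := fun i =>
      (Finset.sum_pos (fun j _ => hw i j) Finset.univ_nonempty).ne'
    have hc : ∀ j, ∑ i, w i j ≠ 0 := fun j =>
      (Finset.sum_pos (fun i _ => hw i j) Finset.univ_nonempty).ne'
    simp only [total_apply, Pi.mul_apply, addArr_matS_mulVec, mul_add, Finset.sum_add_distrib]
    congr 1
    · refine Finset.sum_congr rfl fun i _ => ?_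
      rw [← Finset.sum_mul, mul_div_cancel₀ _ (hr i)]
    · rw [Finset.sum_comm, Finset.sum_comm (f := fun i j => X i j)]
      refine Finset.sum_congr rfl fun i _ => ?_
      rw [← Finset.sum_mul, mul_div_cancel₀ _ (hc i)]
  rw [Matrix.sub_mulVec, map_sub, mul_sub, map_sub, h1, h2]
  ring

/-! ### Sup-norm bounds for weighted additive least squares -/

/-- A weighted average with weights between `b₀` and `b₁` contains the plain average with
coefficient at least `b₀ / b₁`. -/
theorem weighted_sum_le {κ : Type*} [Fintype κ] [Nonempty κ] {b₀ b₁ U : ℝ} {v x : κ → ℝ}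
    (hb₀ : 0 < b₀) (hv₀ : ∀ j, b₀ ≤ v j) (hv₁ : ∀ j, v j ≤ b₁) (hU : ∀ j, x j ≤ U) :
    (∑ j, v j * x j) / ∑ j, v j ≤
      b₀ / b₁ * ((∑ j, x j) / Fintype.card κ) + (1 - b₀ / b₁) * U := by
  obtain ⟨j₀⟩ := (inferInstance : Nonempty κ)
  have hb₁ : 0 < b₁ := hb₀.trans_le ((hv₀ j₀).trans (hv₁ j₀))
  have hn : (0 : ℝ) < Fintype.card κ := by exact_mod_cast Fintype.card_pos
  have hs : 0 < ∑ j, v j :=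
    Finset.sum_pos (fun j _ => hb₀.trans_le (hv₀ j)) Finset.univ_nonempty
  have hs1 : ∑ j, v j ≤ Fintype.card κ * b₁ := by
    simpa using Finset.sum_le_card_nsmul Finset.univ v b₁ fun j _ => hv₁ j
  have h1 : ∑ j, v j * (U - x j) ≥ b₀ * ∑ j, (U - x j) := by
    rw [Finset.mul_sum]
    exact Finset.sum_le_sum fun j _ =>
      mul_le_mul_of_nonneg_right (hv₀ j) (sub_nonneg.2 (hU j))
  have h2 : 0 ≤ ∑ j, (U - x j) := Finset.sum_nonneg fun j _ => sub_nonneg.2 (hU j)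
  have h3 : (∑ j, v j * (U - x j)) / ∑ j, v j ≥
      b₀ * (∑ j, (U - x j)) / (Fintype.card κ * b₁) := by
    refine le_trans (div_le_div_of_nonneg_left (by positivity) hs hs1) ?_
    exact div_le_div_of_nonneg_right h1 hs.le
  have h4 : (∑ j, v j * (U - x j)) / ∑ j, v j = U - (∑ j, v j * x j) / ∑ j, v j := by
    simp only [mul_sub, Finset.sum_sub_distrib, ← Finset.sum_mul]
    field_simp
  have h5 : b₀ * (∑ j, (U - x j)) / (Fintype.card κ * b₁) =
      b₀ / b₁ * (U - (∑ j, x j) / Fintype.card κ) := by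
    rw [Finset.sum_sub_distrib]
    simp only [Finset.sum_const, Finset.card_univ, nsmul_eq_mul]
    field_simp
  rw [h4, h5] at h3
  linarith

/-- Two weighted averages of the same numbers differ by at most `1 - b₀ / b₁` times their
oscillation. -/
theorem weighted_sum_sub_le {κ : Type*} [Fintype κ] [Nonempty κ] {b₀ b₁ U L : ℝ}
    {v v' x : κ → ℝ} (hb₀ : 0 < b₀) (hv₀ : ∀ j, b₀ ≤ v j) (hv₁ : ∀ j, v j ≤ b₁)
    (hv₀' : ∀ j, b₀ ≤ v' j) (hv₁' : ∀ j, v' j ≤ b₁) (hU : ∀ j, x j ≤ U) (hL : ∀ j, L ≤ x j) :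
    (∑ j, v j * x j) / ∑ j, v j - (∑ j, v' j * x j) / ∑ j, v' j ≤ (1 - b₀ / b₁) * (U - L) := by
  have h1 := weighted_sum_le hb₀ hv₀ hv₁ hU
  have h2 := weighted_sum_le (x := -x) (U := -L) hb₀ hv₀' hv₁' fun j => neg_le_neg (hL j)
  simp only [Pi.neg_apply, mul_neg, Finset.sum_neg_distrib, neg_div] at h2
  linarith

theorem sub_le_of_weighted_rows {ι κ : Type*} [Fintype κ] [Nonempty κ]
    {b₀ b₁ τ U L : ℝ} {w : ι → κ → ℝ} {α : ι → ℝ} {β : κ → ℝ} (hb₀ : 0 < b₀)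
    (hw₀ : ∀ i j, b₀ ≤ w i j) (hw₁ : ∀ i j, w i j ≤ b₁)
    (hr : ∀ i, |∑ j, w i j * (α i + β j)| ≤ τ * ∑ j, w i j)
    (hU : ∀ j, β j ≤ U) (hL : ∀ j, L ≤ β j) (i i' : ι) :
    α i - α i' ≤ 2 * τ + (1 - b₀ / b₁) * (U - L) := by
  have key : ∀ i, |α i + (∑ j, w i j * β j) / ∑ j, w i j| ≤ τ := fun i => by
    have hs : 0 < ∑ j, w i j :=
      Finset.sum_pos (fun j _ => hb₀.trans_le (hw₀ i j)) Finset.univ_nonempty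
    have h := hr i
    have e : ∑ j, w i j * (α i + β j) =
        (α i + (∑ j, w i j * β j) / ∑ j, w i j) * ∑ j, w i j := by
      simp only [mul_add, Finset.sum_add_distrib, ← Finset.sum_mul, add_mul]
      rw [div_mul_cancel₀ _ hs.ne']; ring
    rw [e, abs_mul, abs_of_pos hs] at h
    exact le_of_mul_le_mul_right h hs
  have h1 := abs_le.1 (key i)
  have h2 := abs_le.1 (key i')
  have h3 := weighted_sum_sub_le (x := β) hb₀ (hw₀ i') (hw₁ i') (hw₀ i) (hw₁ i) hU hL
  linarith [h1.2, h2.1]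

/-- If all row sums and column sums of `w_{ij} (α_i + β_j)` are small, then so are the oscillations
of `α` and of `β`: by the averaging bound each oscillation is at most `2τ` plus `1 - b₀ / b₁` times
the other one. -/
theorem osc_add_osc_le {ι κ : Type*} [Fintype ι] [Fintype κ] [Nonempty ι] [Nonempty κ]
    {b₀ b₁ τ : ℝ} {w : ι → κ → ℝ} {α : ι → ℝ} {β : κ → ℝ} (hb₀ : 0 < b₀)
    (hw₀ : ∀ i j, b₀ ≤ w i j) (hw₁ : ∀ i j, w i j ≤ b₁)
    (hr : ∀ i, |∑ j, w i j * (α i + β j)| ≤ τ * ∑ j, w i j)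
    (hc : ∀ j, |∑ i, w i j * (α i + β j)| ≤ τ * ∑ i, w i j) (i i' : ι) (j j' : κ) :
    (α i - α i') + (β j - β j') ≤ 4 * τ * (b₁ / b₀) := by
  obtain ⟨i₁, hi₁⟩ := Finite.exists_max α
  obtain ⟨i₀, hi₀⟩ := Finite.exists_min α
  obtain ⟨j₁, hj₁⟩ := Finite.exists_max β
  obtain ⟨j₀, hj₀⟩ := Finite.exists_min β
  have hb₁ : 0 < b₁ := hb₀.trans_le ((hw₀ i j).trans (hw₁ i j))
  have h1 := sub_le_of_weighted_rows hb₀ hw₀ hw₁ hr hj₁ hj₀ i₁ i₀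
  have h2 := sub_le_of_weighted_rows (w := fun j i => w i j) (α := β) (β := α) (τ := τ) hb₀
    (fun j i => hw₀ i j) (fun j i => hw₁ i j) (fun j => by simpa only [add_comm (β j)] using hc j)
    hi₁ hi₀ j₁ j₀
  have h3 : b₀ / b₁ * ((α i₁ - α i₀) + (β j₁ - β j₀)) ≤ 4 * τ := by linarith
  have h4 : (α i₁ - α i₀) + (β j₁ - β j₀) ≤ 4 * τ * (b₁ / b₀) := by
    rw [div_mul_eq_mul_div, div_le_iff₀ hb₁] at h3
    rw [mul_div_assoc', le_div_iff₀ hb₀]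
    linarith
  linarith [hi₁ i, hi₀ i', hj₁ j, hj₀ j']

/-- The inverse of the weighted Laplacian is bounded in sup norm by `5 b₁ / b₀`, relative to the
degrees of the weights. -/
theorem abs_le_of_weighted_degrees {b₀ b₁ τ : ℝ} {w : Fin m → Fin (q + 1) → ℝ}
    {u : Fin m ⊕ Fin q → ℝ} (hb₀ : 0 < b₀) (hw₀ : ∀ i j, b₀ ≤ w i j) (hw₁ : ∀ i j, w i j ≤ b₁)
    (hr : ∀ i, |∑ j, w i j * addArr u i j| ≤ τ * ∑ j, w i j)
    (hc : ∀ j, |∑ i, w i j * addArr u i j| ≤ τ * ∑ i, w i j) (hm : 0 < m)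
    (l : Fin m ⊕ Fin q) : |u l| ≤ 5 * (b₁ / b₀) * τ := by
  have hne : Nonempty (Fin m) := ⟨⟨0, hm⟩⟩
  let i₀ : Fin m := ⟨0, hm⟩
  have hb₁ : 0 < b₁ := hb₀.trans_le ((hw₀ i₀ 0).trans (hw₁ i₀ 0))
  have hB : 1 ≤ b₁ / b₀ := (one_le_div hb₀).2 ((hw₀ i₀ 0).trans (hw₁ i₀ 0))
  have hs : ∀ i, 0 < ∑ j, w i j := fun i =>
    Finset.sum_pos (fun j _ => hb₀.trans_le (hw₀ i j)) Finset.univ_nonempty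
  have hτ : 0 ≤ τ := by
    have := (abs_nonneg _).trans (hr i₀)
    exact nonneg_of_mul_nonneg_left this (hs i₀)
  have hosc := osc_add_osc_le (α := fun i => u (Sum.inl i)) (β := eventParam u) hb₀ hw₀ hw₁ hr hc
  have hβ : ∀ j, |eventParam u j| ≤ 4 * τ * (b₁ / b₀) := fun j => by
    have h1 := hosc i₀ i₀ j (Fin.last q)
    have h2 := hosc i₀ i₀ (Fin.last q) j
    have h0 : eventParam u (Fin.last q) = 0 := by simp [eventParam]
    rw [abs_le]; constructor <;> linarith
  rcases l with i | j
  · have h := hr i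
    have hle : |∑ j, w i j * eventParam u j| ≤ 4 * τ * (b₁ / b₀) * ∑ j, w i j := by
      refine (Finset.abs_sum_le_sum_abs _ _).trans ?_
      rw [Finset.mul_sum]
      refine Finset.sum_le_sum fun j _ => ?_
      rw [abs_mul, abs_of_pos (hb₀.trans_le (hw₀ i j)), mul_comm]
      exact mul_le_mul_of_nonneg_right (hβ j) (hb₀.trans_le (hw₀ i j)).le
    have e : ∑ j, w i j * addArr u i j =
        u (Sum.inl i) * ∑ j, w i j + ∑ j, w i j * eventParam u j := by
      rw [Finset.mul_sum, ← Finset.sum_add_distrib]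
      refine Finset.sum_congr rfl fun j _ => ?_
      simp only [addArr, LinearMap.coe_mk, AddHom.coe_mk]; ring
    have h2 : |u (Sum.inl i)| * ∑ j, w i j ≤ (5 * (b₁ / b₀) * τ) * ∑ j, w i j := by
      rw [← abs_of_pos (hs i), ← abs_mul, abs_of_pos (hs i)]
      have e2 : u (Sum.inl i) * ∑ j, w i j =
          (∑ j, w i j * addArr u i j) - ∑ j, w i j * eventParam u j := by rw [e]; ring
      rw [e2]
      refine (abs_sub _ _).trans ?_
      have : τ * ∑ j, w i j ≤ b₁ / b₀ * τ * ∑ j, w i j := by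
        have := mul_le_mul_of_nonneg_right hB (mul_nonneg hτ (hs i).le)
        linarith
      linarith
    exact le_of_mul_le_mul_right h2 (hs i)
  · have h := hβ j.castSucc
    have e : eventParam u j.castSucc = u (Sum.inr j) := by simp [eventParam]
    rw [e] at h
    have : 0 ≤ b₁ / b₀ * τ := mul_nonneg (by linarith) hτ
    linarith

theorem abs_addArr_le {u : Fin m ⊕ Fin q → ℝ} {c : ℝ} (h : ∀ l, |u l| ≤ c) (i : Fin m)
    (j : Fin (q + 1)) : |addArr u i j| ≤ 2 * c := by
  have hc : 0 ≤ c := (abs_nonneg _).trans (h (Sum.inl i))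
  refine Fin.lastCases ?_ (fun j => ?_) j
  · rw [addArr_last]; linarith [h (Sum.inl i)]
  · rw [addArr_castSucc]
    exact (abs_add_le _ _).trans (by linarith [h (Sum.inl i), h (Sum.inr j)])

/-- The sup-norm bound in the form used throughout: `w · addArr u` has the same degrees as an
array `G` whose entries are dominated by the weights plus an array with small degrees. -/
theorem abs_le_of_degreeVec_eq {b₀ b₁ τ ρ : ℝ} {w G ε : Fin m → Fin (q + 1) → ℝ}
    {u : Fin m ⊕ Fin q → ℝ} (hb₀ : 0 < b₀) (hw₀ : ∀ i j, b₀ ≤ w i j) (hw₁ : ∀ i j, w i j ≤ b₁)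
    (hm : 0 < m) (hu : degreeVec (w * addArr u - G - ε) = 0)
    (hG : ∀ i j, |G i j| ≤ ρ * w i j) (hτ : 0 ≤ τ)
    (hεr : ∀ i, |∑ j, ε i j| ≤ ((q + 1 : ℕ) : ℝ) * τ) (hεc : ∀ j, |∑ i, ε i j| ≤ (m : ℝ) * τ)
    (l : Fin m ⊕ Fin q) : |u l| ≤ 5 * (b₁ / b₀) * (ρ + τ / b₀) := by
  obtain ⟨hr, hc⟩ := row_col_eq_zero hu
  refine abs_le_of_weighted_degrees hb₀ hw₀ hw₁ (fun i => ?_) (fun j => ?_) hm l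
  · have e : ∑ j, w i j * addArr u i j = ∑ j, G i j + ∑ j, ε i j := by
      have := hr i
      simp only [Pi.sub_apply, Pi.mul_apply, Finset.sum_sub_distrib] at this
      linarith
    rw [e, add_mul]
    refine (abs_add_le _ _).trans (add_le_add ?_ ((hεr i).trans ?_))
    · rw [Finset.mul_sum]
      exact (Finset.abs_sum_le_sum_abs _ _).trans (Finset.sum_le_sum fun j _ => hG i j)
    · have : ((q + 1 : ℕ) : ℝ) * b₀ ≤ ∑ j, w i j := by
        simpa using Finset.card_nsmul_le_sum Finset.univ (w i) b₀ fun j _ => hw₀ i j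
      calc ((q + 1 : ℕ) : ℝ) * τ = τ / b₀ * (((q + 1 : ℕ) : ℝ) * b₀) := by field_simp
        _ ≤ _ := mul_le_mul_of_nonneg_left this (by positivity)
  · have e : ∑ i, w i j * addArr u i j = ∑ i, G i j + ∑ i, ε i j := by
      have := hc j
      simp only [Pi.sub_apply, Pi.mul_apply, Finset.sum_sub_distrib] at this
      linarith
    rw [e, add_mul]
    refine (abs_add_le _ _).trans (add_le_add ?_ ((hεc j).trans ?_))
    · rw [Finset.mul_sum]
      exact (Finset.abs_sum_le_sum_abs _ _).trans (Finset.sum_le_sum fun i _ => hG i j)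
    · have : (m : ℝ) * b₀ ≤ ∑ i, w i j := by
        simpa using Finset.card_nsmul_le_sum Finset.univ (fun i => w i j) b₀ fun i _ => hw₀ i j
      calc (m : ℝ) * τ = τ / b₀ * ((m : ℝ) * b₀) := by field_simp
        _ ≤ _ := mul_le_mul_of_nonneg_left this (by positivity)

/-! ### Weighted residuals and the Schur complement `H` -/

/-- The array of the `a`-th covariate. -/
def covArr (z : Fin m → Fin (q + 1) → Fin p → ℝ) (a : Fin p) : Fin m → Fin (q + 1) → ℝ :=
  fun i j => z i j a

/-- The array `z_{ij}ᵀ e`, linear in `e`. -/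
def covLin (z : Fin m → Fin (q + 1) → Fin p → ℝ) :
    (Fin p → ℝ) →ₗ[ℝ] (Fin m → Fin (q + 1) → ℝ) where
  toFun e i j := z i j ⬝ᵥ e
  map_add' e f := by ext i j; simp [dotProduct_add]
  map_smul' c e := by ext i j; simp [dotProduct_smul]

theorem covLin_apply (z : Fin m → Fin (q + 1) → Fin p → ℝ) (e : Fin p → ℝ) (i : Fin m)
    (j : Fin (q + 1)) : covLin z e i j = z i j ⬝ᵥ e := rfl

theorem covLin_eq_sum (z : Fin m → Fin (q + 1) → Fin p → ℝ) (e : Fin p → ℝ) :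
    covLin z e = ∑ a, e a • covArr z a := by
  ext i j
  simp only [covLin_apply, dotProduct, Finset.sum_apply, Pi.smul_apply, covArr, smul_eq_mul]
  exact Finset.sum_congr rfl fun a _ => mul_comm _ _

theorem covLin_single (z : Fin m → Fin (q + 1) → Fin p → ℝ) (a : Fin p) :
    covLin z (Pi.single a 1) = covArr z a := by
  ext i j; simp [covLin_apply, covArr]

/-- The coefficients of the `w`-weighted least squares projection of an array on the additive
arrays. -/
noncomputable def projCoef (w : Fin m → Fin (q + 1) → ℝ) :
    (Fin m → Fin (q + 1) → ℝ) →ₗ[ℝ] (Fin m ⊕ Fin q → ℝ) :=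
  (lapMat w)⁻¹.mulVecLin ∘ₗ degreeLin ∘ₗ LinearMap.mulLeft ℝ w

/-- The residual of that projection. -/
noncomputable def resid (w : Fin m → Fin (q + 1) → ℝ) :
    (Fin m → Fin (q + 1) → ℝ) →ₗ[ℝ] (Fin m → Fin (q + 1) → ℝ) :=
  LinearMap.id - addArr ∘ₗ projCoef w

theorem projCoef_apply (w y : Fin m → Fin (q + 1) → ℝ) :
    projCoef w y = (lapMat w)⁻¹ *ᵥ degreeVec (w * y) := rfl

theorem resid_apply (w y : Fin m → Fin (q + 1) → ℝ) :
    resid w y = y - addArr (projCoef w y) := rfl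

theorem lapMat_smul_inv {s : ℝ} (hs : s * s = 1) (w : Fin m → Fin (q + 1) → ℝ) :
    (lapMat (s • w))⁻¹ = s • (lapMat w)⁻¹ := by
  have h0 : s ≠ 0 := by rintro rfl; simp at hs
  by_cases hd : IsUnit (lapMat w).det
  · refine Matrix.inv_eq_right_inv ?_
    rw [lapMat_smul, Matrix.smul_mul, Matrix.mul_smul, smul_smul, hs, one_smul,
      Matrix.mul_nonsing_inv _ hd]
  · have hd' : ¬ IsUnit (lapMat (s • w)).det := by
      rw [lapMat_smul, Matrix.det_smul]
      intro h
      exact hd (isUnit_of_mul_isUnit_right h)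
    rw [Matrix.nonsing_inv_apply_not_isUnit _ hd, Matrix.nonsing_inv_apply_not_isUnit _ hd',
      smul_zero]

theorem projCoef_smul {s : ℝ} (hs : s * s = 1) (w y : Fin m → Fin (q + 1) → ℝ) :
    projCoef (s • w) y = projCoef w y := by
  rw [projCoef_apply, projCoef_apply, lapMat_smul_inv hs, smul_mul_assoc, ← degreeLin_apply,
    map_smul, Matrix.smul_mulVec, Matrix.mulVec_smul, smul_smul, hs, one_smul]; rfl

theorem resid_smul {s : ℝ} (hs : s * s = 1) (w y : Fin m → Fin (q + 1) → ℝ) :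
    resid (s • w) y = resid w y := by
  rw [resid_apply, resid_apply, projCoef_smul hs]

theorem degreeVec_mul_resid (hm : 0 < m) {w : Fin m → Fin (q + 1) → ℝ} (hw : ∀ i j, 0 < w i j)
    (y : Fin m → Fin (q + 1) → ℝ) : degreeVec (w * resid w y) = 0 := by
  rw [resid_apply, mul_sub, ← degreeLin_apply, map_sub, degreeLin_apply, degreeLin_apply,
    ← lapMat_mulVec, projCoef_apply, Matrix.mulVec_mulVec,
    Matrix.mul_nonsing_inv _ (lapMat_isUnit_det hm hw), Matrix.one_mulVec, sub_self]

/-- Residuals are orthogonal to additive arrays. -/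
theorem total_mul_resid_mul_addArr (hm : 0 < m) {w : Fin m → Fin (q + 1) → ℝ}
    (hw : ∀ i j, 0 < w i j) (y : Fin m → Fin (q + 1) → ℝ) (u : Fin m ⊕ Fin q → ℝ) :
    total (w * resid w y * addArr u) = 0 := by
  rw [← degreeVec_dotProduct, degreeVec_mul_resid hm hw, zero_dotProduct]

theorem total_mul_mul_resid (hm : 0 < m) {w : Fin m → Fin (q + 1) → ℝ}
    (hw : ∀ i j, 0 < w i j) (x y : Fin m → Fin (q + 1) → ℝ) :
    total (w * x * resid w y) = total (w * resid w x * resid w y) := by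
  have h := total_mul_resid_mul_addArr hm hw y (projCoef w x)
  have e : w * resid w x * resid w y =
      w * x * resid w y - w * resid w y * addArr (projCoef w x) := by
    rw [resid_apply w x]; ring
  rw [e, map_sub, h, sub_zero]

/-- The residual has the least weighted sum of squares among all `y - addArr u`. -/
theorem total_resid_sq_le (hm : 0 < m) {w : Fin m → Fin (q + 1) → ℝ}
    (hw : ∀ i j, 0 < w i j) (y : Fin m → Fin (q + 1) → ℝ) (u : Fin m ⊕ Fin q → ℝ) :
    total (w * resid w y * resid w y) ≤ total (w * (y - addArr u) * (y - addArr u)) := by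
  have e : w * (y - addArr u) * (y - addArr u) = w * resid w y * resid w y +
      (w * resid w y * addArr ((2 : ℝ) • (projCoef w y - u)) +
        w * addArr (projCoef w y - u) * addArr (projCoef w y - u)) := by
    have : y - addArr u = resid w y + addArr (projCoef w y - u) := by
      rw [resid_apply, map_sub]; ring
    rw [this, map_smul, ← Nat.cast_ofNat (R := ℝ) (n := 2), Nat.cast_smul_eq_nsmul, two_nsmul]
    ring
  rw [e, map_add, map_add, total_mul_resid_mul_addArr hm hw]
  linarith [total_mul_sq_nonneg hw (addArr (projCoef w y - u))]

theorem total_le_total {X Y : Fin m → Fin (q + 1) → ℝ} (h : ∀ i j, X i j ≤ Y i j) :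
    total X ≤ total Y := by
  rw [total_apply, total_apply]
  exact Finset.sum_le_sum fun i _ => Finset.sum_le_sum fun j _ => h i j

/-- Residual sums of squares for two sets of weights are comparable. -/
theorem total_resid_sq_compare (hm : 0 < m) {b₀ b₁ : ℝ} (hb₀ : 0 < b₀)
    {w w' : Fin m → Fin (q + 1) → ℝ} (hw₀ : ∀ i j, b₀ ≤ w i j) (hw₁ : ∀ i j, w i j ≤ b₁)
    (hw₀' : ∀ i j, b₀ ≤ w' i j) (y : Fin m → Fin (q + 1) → ℝ) :
    total (w * resid w y * resid w y) ≤ b₁ / b₀ * total (w' * resid w' y * resid w' y) := by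
  refine (total_resid_sq_le hm (fun i j => hb₀.trans_le (hw₀ i j)) y (projCoef w' y)).trans ?_
  rw [← smul_eq_mul (b₁ / b₀), ← map_smul]
  refine total_le_total fun i j => ?_
  simp only [Pi.mul_apply, Pi.smul_apply, smul_eq_mul, ← resid_apply]
  have h1 : w i j ≤ b₁ / b₀ * w' i j := by
    have hb₁ : 0 < b₁ := hb₀.trans_le ((hw₀ i j).trans (hw₁ i j))
    rw [div_mul_eq_mul_div, le_div_iff₀ hb₀]
    exact mul_le_mul (hw₁ i j) (hw₀' i j) hb₀.le hb₁.le
  have h2 := mul_le_mul_of_nonneg_right h1 (mul_self_nonneg (resid w' y i j))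
  linarith

/-- The Schur complement `∑ w_{ij} z_{ij} (z_{ij} - proj z_{ij})ᵀ`, the value of `H` when `μ'` takes
the values `w`. -/
noncomputable def schur (w : Fin m → Fin (q + 1) → ℝ) (z : Fin m → Fin (q + 1) → Fin p → ℝ) :
    Matrix (Fin p) (Fin p) ℝ :=
  Matrix.of fun a b => total (w * covArr z a * resid w (covArr z b))

theorem schur_smul {s : ℝ} (hs : s * s = 1) (w : Fin m → Fin (q + 1) → ℝ)
    (z : Fin m → Fin (q + 1) → Fin p → ℝ) : schur (s • w) z = s • schur w z := by
  ext a b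
  simp only [schur, Matrix.of_apply, Matrix.smul_apply, resid_smul hs, smul_mul_assoc, map_smul]

theorem schur_isSymm (hm : 0 < m) {w : Fin m → Fin (q + 1) → ℝ}
    (hw : ∀ i j, 0 < w i j) (z : Fin m → Fin (q + 1) → Fin p → ℝ) : (schur w z).IsSymm := by
  ext a b
  simp only [schur, Matrix.transpose_apply, Matrix.of_apply]
  rw [total_mul_mul_resid hm hw (covArr z a) (covArr z b),
    total_mul_mul_resid hm hw (covArr z b) (covArr z a)]
  congr 1; ring

theorem dotProduct_schur_mulVec (hm : 0 < m) {w : Fin m → Fin (q + 1) → ℝ}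
    (hw : ∀ i j, 0 < w i j) (z : Fin m → Fin (q + 1) → Fin p → ℝ) (e : Fin p → ℝ) :
    e ⬝ᵥ (schur w z *ᵥ e) = total (w * resid w (covLin z e) * resid w (covLin z e)) := by
  have h1 : ∀ y, total (w * covLin z e * y) = ∑ a, e a * total (w * covArr z a * y) := fun y => by
    rw [covLin_eq_sum, Finset.mul_sum, Finset.sum_mul, map_sum]
    refine Finset.sum_congr rfl fun a _ => ?_
    rw [mul_smul_comm, smul_mul_assoc, map_smul, smul_eq_mul]
  have h2 : ∀ x, total (w * x * resid w (covLin z e)) =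
      ∑ b, e b * total (w * x * resid w (covArr z b)) := fun x => by
    rw [covLin_eq_sum, map_sum, Finset.mul_sum, map_sum]
    refine Finset.sum_congr rfl fun a _ => ?_
    rw [map_smul, mul_smul_comm, map_smul, smul_eq_mul]
  rw [← total_mul_mul_resid hm hw, h1]
  refine Finset.sum_congr rfl fun a _ => ?_
  rw [h2]
  congr 1
  rw [Matrix.mulVec, dotProduct]
  exact Finset.sum_congr rfl fun b _ => mul_comm (schur w z a b) (e b)

/-- Cauchy–Schwarz for a positive semidefinite form, against the coordinate functionals. -/
theorem sq_le_inv_diag_mul {ι : Type*} [Fintype ι] [DecidableEq ι] {H : Matrix ι ι ℝ}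
    (hs : H.IsSymm) (hpos : ∀ e, 0 ≤ e ⬝ᵥ (H *ᵥ e)) (hu : IsUnit H.det) (e : ι → ℝ) (a : ι) :
    e a ^ 2 ≤ H⁻¹ a a * (e ⬝ᵥ (H *ᵥ e)) := by
  set f : ι → ℝ := H⁻¹ *ᵥ Pi.single a 1 with hf
  have hHf : H *ᵥ f = Pi.single a 1 := by
    rw [hf, Matrix.mulVec_mulVec, Matrix.mul_nonsing_inv _ hu, Matrix.one_mulVec]
  have hfe : f ⬝ᵥ (H *ᵥ e) = e a := by
    rw [Matrix.dotProduct_mulVec, ← Matrix.mulVec_transpose, hs.eq, hHf]; simp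
  have hef : e ⬝ᵥ (H *ᵥ f) = e a := by rw [hHf]; simp
  have hff : f ⬝ᵥ (H *ᵥ f) = H⁻¹ a a := by
    rw [hHf, dotProduct_single, mul_one, hf, Matrix.mulVec_single_one]; rfl
  have hq : ∀ t : ℝ, 0 ≤ H⁻¹ a a * (t * t) + (-2 * e a) * t + e ⬝ᵥ (H *ᵥ e) := fun t => by
    have h := hpos (e - t • f)
    rw [Matrix.mulVec_sub, Matrix.mulVec_smul, sub_dotProduct, dotProduct_sub, dotProduct_sub,
      smul_dotProduct, smul_dotProduct, dotProduct_smul, dotProduct_smul, hfe, hef, hff] at h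
    simp only [smul_eq_mul] at h
    linarith
  have h := discrim_le_zero hq
  rw [discrim] at h
  linarith

theorem abs_inv_diag_le_rowSumNorm {ι : Type*} [Fintype ι] (A : Matrix ι ι ℝ) (a : ι) :
    |A a a| ≤ rowSumNorm A := by
  refine le_trans ?_ (le_ciSup (f := fun i => ∑ j, |A i j|) (Set.finite_range _).bddAbove a)
  exact Finset.single_le_sum (f := fun j => |A a j|) (fun j _ => abs_nonneg _) (Finset.mem_univ a)

/-! ### The Jacobians and the constant `κ` -/

/-- The array of the derivatives `μ'(π_{ij})`. -/
noncomputable def derivArr (μ : ℝ → ℝ) (z : Fin m → Fin (q + 1) → Fin p → ℝ)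
    (θ : Fin m ⊕ Fin q → ℝ) (γ : Fin p → ℝ) : Fin m → Fin (q + 1) → ℝ :=
  fun i j => deriv μ (linPred z θ γ i j)

theorem linPred_update_left (z : Fin m → Fin (q + 1) → Fin p → ℝ) (θ : Fin m ⊕ Fin q → ℝ)
    (γ : Fin p → ℝ) (l : Fin m ⊕ Fin q) (t : ℝ) (i : Fin m) (j : Fin (q + 1)) :
    linPred z (Function.update θ l t) γ i j =
      linPred z θ γ i j + (t - θ l) * addArr (Pi.single l 1) i j := by
  have h : Function.update θ l t = θ + (t - θ l) • Pi.single l 1 := by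
    ext a
    by_cases ha : a = l
    · subst ha; simp
    · simp [ha]
  rw [h, linPred_eq, linPred_eq, map_add, map_smul]
  simp only [Pi.add_apply, Pi.smul_apply, smul_eq_mul]
  ring

theorem linPred_update_right (z : Fin m → Fin (q + 1) → Fin p → ℝ) (θ : Fin m ⊕ Fin q → ℝ)
    (γ : Fin p → ℝ) (b : Fin p) (t : ℝ) (i : Fin m) (j : Fin (q + 1)) :
    linPred z θ (Function.update γ b t) i j =
      linPred z θ γ i j + (t - γ b) * covArr z b i j := by
  have h : Function.update γ b t = γ + (t - γ b) • Pi.single b 1 := by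
    ext a
    by_cases ha : a = b
    · subst ha; simp
    · simp [ha]
  rw [h, linPred_eq, linPred_eq, dotProduct_add, dotProduct_smul, ← covLin_apply z (Pi.single b 1),
    covLin_single, smul_eq_mul]
  ring

theorem hasDerivAt_comp_affine {μ : ℝ → ℝ} {a c : ℝ} (t₀ : ℝ) (h : DifferentiableAt ℝ μ a) :
    HasDerivAt (fun t => μ (a + (t - t₀) * c)) (deriv μ a * c) t₀ := by
  have h1 : HasDerivAt (fun t => a + (t - t₀) * c) c t₀ := by
    simpa using (((hasDerivAt_id t₀).sub_const t₀).mul_const c).const_add a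
  have h2 : HasDerivAt μ (deriv μ a) (a + (t₀ - t₀) * c) := by simpa using h.hasDerivAt
  exact h2.comp t₀ h1

theorem hasDerivAt_degreeVec {X : ℝ → Fin m → Fin (q + 1) → ℝ} {X' : Fin m → Fin (q + 1) → ℝ}
    {t : ℝ} (h : ∀ i j, HasDerivAt (fun t => X t i j) (X' i j) t) (a : Fin m ⊕ Fin q) :
    HasDerivAt (fun t => degreeVec (X t) a) (degreeVec X' a) t := by
  rcases a with i | j
  · exact HasDerivAt.fun_sum fun j _ => h i j
  · exact HasDerivAt.fun_sum fun i _ => h i j.castSucc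

theorem momentQ_apply (μ : ℝ → ℝ) (z : Fin m → Fin (q + 1) → Fin p → ℝ)
    (X : Fin m → Fin (q + 1) → ℝ) (θ : Fin m ⊕ Fin q → ℝ) (γ : Fin p → ℝ) (a : Fin p) :
    momentQ μ z X θ γ a = total ((meanMatrix μ z θ γ - X) * covArr z a) := by
  simp [momentQ, total_apply, covArr, Finset.sum_apply]

theorem hasDerivAt_total_mul {X : ℝ → Fin m → Fin (q + 1) → ℝ} {X' y : Fin m → Fin (q + 1) → ℝ}
    {t : ℝ} (h : ∀ i j, HasDerivAt (fun t => X t i j) (X' i j) t) :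
    HasDerivAt (fun t => total ((X t - 0) * y)) (total (X' * y)) t := by
  simp only [sub_zero, total_apply, Pi.mul_apply]
  exact HasDerivAt.fun_sum fun i _ => HasDerivAt.fun_sum fun j _ => (h i j).mul_const _

theorem jacobian_momentF_left {μ : ℝ → ℝ} {z : Fin m → Fin (q + 1) → Fin p → ℝ}
    {θ : Fin m ⊕ Fin q → ℝ} {γ : Fin p → ℝ}
    (hd : ∀ i j, DifferentiableAt ℝ μ (linPred z θ γ i j)) :
    jacV μ z θ γ = lapMat (derivArr μ z θ γ) := by
  ext a l
  rw [lapMat_apply, jacV, jacobian, Matrix.of_apply]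
  refine HasDerivAt.deriv ?_
  simp only [momentF, Pi.sub_apply]
  refine HasDerivAt.sub_const _ (hasDerivAt_degreeVec (fun i j => ?_) a)
  simp only [meanMatrix, linPred_update_left]
  exact hasDerivAt_comp_affine _ (hd i j)

theorem jacobian_momentF_right {μ : ℝ → ℝ} {z : Fin m → Fin (q + 1) → Fin p → ℝ}
    {θ : Fin m ⊕ Fin q → ℝ} {γ : Fin p → ℝ}
    (hd : ∀ i j, DifferentiableAt ℝ μ (linPred z θ γ i j)) (a : Fin m ⊕ Fin q) (b : Fin p) :
    jacobian (fun γ' => momentF μ z 0 θ γ') γ a b =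
      degreeVec (derivArr μ z θ γ * covArr z b) a := by
  rw [jacobian, Matrix.of_apply]
  refine HasDerivAt.deriv ?_
  simp only [momentF, Pi.sub_apply]
  refine HasDerivAt.sub_const _ (hasDerivAt_degreeVec (fun i j => ?_) a)
  simp only [meanMatrix, linPred_update_right]
  exact hasDerivAt_comp_affine _ (hd i j)

theorem jacobian_momentQ_left {μ : ℝ → ℝ} {z : Fin m → Fin (q + 1) → Fin p → ℝ}
    {θ : Fin m ⊕ Fin q → ℝ} {γ : Fin p → ℝ}
    (hd : ∀ i j, DifferentiableAt ℝ μ (linPred z θ γ i j)) (a : Fin p) (l : Fin m ⊕ Fin q) :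
    jacobian (fun θ' => momentQ μ z 0 θ' γ) θ a l =
      degreeVec (derivArr μ z θ γ * covArr z a) l := by
  have e : degreeVec (derivArr μ z θ γ * covArr z a) l =
      total (derivArr μ z θ γ * addArr (Pi.single l 1) * covArr z a) := by
    have := degreeVec_dotProduct (derivArr μ z θ γ * covArr z a) (Pi.single l 1)
    rw [dotProduct_single, mul_one] at this
    rw [this]; congr 1; ring
  rw [e, jacobian, Matrix.of_apply]
  refine HasDerivAt.deriv ?_
  simp only [momentQ_apply]
  refine hasDerivAt_total_mul (X := fun t => meanMatrix μ z (Function.update θ l t) γ)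
    fun i j => ?_
  simp only [meanMatrix, linPred_update_left]
  exact hasDerivAt_comp_affine _ (hd i j)

theorem jacobian_momentQ_right {μ : ℝ → ℝ} {z : Fin m → Fin (q + 1) → Fin p → ℝ}
    {θ : Fin m ⊕ Fin q → ℝ} {γ : Fin p → ℝ}
    (hd : ∀ i j, DifferentiableAt ℝ μ (linPred z θ γ i j)) (a b : Fin p) :
    jacobian (fun γ' => momentQ μ z 0 θ γ') γ a b =
      total (derivArr μ z θ γ * covArr z b * covArr z a) := by
  rw [jacobian, Matrix.of_apply]
  refine HasDerivAt.deriv ?_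
  simp only [momentQ_apply]
  refine hasDerivAt_total_mul (X := fun t => meanMatrix μ z θ (Function.update γ b t))
    fun i j => ?_
  simp only [meanMatrix, linPred_update_right]
  exact hasDerivAt_comp_affine _ (hd i j)

theorem matH_eq_schur {μ : ℝ → ℝ} {z : Fin m → Fin (q + 1) → Fin p → ℝ}
    {θ : Fin m ⊕ Fin q → ℝ} {γ : Fin p → ℝ}
    (hd : ∀ i j, DifferentiableAt ℝ μ (linPred z θ γ i j)) :
    matH μ z θ γ = schur (derivArr μ z θ γ) z := by
  ext a b
  rw [matH, Matrix.sub_apply, jacobian_momentQ_right hd, jacobian_momentF_left hd, Matrix.mul_assoc]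
  have h1 : ((lapMat (derivArr μ z θ γ))⁻¹ * jacobian (fun γ' => momentF μ z 0 θ γ') γ).col b =
      projCoef (derivArr μ z θ γ) (covArr z b) := by
    rw [projCoef_apply]
    have h2 : (jacobian (fun γ' => momentF μ z 0 θ γ') γ).col b =
        degreeVec (derivArr μ z θ γ * covArr z b) := by
      ext l
      exact jacobian_momentF_right hd l b
    rw [← h2]
    ext l
    rfl
  have h3 : (jacobian (fun θ' => momentQ μ z 0 θ' γ) θ *
      ((lapMat (derivArr μ z θ γ))⁻¹ * jacobian (fun γ' => momentF μ z 0 θ γ') γ)) a b =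
      degreeVec (derivArr μ z θ γ * covArr z a) ⬝ᵥ projCoef (derivArr μ z θ γ) (covArr z b) := by
    rw [← h1, Matrix.mul_apply, dotProduct]
    refine Finset.sum_congr rfl fun l _ => ?_
    rw [jacobian_momentQ_left hd]; rfl
  rw [h3, degreeVec_dotProduct, ← map_sub, schur, Matrix.of_apply, resid_apply]
  congr 1; ring

theorem abs_covLin_le {z : Fin m → Fin (q + 1) → Fin p → ℝ} {Cz : ℝ} (hz : ∀ i j, ‖z i j‖ ≤ Cz)
    (e : Fin p → ℝ) (i : Fin m) (j : Fin (q + 1)) : |covLin z e i j| ≤ p * Cz * ‖e‖ := by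
  rw [covLin_apply, dotProduct]
  refine (Finset.abs_sum_le_sum_abs _ _).trans ?_
  have : ∑ a : Fin p, |z i j a * e a| ≤ ∑ _a : Fin p, Cz * ‖e‖ := by
    refine Finset.sum_le_sum fun a _ => ?_
    rw [abs_mul]
    have h1 : |z i j a| ≤ Cz := (norm_le_pi_norm (z i j) a).trans (hz i j)
    exact mul_le_mul h1 (norm_le_pi_norm e a) (abs_nonneg _) ((abs_nonneg _).trans h1)
  refine this.trans (le_of_eq ?_)
  simp; ring

theorem abs_covArr_le {z : Fin m → Fin (q + 1) → Fin p → ℝ} {Cz : ℝ} (hz : ∀ i j, ‖z i j‖ ≤ Cz)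
    (a : Fin p) (i : Fin m) (j : Fin (q + 1)) : |covArr z a i j| ≤ Cz :=
  (norm_le_pi_norm (z i j) a).trans (hz i j)

/-- All entries of inverse Schur complements are bounded in terms of a single one, so the supremum
defining `κ` is over a bounded set. -/
theorem abs_inv_schur_le (hm : 0 < m) {b₀ b₁ : ℝ} (hb₀ : 0 < b₀)
    {w w' : Fin m → Fin (q + 1) → ℝ} (hw₀ : ∀ i j, b₀ ≤ w i j) (hw₁ : ∀ i j, w i j ≤ b₁)
    (hw₀' : ∀ i j, b₀ ≤ w' i j) {z : Fin m → Fin (q + 1) → Fin p → ℝ}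
    (hu : IsUnit (schur w z).det) (hu' : IsUnit (schur w' z).det) {K : ℝ}
    (hK : ∀ a, (schur w z)⁻¹ a a ≤ K) (a b : Fin p) : |(schur w' z)⁻¹ b a| ≤ K * (b₁ / b₀) := by
  have hw : ∀ i j, 0 < w i j := fun i j => hb₀.trans_le (hw₀ i j)
  have hw' : ∀ i j, 0 < w' i j := fun i j => hb₀.trans_le (hw₀' i j)
  have hb₁ : 0 ≤ b₁ := hb₀.le.trans ((hw₀ ⟨0, hm⟩ 0).trans (hw₁ ⟨0, hm⟩ 0))
  set e : Fin p → ℝ := (schur w' z)⁻¹ *ᵥ Pi.single a 1 with he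
  have hea : ∀ b, e b = (schur w' z)⁻¹ b a := fun b => by
    rw [he, Matrix.mulVec_single_one]; rfl
  have hHe : schur w' z *ᵥ e = Pi.single a 1 := by
    rw [he, Matrix.mulVec_mulVec, Matrix.mul_nonsing_inv _ hu', Matrix.one_mulVec]
  have hE : e ⬝ᵥ (schur w' z *ᵥ e) = e a := by rw [hHe]; simp
  have hE0 : 0 ≤ e a := by
    rw [← hE, dotProduct_schur_mulVec hm hw']; exact total_mul_sq_nonneg hw' _
  have key : ∀ b, e b ^ 2 ≤ K * (b₁ / b₀) * e a := fun b => by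
    have h1 := sq_le_inv_diag_mul (schur_isSymm hm hw z) (fun e => by
      rw [dotProduct_schur_mulVec hm hw]; exact total_mul_sq_nonneg hw _) hu e b
    rw [dotProduct_schur_mulVec hm hw] at h1
    have h2 := total_resid_sq_compare hm hb₀ hw₀ hw₁ hw₀' (covLin z e)
    rw [← dotProduct_schur_mulVec hm hw', hE] at h2
    have h3 : 0 ≤ total (w * resid w (covLin z e) * resid w (covLin z e)) :=
      total_mul_sq_nonneg hw _
    have hK0 : 0 ≤ K := by
      have h4 := sq_le_inv_diag_mul (schur_isSymm hm hw z) (fun e => by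
        rw [dotProduct_schur_mulVec hm hw]; exact total_mul_sq_nonneg hw _) hu (Pi.single b 1) b
      rw [dotProduct_schur_mulVec hm hw] at h4
      simp only [Pi.single_eq_same, one_pow] at h4
      have h5 : 0 ≤ total (w * resid w (covLin z (Pi.single b 1)) *
        resid w (covLin z (Pi.single b 1))) := total_mul_sq_nonneg hw _
      by_contra hneg
      have : (schur w z)⁻¹ b b ≤ 0 := (hK b).trans (not_le.1 hneg).le
      linarith [mul_nonpos_of_nonpos_of_nonneg this h5]
    calc e b ^ 2 ≤ _ := h1
      _ ≤ K * total (w * resid w (covLin z e) * resid w (covLin z e)) :=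
        mul_le_mul_of_nonneg_right (hK b) h3
      _ ≤ K * (b₁ / b₀ * e a) := mul_le_mul_of_nonneg_left h2 hK0
      _ = _ := by ring
  have hab := key b
  have haa := key a
  rw [← hea]
  have h1 : e a ≤ K * (b₁ / b₀) := by
    rcases hE0.eq_or_lt with h0 | h0
    · rw [← h0]
      by_contra hneg
      -- `e a = 0` forces `e = 0`, which is impossible as `e` solves a nonzero equation
      have hz : e = 0 := by
        ext c
        have := key c
        rw [← h0, mul_zero] at this
        exact pow_eq_zero_iff two_ne_zero |>.1 (le_antisymm this (sq_nonneg _))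
      rw [hz, Matrix.mulVec_zero] at hHe
      have := congrFun hHe a
      simp at this
    · nlinarith
  refine abs_le_of_sq_le_sq ?_ (hE0.trans h1)
  nlinarith

theorem rowSumNorm_nonneg {ι κ : Type*} [Fintype κ] (A : Matrix ι κ ℝ) : 0 ≤ rowSumNorm A :=
  Real.iSup_nonneg fun _ => Finset.sum_nonneg fun _ _ => abs_nonneg _

/-- The defining property of `κ`: the quadratic form of `H / (mn)` at the truth is bounded below
by the squared coordinates over `κ`.  The supremum in `κ` is a genuine one, since all the inverses
`H⁻¹(θ, γ*)` are comparable. -/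
theorem sq_le_kappa_mul (hm : 0 < m) {μ : ℝ → ℝ} {z : Fin m → Fin (q + 1) → Fin p → ℝ}
    {θs : Fin m ⊕ Fin q → ℝ} {γs : Fin p → ℝ} {ε₁ b₀ b₁ s : ℝ} (hb₀ : 0 < b₀) (hs : s * s = 1)
    (hε₁ : 0 ≤ ε₁)
    (hd : ∀ θ ∈ Metric.closedBall θs ε₁, ∀ i j, DifferentiableAt ℝ μ (linPred z θ γs i j))
    (hw : ∀ θ ∈ Metric.closedBall θs ε₁, ∀ i j,
      b₀ ≤ (s • derivArr μ z θ γs) i j ∧ (s • derivArr μ z θ γs) i j ≤ b₁)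
    (hH : ∀ θ ∈ Metric.closedBall θs ε₁, IsUnit (matH μ z θ γs).det)
    (e : Fin p → ℝ) (a : Fin p) :
    (m : ℝ) * ((q + 1 : ℕ) : ℝ) * e a ^ 2 ≤ kappa μ z θs γs ε₁ *
      total ((s • derivArr μ z θs γs) * resid (s • derivArr μ z θs γs) (covLin z e) *
        resid (s • derivArr μ z θs γs) (covLin z e)) := by
  have hθs : θs ∈ Metric.closedBall θs ε₁ := Metric.mem_closedBall_self hε₁
  have hss : ∀ θ ∈ Metric.closedBall θs ε₁,
      schur (s • derivArr μ z θ γs) z = s • matH μ z θ γs := fun θ hθ => by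
    rw [matH_eq_schur (hd θ hθ), schur_smul hs]
  have hsu : IsUnit s := IsUnit.of_mul_eq_one s hs
  have hunit : ∀ θ ∈ Metric.closedBall θs ε₁,
      IsUnit (schur (s • derivArr μ z θ γs) z).det := fun θ hθ => by
    rw [hss θ hθ, Matrix.det_smul]
    exact (hsu.pow _).mul (hH θ hθ)
  have hinv : ∀ θ ∈ Metric.closedBall θs ε₁,
      (schur (s • derivArr μ z θ γs) z)⁻¹ = s • (matH μ z θ γs)⁻¹ := fun θ hθ => by
    refine Matrix.inv_eq_right_inv ?_
    rw [hss θ hθ, Matrix.smul_mul, Matrix.mul_smul, smul_smul, hs, one_smul,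
      Matrix.mul_nonsing_inv _ (hH θ hθ)]
  have habs : |s| = 1 := by
    rcases mul_self_eq_one_iff.1 hs with h | h <;> simp [h]
  set w := s • derivArr μ z θs γs with hwdef
  have hwpos : ∀ i j, 0 < w i j := fun i j => hb₀.trans_le (hw θs hθs i j).1
  have hmn : (0 : ℝ) ≤ (m : ℝ) * ((q + 1 : ℕ) : ℝ) := by positivity
  -- the supremum defining `κ` is over a bounded set
  have hbdd : BddAbove ((fun θ => rowSumNorm (((m : ℝ) * ((q + 1 : ℕ) : ℝ)) •
      (matH μ z θ γs)⁻¹)) '' Metric.closedBall θs ε₁) := by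
    refine ⟨p * ((m : ℝ) * ((q + 1 : ℕ) : ℝ) *
      (rowSumNorm ((schur w z)⁻¹) * (b₁ / b₀))), ?_⟩
    rintro _ ⟨θ, hθ, rfl⟩
    have hb : ∀ a b, |(matH μ z θ γs)⁻¹ b a| ≤ rowSumNorm ((schur w z)⁻¹) * (b₁ / b₀) :=
      fun a b => by
        have h := abs_inv_schur_le hm hb₀ (fun i j => (hw θs hθs i j).1)
          (fun i j => (hw θs hθs i j).2) (fun i j => (hw θ hθ i j).1) (hunit θs hθs)
          (hunit θ hθ)
          (fun a => (le_abs_self _).trans (abs_inv_diag_le_rowSumNorm ((schur w z)⁻¹) a)) a b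
        rwa [hinv θ hθ, Matrix.smul_apply, smul_eq_mul, abs_mul, habs, one_mul] at h
    have hK : 0 ≤ rowSumNorm ((schur w z)⁻¹) * (b₁ / b₀) := (abs_nonneg _).trans (hb a a)
    refine Real.iSup_le (fun i => ?_) (by positivity)
    refine (Finset.sum_le_card_nsmul _ _ ((m : ℝ) * ((q + 1 : ℕ) : ℝ) *
      (rowSumNorm ((schur w z)⁻¹) * (b₁ / b₀))) fun j _ => ?_).trans (by simp)
    rw [Matrix.smul_apply, smul_eq_mul, abs_mul, abs_of_nonneg hmn]
    exact mul_le_mul_of_nonneg_left (hb j i) hmn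
  have hκ : (m : ℝ) * ((q + 1 : ℕ) : ℝ) * (schur w z)⁻¹ a a ≤ kappa μ z θs γs ε₁ := by
    have h1 := le_csSup hbdd (Set.mem_image_of_mem _ hθs)
    refine le_trans ?_ h1
    refine le_trans ?_ (abs_inv_diag_le_rowSumNorm _ a)
    rw [Matrix.smul_apply, smul_eq_mul, abs_mul, abs_of_nonneg hmn]
    refine mul_le_mul_of_nonneg_left ?_ hmn
    rw [hinv θs hθs, Matrix.smul_apply, smul_eq_mul]
    refine (le_abs_self _).trans ?_
    rw [abs_mul, habs, one_mul]
  have h1 := sq_le_inv_diag_mul (schur_isSymm hm hwpos z) (fun e => by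
      rw [dotProduct_schur_mulVec hm hwpos]; exact total_mul_sq_nonneg hwpos _)
      (hunit θs hθs) e a
  rw [dotProduct_schur_mulVec hm hwpos] at h1
  calc (m : ℝ) * ((q + 1 : ℕ) : ℝ) * e a ^ 2 ≤ _ := mul_le_mul_of_nonneg_left h1 hmn
    _ = (m : ℝ) * ((q + 1 : ℕ) : ℝ) * (schur w z)⁻¹ a a *
        total (w * resid w (covLin z e) * resid w (covLin z e)) := by ring
    _ ≤ _ := mul_le_mul_of_nonneg_right hκ (total_mul_sq_nonneg hwpos _)

/-- The supremum `κ` is at least of order `1 / b₁`. -/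
theorem one_le_of_sq_le_mul (hm : 0 < m) (hp : 0 < p)
    {z : Fin m → Fin (q + 1) → Fin p → ℝ} {Cz b₁ κ : ℝ} (hz : ∀ i j, ‖z i j‖ ≤ Cz) (hκ0 : 0 ≤ κ)
    {w : Fin m → Fin (q + 1) → ℝ} (hw : ∀ i j, 0 < w i j) (hw₁ : ∀ i j, w i j ≤ b₁)
    (hκ : ∀ (e : Fin p → ℝ) (a : Fin p), (m : ℝ) * ((q + 1 : ℕ) : ℝ) * e a ^ 2 ≤
      κ * total (w * resid w (covLin z e) * resid w (covLin z e))) :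
    1 ≤ κ * b₁ * Cz ^ 2 := by
  let a : Fin p := ⟨0, hp⟩
  have h := hκ (Pi.single a 1) a
  rw [Pi.single_eq_same, one_pow, mul_one, covLin_single] at h
  have h1 := total_resid_sq_le hm hw (covArr z a) 0
  rw [map_zero, sub_zero] at h1
  have h2 : total (w * covArr z a * covArr z a) ≤ (m : ℝ) * ((q + 1 : ℕ) : ℝ) * (b₁ * Cz ^ 2) := by
    have h3 : ∀ i j, (w * covArr z a * covArr z a) i j ≤ b₁ * Cz ^ 2 := fun i j => by
      have h4 : covArr z a i j ^ 2 ≤ Cz ^ 2 := sq_le_sq' (abs_le.1 (abs_covArr_le hz a i j)).1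
        (abs_le.1 (abs_covArr_le hz a i j)).2
      calc (w * covArr z a * covArr z a) i j = w i j * covArr z a i j ^ 2 := by
            simp only [Pi.mul_apply]; ring
        _ ≤ b₁ * Cz ^ 2 := mul_le_mul (hw₁ i j) h4 (sq_nonneg _) ((hw i j).le.trans (hw₁ i j))
    refine (total_le_total (Y := fun _ _ => b₁ * Cz ^ 2) h3).trans (le_of_eq ?_)
    simp [total_apply]; ring
  have hmn : (0 : ℝ) < (m : ℝ) * ((q + 1 : ℕ) : ℝ) := by positivity
  have h5 : (m : ℝ) * ((q + 1 : ℕ) : ℝ) * 1 ≤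
      (m : ℝ) * ((q + 1 : ℕ) : ℝ) * (κ * b₁ * Cz ^ 2) := by
    calc _ ≤ κ * total (w * resid w (covArr z a) * resid w (covArr z a)) := by rwa [mul_one]
      _ ≤ κ * ((m : ℝ) * ((q + 1 : ℕ) : ℝ) * (b₁ * Cz ^ 2)) :=
        mul_le_mul_of_nonneg_left (h1.trans h2) hκ0
      _ = _ := by ring
  exact le_of_mul_le_mul_left h5 hmn

theorem kappa_nonneg (μ : ℝ → ℝ) (z : Fin m → Fin (q + 1) → Fin p → ℝ)
    (θs : Fin m ⊕ Fin q → ℝ) (γs : Fin p → ℝ) (ε : ℝ) : 0 ≤ kappa μ z θs γs ε := by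
  refine Real.sSup_nonneg ?_
  rintro _ ⟨θ, _, rfl⟩
  exact rowSumNorm_nonneg _

/-! ### Mean value weights -/

/-- `(θ, γ) ↦ (π_{ij})` as a linear map. -/
def predLin (z : Fin m → Fin (q + 1) → Fin p → ℝ) :
    (Fin m ⊕ Fin q → ℝ) × (Fin p → ℝ) →ₗ[ℝ] (Fin m → Fin (q + 1) → ℝ) :=
  addArr.coprod (covLin z)

theorem predLin_apply (z : Fin m → Fin (q + 1) → Fin p → ℝ)
    (η : (Fin m ⊕ Fin q → ℝ) × (Fin p → ℝ)) (i : Fin m) (j : Fin (q + 1)) :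
    predLin z η i j = linPred z η.1 η.2 i j := rfl

/-- The set of values of `π_{ij}` over the box `B(θ*, ε₁) × B(γ*, ε₂)`. -/
def predRange (z : Fin m → Fin (q + 1) → Fin p → ℝ) (θs : Fin m ⊕ Fin q → ℝ)
    (γs : Fin p → ℝ) (ε₁ ε₂ : ℝ) (i : Fin m) (j : Fin (q + 1)) : Set ℝ :=
  (fun η => predLin z η i j) '' (Metric.closedBall θs ε₁ ×ˢ Metric.closedBall γs ε₂)

theorem convex_predRange (z : Fin m → Fin (q + 1) → Fin p → ℝ) (θs : Fin m ⊕ Fin q → ℝ)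
    (γs : Fin p → ℝ) (ε₁ ε₂ : ℝ) (i : Fin m) (j : Fin (q + 1)) :
    Convex ℝ (predRange z θs γs ε₁ ε₂ i j) :=
  ((convex_closedBall θs ε₁).prod (convex_closedBall γs ε₂)).linear_image
    ((LinearMap.proj j : (Fin (q + 1) → ℝ) →ₗ[ℝ] ℝ) ∘ₗ
      (LinearMap.proj i : (Fin m → Fin (q + 1) → ℝ) →ₗ[ℝ] _) ∘ₗ predLin z)

theorem exists_sign_of_ne_zero {μ : ℝ → ℝ} {I : Set ℝ} (hI : Convex ℝ I)
    (hd : ∀ t ∈ I, DifferentiableAt ℝ μ t) (h0 : ∀ t ∈ I, deriv μ t ≠ 0) {t t' : ℝ}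
    (ht : t ∈ I) (ht' : t' ∈ I) : 0 < deriv μ t * deriv μ t' := by
  rcases hasDerivWithinAt_forall_lt_or_forall_gt_of_forall_ne hI
    (fun t ht => (hd t ht).hasDerivAt.hasDerivWithinAt) h0 with h | h
  · exact mul_pos_of_neg_of_neg (h t ht) (h t' ht')
  · exact mul_pos (h t ht) (h t' ht')

/-- Under `DerivBounds` the derivatives `μ'(π_{ij})` have one and the same sign over the whole
box (Darboux), hence lie in `[b₀, b₁]` after multiplication by that sign. -/
theorem DerivBounds.exists_sign (hm : 0 < m) {μ : ℝ → ℝ}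
    {z : Fin m → Fin (q + 1) → Fin p → ℝ} {θs : Fin m ⊕ Fin q → ℝ} {γs : Fin p → ℝ}
    {ε₁ ε₂ b₀ b₁ b₂ b₃ : ℝ} (hε₁ : 0 ≤ ε₁) (hε₂ : 0 ≤ ε₂) (hb₀ : 0 < b₀)
    (h : DerivBounds μ z θs γs ε₁ ε₂ b₀ b₁ b₂ b₃) :
    ∃ s : ℝ, s * s = 1 ∧ ∀ i j, ∀ t ∈ predRange z θs γs ε₁ ε₂ i j,
      b₀ ≤ s * deriv μ t ∧ s * deriv μ t ≤ b₁ := by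
  have hθs : θs ∈ Metric.closedBall θs ε₁ := Metric.mem_closedBall_self hε₁
  have hγs : γs ∈ Metric.closedBall γs ε₂ := Metric.mem_closedBall_self hε₂
  let i₀ : Fin m := ⟨0, hm⟩
  set d := deriv μ (linPred z θs γs i₀ 0) with hdef
  have hsame : ∀ i j, ∀ t ∈ predRange z θs γs ε₁ ε₂ i j, 0 < d * deriv μ t := by
    intro i j t ht
    have h1 := exists_sign_of_ne_zero (μ := μ) (convex_predRange z θs γs ε₁ ε₂ i j)
      (by
        rintro _ ⟨η, ⟨h1, h2⟩, rfl⟩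
        exact (h η.1 h1 η.2 h2).1 i j 0 (by norm_num))
      (by
        rintro _ ⟨η, ⟨h1, h2⟩, rfl⟩ h3
        have := ((h η.1 h1 η.2 h2).2.2 i j).1
        rw [← predLin_apply, h3, abs_zero] at this
        linarith) ht (t' := linPred z θs γs i j) ⟨(θs, γs), ⟨hθs, hγs⟩, rfl⟩
    have h2 := (h θs hθs γs hγs).2.1 i₀ 0 i j
    have h3 := mul_pos h1 h2
    have hx : deriv μ (linPred z θs γs i j) ≠ 0 := right_ne_zero_of_mul h1.ne'
    have h4 : 0 < deriv μ (linPred z θs γs i j) ^ 2 := by positivity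
    refine pos_of_mul_pos_left (b := deriv μ (linPred z θs γs i j) ^ 2) ?_ h4.le
    rw [hdef]
    linarith
  have hbd : ∀ i j, ∀ t ∈ predRange z θs γs ε₁ ε₂ i j,
      b₀ ≤ |deriv μ t| ∧ |deriv μ t| ≤ b₁ := by
    rintro i j _ ⟨η, ⟨h1, h2⟩, rfl⟩
    have := (h η.1 h1 η.2 h2).2.2 i j
    exact ⟨this.1, this.2.1⟩
  rcases lt_or_ge 0 d with hd | hd
  · refine ⟨1, by norm_num, fun i j t ht => ?_⟩
    have h1 := hbd i j t ht
    rwa [abs_of_pos (pos_of_mul_pos_right (hsame i j t ht) hd.le), ← one_mul (deriv μ t)] at h1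
  · refine ⟨-1, by norm_num, fun i j t ht => ?_⟩
    have h1 := hbd i j t ht
    have h2 : deriv μ t < 0 := by
      by_contra hn
      have := mul_nonpos_of_nonpos_of_nonneg hd (not_lt.1 hn)
      linarith [hsame i j t ht]
    rwa [abs_of_neg h2, ← neg_one_mul] at h1

theorem exists_mean_value {μ : ℝ → ℝ} {I : Set ℝ} {b₂ : ℝ} (hI : Convex ℝ I)
    (hd : ∀ t ∈ I, DifferentiableAt ℝ μ t) (hd' : ∀ t ∈ I, DifferentiableAt ℝ (deriv μ) t)
    (hb : ∀ t ∈ I, |deriv (deriv μ) t| ≤ b₂) {a c : ℝ} (ha : a ∈ I) (hc : c ∈ I) :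
    ∃ ξ ∈ I, μ a - μ c = deriv μ ξ * (a - c) ∧ |deriv μ ξ - deriv μ c| ≤ b₂ * |a - c| := by
  have hb₂ : 0 ≤ b₂ := (abs_nonneg _).trans (hb a ha)
  have key : ∀ ξ ∈ I, |ξ - c| ≤ |a - c| → |deriv μ ξ - deriv μ c| ≤ b₂ * |a - c| :=
    fun ξ hξ hle => (hI.norm_image_sub_le_of_norm_deriv_le hd' hb hc hξ).trans
      (mul_le_mul_of_nonneg_left hle hb₂)
  have hIo := hI.ordConnected
  rcases lt_trichotomy a c with h | rfl | h
  · have hsub := hIo.out ha hc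
    obtain ⟨ξ, hξ, h1⟩ := exists_deriv_eq_slope μ h
      (fun t ht => (hd t (hsub ht)).continuousAt.continuousWithinAt)
      (fun t ht => (hd t (hsub (Set.Ioo_subset_Icc_self ht))).differentiableWithinAt)
    refine ⟨ξ, hsub (Set.Ioo_subset_Icc_self hξ), ?_, key ξ (hsub (Set.Ioo_subset_Icc_self hξ)) ?_⟩
    · have : c - a ≠ 0 := (sub_pos.2 h).ne'
      rw [h1]; field_simp; ring
    · rw [abs_of_neg (sub_neg.2 hξ.2), abs_of_neg (sub_neg.2 h)]; linarith [hξ.1]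
  · exact ⟨a, ha, by simp, by simp⟩
  · have hsub := hIo.out hc ha
    obtain ⟨ξ, hξ, h1⟩ := exists_deriv_eq_slope μ h
      (fun t ht => (hd t (hsub ht)).continuousAt.continuousWithinAt)
      (fun t ht => (hd t (hsub (Set.Ioo_subset_Icc_self ht))).differentiableWithinAt)
    refine ⟨ξ, hsub (Set.Ioo_subset_Icc_self hξ), ?_, key ξ (hsub (Set.Ioo_subset_Icc_self hξ)) ?_⟩
    · have : a - c ≠ 0 := (sub_pos.2 h).ne'
      rw [h1]; field_simp
    · rw [abs_of_pos (sub_pos.2 hξ.1), abs_of_pos (sub_pos.2 h)]; linarith [hξ.2]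

/-- Between two parameters in the box the means differ by `w̄ · (π - π')`, where the weights `w̄`
satisfy the same bounds as `μ'`, and differ from `μ'(π')` by at most `b₂ |π - π'|`. -/
theorem DerivBounds.exists_weights {μ : ℝ → ℝ}
    {z : Fin m → Fin (q + 1) → Fin p → ℝ} {θs : Fin m ⊕ Fin q → ℝ} {γs : Fin p → ℝ}
    {ε₁ ε₂ b₀ b₁ b₂ b₃ s : ℝ} (h : DerivBounds μ z θs γs ε₁ ε₂ b₀ b₁ b₂ b₃) (hs : s * s = 1)
    (hsign : ∀ i j, ∀ t ∈ predRange z θs γs ε₁ ε₂ i j, b₀ ≤ s * deriv μ t ∧ s * deriv μ t ≤ b₁)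
    {η η' : (Fin m ⊕ Fin q → ℝ) × (Fin p → ℝ)}
    (hη : η ∈ Metric.closedBall θs ε₁ ×ˢ Metric.closedBall γs ε₂)
    (hη' : η' ∈ Metric.closedBall θs ε₁ ×ˢ Metric.closedBall γs ε₂) :
    ∃ w : Fin m → Fin (q + 1) → ℝ, (∀ i j, b₀ ≤ w i j ∧ w i j ≤ b₁) ∧
      s • (meanMatrix μ z η.1 η.2 - meanMatrix μ z η'.1 η'.2) = w * predLin z (η - η') ∧
      ∀ i j, |w i j - (s • derivArr μ z η'.1 η'.2) i j| ≤ b₂ * |predLin z (η - η') i j| := by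
  have habs : |s| = 1 := by
    rcases mul_self_eq_one_iff.1 hs with h | h <;> simp [h]
  have hex : ∀ i j, ∃ ξ ∈ predRange z θs γs ε₁ ε₂ i j,
      μ (predLin z η i j) - μ (predLin z η' i j) =
        deriv μ ξ * (predLin z η i j - predLin z η' i j) ∧
      |deriv μ ξ - deriv μ (predLin z η' i j)| ≤ b₂ * |predLin z η i j - predLin z η' i j| := by
    intro i j
    refine exists_mean_value (convex_predRange z θs γs ε₁ ε₂ i j) ?_ ?_ ?_
      ⟨η, hη, rfl⟩ ⟨η', hη', rfl⟩
    · rintro _ ⟨η, ⟨h1, h2⟩, rfl⟩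
      exact (h η.1 h1 η.2 h2).1 i j 0 (by norm_num)
    · rintro _ ⟨η, ⟨h1, h2⟩, rfl⟩
      have := (h η.1 h1 η.2 h2).1 i j 1 (by norm_num)
      rwa [iteratedDeriv_one] at this
    · rintro _ ⟨η, ⟨h1, h2⟩, rfl⟩
      have := ((h η.1 h1 η.2 h2).2.2 i j).2.2.1
      rwa [iteratedDeriv_succ, iteratedDeriv_one] at this
  choose ξ hξ hξ1 hξ2 using hex
  refine ⟨fun i j => s * deriv μ (ξ i j), fun i j => hsign i j _ (hξ i j), ?_, fun i j => ?_⟩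
  · ext i j
    have := hξ1 i j
    simp only [predLin_apply] at this
    simp only [Pi.smul_apply, Pi.sub_apply, Pi.mul_apply, map_sub, smul_eq_mul, meanMatrix, this,
      predLin_apply]
    ring
  · have := hξ2 i j
    simp only [Pi.smul_apply, smul_eq_mul, derivArr, map_sub, Pi.sub_apply]
    rw [← mul_sub, abs_mul, habs, one_mul]
    exact this

/-! ### Deterministic bounds for solutions of the moment equations -/

theorem abs_eventParam_le {u : Fin m ⊕ Fin q → ℝ} {c : ℝ} (hc : 0 ≤ c) (h : ∀ l, |u l| ≤ c)
    (j : Fin (q + 1)) : |eventParam u j| ≤ c := by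
  refine Fin.lastCases ?_ (fun j => ?_) j
  · simpa [eventParam] using hc
  · simpa [eventParam] using h (Sum.inr j)

theorem abs_projCoef_le (hm : 0 < m) {b₀ b₁ ρ : ℝ} (hb₀ : 0 < b₀)
    {w y : Fin m → Fin (q + 1) → ℝ} (hw₀ : ∀ i j, b₀ ≤ w i j) (hw₁ : ∀ i j, w i j ≤ b₁)
    (hy : ∀ i j, |w i j * y i j| ≤ ρ * w i j) (l : Fin m ⊕ Fin q) :
    |projCoef w y l| ≤ 5 * (b₁ / b₀) * ρ := by
  have h := abs_le_of_degreeVec_eq (G := w * y) (ε := 0) (u := projCoef w y) (τ := 0) (ρ := ρ)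
    hb₀ hw₀ hw₁ hm ?_ (fun i j => hy i j) le_rfl (by simp) (by simp) l
  · simpa using h
  · have h1 := degreeVec_mul_resid hm (fun i j => hb₀.trans_le (hw₀ i j)) y
    rw [resid_apply, mul_sub, ← degreeLin_apply] at h1
    rw [sub_zero, ← degreeLin_apply, ← neg_sub, map_neg, h1, neg_zero]

theorem abs_resid_le (hm : 0 < m) {b₀ b₁ ρ : ℝ} (hb₀ : 0 < b₀)
    {w y : Fin m → Fin (q + 1) → ℝ} (hw₀ : ∀ i j, b₀ ≤ w i j) (hw₁ : ∀ i j, w i j ≤ b₁)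
    (hy : ∀ i j, |y i j| ≤ ρ) (i : Fin m) (j : Fin (q + 1)) :
    |resid w y i j| ≤ 11 * (b₁ / b₀) * ρ := by
  have h1 := abs_addArr_le (abs_projCoef_le hm hb₀ hw₀ hw₁ (ρ := ρ) (y := y) fun i j => by
    have hw : 0 ≤ w i j := hb₀.le.trans (hw₀ i j)
    rw [abs_mul, abs_of_nonneg hw, mul_comm]
    exact mul_le_mul_of_nonneg_right (hy i j) hw) i j
  have hB : 1 ≤ b₁ / b₀ := (one_le_div hb₀).2 ((hw₀ i j).trans (hw₁ i j))
  have hρ : 0 ≤ ρ := (abs_nonneg _).trans (hy i j)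
  rw [resid_apply]
  refine (abs_sub _ _).trans ?_
  nlinarith [hy i j, mul_le_mul_of_nonneg_right hB hρ]

/-- Additive arrays see the noise only through its row and column sums. -/
theorem abs_total_addArr_mul_le {ε : Fin m → Fin (q + 1) → ℝ} {u : Fin m ⊕ Fin q → ℝ} {c τ : ℝ}
    (hc : 0 ≤ c) (hu : ∀ l, |u l| ≤ c)
    (hεr : ∀ i, |∑ j, ε i j| ≤ ((q + 1 : ℕ) : ℝ) * τ) (hεc : ∀ j, |∑ i, ε i j| ≤ (m : ℝ) * τ) :
    |total (addArr u * ε)| ≤ (m : ℝ) * ((q + 1 : ℕ) : ℝ) * (2 * c * τ) := by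
  have e : total (addArr u * ε) =
      ∑ i, u (Sum.inl i) * ∑ j, ε i j + ∑ j, eventParam u j * ∑ i, ε i j := by
    simp only [Finset.mul_sum]
    rw [Finset.sum_comm (s := (Finset.univ : Finset (Fin (q + 1)))), ← Finset.sum_add_distrib,
      total_apply]
    refine Finset.sum_congr rfl fun i _ => ?_
    rw [← Finset.sum_add_distrib]
    refine Finset.sum_congr rfl fun j _ => ?_
    simp only [Pi.mul_apply, addArr, LinearMap.coe_mk, AddHom.coe_mk]; ring
  rw [e]
  refine (abs_add_le _ _).trans ?_
  have h1 : |∑ i, u (Sum.inl i) * ∑ j, ε i j| ≤ ∑ _i : Fin m, c * (((q + 1 : ℕ) : ℝ) * τ) := by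
    refine (Finset.abs_sum_le_sum_abs _ _).trans (Finset.sum_le_sum fun i _ => ?_)
    rw [abs_mul]
    exact mul_le_mul (hu _) (hεr i) (abs_nonneg _) hc
  have h2 : |∑ j, eventParam u j * ∑ i, ε i j| ≤ ∑ _j : Fin (q + 1), c * ((m : ℝ) * τ) := by
    refine (Finset.abs_sum_le_sum_abs _ _).trans (Finset.sum_le_sum fun j _ => ?_)
    rw [abs_mul]
    exact mul_le_mul (abs_eventParam_le hc hu j) (hεc j) (abs_nonneg _) hc
  simp only [Finset.sum_const, Finset.card_univ, Fintype.card_fin, nsmul_eq_mul] at h1 h2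
  linarith

/-- The full Jacobian is nonsingular: the predictors determine the parameters. -/
theorem predLin_injective (hm : 0 < m) {z : Fin m → Fin (q + 1) → Fin p → ℝ} {κ : ℝ} (hκ0 : 0 ≤ κ)
    {w : Fin m → Fin (q + 1) → ℝ} (hw : ∀ i j, 0 < w i j)
    (hκ : ∀ (e : Fin p → ℝ) (a : Fin p), (m : ℝ) * ((q + 1 : ℕ) : ℝ) * e a ^ 2 ≤
      κ * total (w * resid w (covLin z e) * resid w (covLin z e)))
    {v : (Fin m ⊕ Fin q → ℝ) × (Fin p → ℝ)} (hv : predLin z v = 0) : v = 0 := by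
  obtain ⟨u, e⟩ := v
  have hue : addArr u + covLin z e = 0 := hv
  have h1 : covLin z e - addArr (-u) = 0 := by rw [map_neg, sub_neg_eq_add, add_comm (covLin z e)]; exact hue
  have h2 := total_resid_sq_le hm hw (covLin z e) (-u)
  rw [h1, mul_zero, map_zero] at h2
  have he : e = 0 := by
    ext a
    have h3 := (hκ e a).trans (mul_le_mul_of_nonneg_left h2 hκ0)
    rw [mul_zero] at h3
    have hmn : (0 : ℝ) < (m : ℝ) * ((q + 1 : ℕ) : ℝ) := by positivity
    have h4 : e a ^ 2 ≤ 0 := by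
      by_contra hn
      linarith [mul_pos hmn (not_le.1 hn)]
    exact pow_eq_zero_iff two_ne_zero |>.1 (le_antisymm h4 (sq_nonneg _))
  rw [he, map_zero, add_zero] at hue
  have hu := addArr_injective hm (hue.trans (map_zero addArr).symm)
  rw [he, hu]; rfl

/-- The linearized moment equations, for positive weights, have only the zero solution. -/
theorem predLin_eq_zero {z : Fin m → Fin (q + 1) → Fin p → ℝ}
    {w : Fin m → Fin (q + 1) → ℝ} (hw : ∀ i j, 0 < w i j)
    {v : (Fin m ⊕ Fin q → ℝ) × (Fin p → ℝ)} (hdeg : degreeVec (w * predLin z v) = 0)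
    (hcov : ∀ a, total (w * predLin z v * covArr z a) = 0) : predLin z v = 0 := by
  refine eq_zero_of_total_mul_sq hw ?_
  have h1 : predLin z v = addArr v.1 + covLin z v.2 := rfl
  have h2 : total (w * predLin z v * addArr v.1) = 0 := by
    rw [← degreeVec_dotProduct, hdeg, zero_dotProduct]
  have h3 : total (w * predLin z v * covLin z v.2) = 0 := by
    rw [covLin_eq_sum, Finset.mul_sum, map_sum]
    refine Finset.sum_eq_zero fun a _ => ?_
    rw [mul_smul_comm, map_smul, hcov, smul_zero]
  calc total (w * predLin z v * predLin z v)
      = total (w * predLin z v * addArr v.1 + w * predLin z v * covLin z v.2) := by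
        rw [← mul_add, ← h1]
    _ = 0 := by rw [map_add, h2, h3, add_zero]

section Estimates

variable {b₀ b₁ b₂ κ Cz τ ν : ℝ} {w wb ε : Fin m → Fin (q + 1) → ℝ}
  {z : Fin m → Fin (q + 1) → Fin p → ℝ} {v : (Fin m ⊕ Fin q → ℝ) × (Fin p → ℝ)}

/-- Sup-norm bound on the degree part in terms of the noise and of the covariate part. -/
theorem abs_fst_le (hm : 0 < m) (hb₀ : 0 < b₀) (hwb : ∀ i j, b₀ ≤ wb i j ∧ wb i j ≤ b₁)
    (hz : ∀ i j, ‖z i j‖ ≤ Cz) (hdeg : degreeVec (wb * predLin z v - ε) = 0) (hτ : 0 ≤ τ)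
    (hεr : ∀ i, |∑ j, ε i j| ≤ ((q + 1 : ℕ) : ℝ) * τ) (hεc : ∀ j, |∑ i, ε i j| ≤ (m : ℝ) * τ)
    (l : Fin m ⊕ Fin q) : |v.1 l| ≤ 5 * (b₁ / b₀) * (p * Cz * ‖v.2‖ + τ / b₀) := by
  refine abs_le_of_degreeVec_eq (G := -(wb * covLin z v.2)) (ε := ε) hb₀ (fun i j => (hwb i j).1)
    (fun i j => (hwb i j).2) hm ?_ (fun i j => ?_) hτ hεr hεc l
  · rw [← hdeg]
    congr 1
    have : predLin z v = addArr v.1 + covLin z v.2 := rfl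
    rw [this]; ring
  · have hw : 0 ≤ wb i j := hb₀.le.trans (hwb i j).1
    simp only [Pi.neg_apply, Pi.mul_apply, abs_neg, abs_mul, abs_of_nonneg hw]
    rw [mul_comm]
    exact mul_le_mul_of_nonneg_right (abs_covLin_le hz _ i j) hw

theorem abs_predLin_le (hm : 0 < m) (hb₀ : 0 < b₀) (hwb : ∀ i j, b₀ ≤ wb i j ∧ wb i j ≤ b₁)
    (hz : ∀ i j, ‖z i j‖ ≤ Cz) (hdeg : degreeVec (wb * predLin z v - ε) = 0) (hτ : 0 ≤ τ)
    (hεr : ∀ i, |∑ j, ε i j| ≤ ((q + 1 : ℕ) : ℝ) * τ) (hεc : ∀ j, |∑ i, ε i j| ≤ (m : ℝ) * τ)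
    (i : Fin m) (j : Fin (q + 1)) :
    |predLin z v i j| ≤ 11 * (b₁ / b₀) * (p * Cz * ‖v.2‖ + τ / b₀) := by
  have h1 := abs_addArr_le (abs_fst_le hm hb₀ hwb hz hdeg hτ hεr hεc) i j
  have h2 := abs_covLin_le hz v.2 i j
  have hB : 1 ≤ b₁ / b₀ := (one_le_div hb₀).2 ((hwb i j).1.trans (hwb i j).2)
  have h3 : 0 ≤ p * Cz * ‖v.2‖ := (abs_nonneg _).trans h2
  have h4 : 0 ≤ τ / b₀ := by positivity
  have e : predLin z v i j = addArr v.1 i j + covLin z v.2 i j := rfl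
  rw [e]
  refine (abs_add_le _ _).trans ?_
  nlinarith [mul_le_mul_of_nonneg_right hB (add_nonneg h3 h4)]

/-- The score of a covariate under the perturbed weights `w̄` is close to the one under `w`: the
two residuals differ by an additive array of the size of `w̄ - w`, and additive arrays see only the
row and column sums of the noise. -/
theorem abs_total_resid_le (hm : 0 < m) (hb₀ : 0 < b₀) (hb₂ : 0 ≤ b₂) {D : ℝ}
    (hw : ∀ i j, b₀ ≤ w i j ∧ w i j ≤ b₁) (hwb : ∀ i j, b₀ ≤ wb i j ∧ wb i j ≤ b₁)
    (hdiff : ∀ i j, |wb i j - w i j| ≤ b₂ * D)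
    (hz : ∀ i j, ‖z i j‖ ≤ Cz) (hD : 0 ≤ D)
    (hεr : ∀ i, |∑ j, ε i j| ≤ ((q + 1 : ℕ) : ℝ) * τ) (hεc : ∀ j, |∑ i, ε i j| ≤ (m : ℝ) * τ)
    (a : Fin p)
    (hν : |total (resid w (covArr z a) * ε)| ≤ (m : ℝ) * ((q + 1 : ℕ) : ℝ) * ν) :
    |total (resid wb (covArr z a) * ε)| ≤ (m : ℝ) * ((q + 1 : ℕ) : ℝ) *
      (ν + 110 * (b₁ / b₀) ^ 2 * Cz * (b₂ * D) * τ / b₀) := by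
  have hwp : ∀ i j, 0 < w i j := fun i j => hb₀.trans_le (hw i j).1
  have hwbp : ∀ i j, 0 < wb i j := fun i j => hb₀.trans_le (hwb i j).1
  have hCz : 0 ≤ Cz := (norm_nonneg _).trans (hz ⟨0, hm⟩ 0)
  have hB : 0 ≤ b₁ / b₀ := div_nonneg ((hwp ⟨0, hm⟩ 0).le.trans (hw ⟨0, hm⟩ 0).2) hb₀.le
  set r := resid w (covArr z a) with hr
  have hrb : ∀ i j, |r i j| ≤ 11 * (b₁ / b₀) * Cz :=
    abs_resid_le hm hb₀ (fun i j => (hw i j).1) (fun i j => (hw i j).2) (abs_covArr_le hz a)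
  set Δ := projCoef wb (covArr z a) - projCoef w (covArr z a) with hΔ
  have he : resid wb (covArr z a) * ε = r * ε - addArr Δ * ε := by
    rw [hr, hΔ, resid_apply, resid_apply, map_sub]; ring
  have hΔb : ∀ l, |Δ l| ≤ 5 * (b₁ / b₀) * (b₂ * D * (11 * (b₁ / b₀) * Cz) / b₀) := fun l => by
    have h := abs_le_of_degreeVec_eq (w := wb) (u := Δ) (G := (wb - w) * r) (ε := 0) (τ := 0)
      (ρ := b₂ * D * (11 * (b₁ / b₀) * Cz) / b₀) hb₀ (fun i j => (hwb i j).1)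
      (fun i j => (hwb i j).2) hm ?_ (fun i j => ?_) le_rfl (by simp) (by simp) l
    · simpa using h
    · have h1 := degreeVec_mul_resid hm hwp (covArr z a)
      have h2 := degreeVec_mul_resid hm hwbp (covArr z a)
      have e : wb * addArr Δ - (wb - w) * r - 0 =
          w * resid w (covArr z a) - wb * resid wb (covArr z a) := by
        rw [hr, hΔ, resid_apply, resid_apply, map_sub]; ring
      rw [e, ← degreeLin_apply, map_sub, degreeLin_apply, degreeLin_apply, h1, h2, sub_zero]
    · simp only [Pi.mul_apply, Pi.sub_apply, abs_mul]
      calc |wb i j - w i j| * |r i j| ≤ b₂ * D * (11 * (b₁ / b₀) * Cz) :=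
            mul_le_mul (hdiff i j) (hrb i j) (abs_nonneg _) (by positivity)
        _ = b₂ * D * (11 * (b₁ / b₀) * Cz) / b₀ * b₀ := by field_simp
        _ ≤ _ := mul_le_mul_of_nonneg_left (hwb i j).1 (by positivity)
  have h3 := abs_total_addArr_mul_le (by positivity) hΔb hεr hεc
  rw [he, map_sub]
  refine (abs_sub _ _).trans ((add_le_add hν h3).trans (le_of_eq ?_))
  ring

/-- The covariate part solves a problem whose energy is controlled by the scores. -/
theorem norm_snd_le_of_score (hm : 0 < m) (hb₀ : 0 < b₀) (hκ0 : 0 ≤ κ)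
    (hw : ∀ i j, b₀ ≤ w i j ∧ w i j ≤ b₁) (hwb : ∀ i j, b₀ ≤ wb i j ∧ wb i j ≤ b₁)
    (hκ : ∀ (e : Fin p → ℝ) (a : Fin p), (m : ℝ) * ((q + 1 : ℕ) : ℝ) * e a ^ 2 ≤
      κ * total (w * resid w (covLin z e) * resid w (covLin z e)))
    (hdeg : degreeVec (wb * predLin z v - ε) = 0)
    (hcov : ∀ a, total ((wb * predLin z v - ε) * covArr z a) = 0) (hν0 : 0 ≤ ν)
    (hν : ∀ a, |total (resid wb (covArr z a) * ε)| ≤ (m : ℝ) * ((q + 1 : ℕ) : ℝ) * ν) :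
    ‖v.2‖ ≤ p * κ * (b₁ / b₀) * ν := by
  have hwp : ∀ i j, 0 < w i j := fun i j => hb₀.trans_le (hw i j).1
  have hwbp : ∀ i j, 0 < wb i j := fun i j => hb₀.trans_le (hwb i j).1
  have hB : 0 ≤ b₁ / b₀ := div_nonneg ((hwp ⟨0, hm⟩ 0).le.trans (hw ⟨0, hm⟩ 0).2) hb₀.le
  have hmn : (0 : ℝ) < (m : ℝ) * ((q + 1 : ℕ) : ℝ) := by positivity
  set e := v.2 with hedef
  set r := resid wb (covLin z e) with hr
  -- testing the moment equations against the residual of `zᵀ e`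
  have h0 : total ((wb * predLin z v - ε) * r) = 0 := by
    rw [hr, resid_apply, mul_sub, map_sub, ← degreeVec_dotProduct, hdeg, zero_dotProduct, sub_zero,
      covLin_eq_sum, Finset.mul_sum, map_sum]
    refine Finset.sum_eq_zero fun a _ => ?_
    rw [mul_smul_comm, map_smul, hcov, smul_zero]
  have h1 : total (wb * r * r) = total (r * ε) := by
    have h2 : total (wb * r * addArr v.1) = 0 := total_mul_resid_mul_addArr hm hwbp _ _
    have h3 := total_mul_mul_resid hm hwbp (covLin z e) (covLin z e)
    have e1 : (wb * predLin z v - ε) * r =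
        wb * r * addArr v.1 + wb * covLin z e * r - r * ε := by
      have : predLin z v = addArr v.1 + covLin z e := rfl
      rw [this]; ring
    rw [e1, map_sub, map_add, h2] at h0
    rw [← hr] at h3
    linarith
  have h4 : total (r * ε) ≤ p * ‖e‖ * ((m : ℝ) * ((q + 1 : ℕ) : ℝ) * ν) := by
    have e2 : total (r * ε) = ∑ a, e a * total (resid wb (covArr z a) * ε) := by
      rw [hr, covLin_eq_sum, map_sum, Finset.sum_mul, map_sum]
      refine Finset.sum_congr rfl fun a _ => ?_
      rw [map_smul, smul_mul_assoc, map_smul, smul_eq_mul]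
    rw [e2]
    refine (le_abs_self _).trans ((Finset.abs_sum_le_sum_abs _ _).trans ?_)
    have : ∑ a, |e a * total (resid wb (covArr z a) * ε)| ≤
        ∑ _a : Fin p, ‖e‖ * ((m : ℝ) * ((q + 1 : ℕ) : ℝ) * ν) := by
      refine Finset.sum_le_sum fun a _ => ?_
      rw [abs_mul]
      exact mul_le_mul (norm_le_pi_norm e a) (hν a) (abs_nonneg _) (norm_nonneg _)
    refine this.trans (le_of_eq ?_)
    simp; ring
  have h5 := total_resid_sq_compare hm hb₀ (fun i j => (hw i j).1) (fun i j => (hw i j).2)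
    (fun i j => (hwb i j).1) (covLin z e)
  rw [← hr, h1] at h5
  have h6 : ∀ a, e a ^ 2 ≤ p * κ * (b₁ / b₀) * ν * ‖e‖ := fun a => by
    have h7 := hκ e a
    have h8 := mul_le_mul_of_nonneg_left (h5.trans (mul_le_mul_of_nonneg_left h4 hB)) hκ0
    refine le_of_mul_le_mul_left ?_ hmn
    refine (h7.trans h8).trans (le_of_eq ?_)
    ring
  have hX : 0 ≤ p * κ * (b₁ / b₀) * ν := by positivity
  by_contra hn
  have hn := not_le.1 hn
  have h7 : ‖e‖ ≤ Real.sqrt (p * κ * (b₁ / b₀) * ν * ‖e‖) :=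
    (pi_norm_le_iff_of_nonneg (Real.sqrt_nonneg _)).2 fun a => Real.abs_le_sqrt (h6 a)
  have h8 : ‖e‖ ^ 2 ≤ p * κ * (b₁ / b₀) * ν * ‖e‖ :=
    (Real.le_sqrt (norm_nonneg _) (by positivity)).1 h7
  have : 0 < ‖e‖ := hX.trans_lt hn
  nlinarith

/-- A priori bound on the covariate part.  The perturbation of the weights enters multiplied by
the noise level `τ`, so that the bound closes up without any prior localization. -/
theorem norm_snd_le (hm : 0 < m) (hb₀ : 0 < b₀) (hb₂ : 0 ≤ b₂) (hκ0 : 0 ≤ κ)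
    (hw : ∀ i j, b₀ ≤ w i j ∧ w i j ≤ b₁) (hwb : ∀ i j, b₀ ≤ wb i j ∧ wb i j ≤ b₁)
    (hz : ∀ i j, ‖z i j‖ ≤ Cz)
    (hκ : ∀ (e : Fin p → ℝ) (a : Fin p), (m : ℝ) * ((q + 1 : ℕ) : ℝ) * e a ^ 2 ≤
      κ * total (w * resid w (covLin z e) * resid w (covLin z e)))
    (hdeg : degreeVec (wb * predLin z v - ε) = 0)
    (hcov : ∀ a, total ((wb * predLin z v - ε) * covArr z a) = 0)
    (hdiff : ∀ i j, |wb i j - w i j| ≤ b₂ * |predLin z v i j|) (hτ : 0 ≤ τ)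
    (hεr : ∀ i, |∑ j, ε i j| ≤ ((q + 1 : ℕ) : ℝ) * τ) (hεc : ∀ j, |∑ i, ε i j| ≤ (m : ℝ) * τ)
    (hν0 : 0 ≤ ν)
    (hν : ∀ a, |total (resid w (covArr z a) * ε)| ≤ (m : ℝ) * ((q + 1 : ℕ) : ℝ) * ν)
    (hsmall : 1210 * p ^ 2 * Cz ^ 2 * κ * (b₁ / b₀) ^ 4 * b₂ * τ / b₀ ≤ 1 / 2) :
    ‖v.2‖ ≤ 2 * p * κ * (b₁ / b₀) * ν +
      2420 * p * Cz * κ * (b₁ / b₀) ^ 4 * b₂ * τ ^ 2 / b₀ ^ 2 := by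
  have hCz : 0 ≤ Cz := (norm_nonneg _).trans (hz ⟨0, hm⟩ 0)
  have hB : 0 ≤ b₁ / b₀ :=
    div_nonneg (hb₀.le.trans ((hw ⟨0, hm⟩ 0).1.trans (hw ⟨0, hm⟩ 0).2)) hb₀.le
  set B := b₁ / b₀ with hBdef
  set D := 11 * B * (p * Cz * ‖v.2‖ + τ / b₀) with hDdef
  have hD : ∀ i j, |predLin z v i j| ≤ D := abs_predLin_le hm hb₀ hwb hz hdeg hτ hεr hεc
  have hD0 : 0 ≤ D := (abs_nonneg _).trans (hD ⟨0, hm⟩ 0)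
  have h1 : ∀ a, _ := fun a => abs_total_resid_le hm hb₀ hb₂ hw hwb
    (fun i j => (hdiff i j).trans (mul_le_mul_of_nonneg_left (hD i j) hb₂)) hz hD0 hεr hεc a (hν a)
  have h2 := norm_snd_le_of_score hm hb₀ hκ0 hw hwb hκ hdeg hcov (by positivity) h1
  rw [← hBdef] at h2
  have h3 : p * κ * B * (ν + 110 * B ^ 2 * Cz * (b₂ * D) * τ / b₀) =
      p * κ * B * ν + (1210 * p ^ 2 * Cz ^ 2 * κ * B ^ 4 * b₂ * τ / b₀) * ‖v.2‖ +
        1210 * p * Cz * κ * B ^ 4 * b₂ * τ ^ 2 / b₀ ^ 2 := by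
    rw [hDdef]; field_simp; ring
  rw [h3] at h2
  have h4 := mul_le_mul_of_nonneg_right hsmall (norm_nonneg v.2)
  have h5 : 2420 * p * Cz * κ * B ^ 4 * b₂ * τ ^ 2 / b₀ ^ 2 =
      2 * (1210 * p * Cz * κ * B ^ 4 * b₂ * τ ^ 2 / b₀ ^ 2) := by ring
  rw [h5]
  linarith

/-- The degree part is `V⁻¹` applied to the noise, up to the covariate part and a quadratic
remainder. -/
theorem abs_fst_sub_le (hm : 0 < m) (hb₀ : 0 < b₀) (hb₂ : 0 ≤ b₂) {D : ℝ}
    (hw : ∀ i j, b₀ ≤ w i j ∧ w i j ≤ b₁) (hz : ∀ i j, ‖z i j‖ ≤ Cz)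
    (hdeg : degreeVec (wb * predLin z v - ε) = 0)
    (hdiff : ∀ i j, |wb i j - w i j| ≤ b₂ * |predLin z v i j|)
    (hD : ∀ i j, |predLin z v i j| ≤ D) (l : Fin m ⊕ Fin q) :
    |v.1 l - ((lapMat w)⁻¹ *ᵥ degreeVec ε) l| ≤
      5 * (b₁ / b₀) * (p * Cz * ‖v.2‖ + b₂ * D ^ 2 / b₀) := by
  have hwp : ∀ i j, 0 < w i j := fun i j => hb₀.trans_le (hw i j).1
  have hD0 : 0 ≤ D := (abs_nonneg _).trans (hD ⟨0, hm⟩ 0)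
  set y := (lapMat w)⁻¹ *ᵥ degreeVec ε with hy
  have hy1 : degreeVec (w * addArr y) = degreeVec ε := by
    rw [← lapMat_mulVec, hy, Matrix.mulVec_mulVec,
      Matrix.mul_nonsing_inv _ (lapMat_isUnit_det hm hwp), Matrix.one_mulVec]
  have h := abs_le_of_degreeVec_eq (w := w) (u := v.1 - y)
    (G := -(w * covLin z v.2) - (wb - w) * predLin z v) (ε := 0) (τ := 0)
    (ρ := p * Cz * ‖v.2‖ + b₂ * D ^ 2 / b₀) hb₀ (fun i j => (hw i j).1)
    (fun i j => (hw i j).2) hm ?_ (fun i j => ?_) le_rfl (by simp) (by simp) l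
  · simpa using h
  · have e : w * addArr (v.1 - y) - (-(w * covLin z v.2) - (wb - w) * predLin z v) - 0 =
        (wb * predLin z v - ε) - (w * addArr y - ε) := by
      have : predLin z v = addArr v.1 + covLin z v.2 := rfl
      rw [this, map_sub]; ring
    rw [e, ← degreeLin_apply, map_sub, map_sub degreeLin (w * addArr y), degreeLin_apply, hdeg,
      degreeLin_apply, degreeLin_apply, hy1, sub_self, sub_zero]
  · simp only [Pi.mul_apply, Pi.sub_apply, Pi.neg_apply]
    refine (abs_sub _ _).trans ?_
    rw [abs_neg, abs_mul, abs_mul, abs_of_pos (hwp i j), add_mul]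
    refine add_le_add ?_ ?_
    · rw [mul_comm]
      exact mul_le_mul_of_nonneg_right (abs_covLin_le hz _ i j) (hwp i j).le
    · calc |wb i j - w i j| * |predLin z v i j| ≤ b₂ * D * D :=
            mul_le_mul ((hdiff i j).trans (mul_le_mul_of_nonneg_left (hD i j) hb₂)) (hD i j)
              (abs_nonneg _) (by positivity)
        _ = b₂ * D ^ 2 / b₀ * b₀ := by field_simp
        _ ≤ _ := mul_le_mul_of_nonneg_left (hw i j).1 (by positivity)

end Estimates

/-! ### The noise -/

section Noise

variable {Ω : Type*} [MeasurableSpace Ω] {P : Measure Ω}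

/-- The array of centered edge weights at `ω`. -/
noncomputable def noise (x : Fin m → Fin (q + 1) → Ω → ℝ) (P : Measure Ω) (ω : Ω) :
    Fin m → Fin (q + 1) → ℝ :=
  fun i j => x i j ω - ∫ ω', x i j ω' ∂P

theorem IsSubExponential.memLp [IsProbabilityMeasure P] {Y : Ω → ℝ} {h : ℝ}
    (hY : IsSubExponential Y h P) : MemLp (fun ω => Y ω - ∫ ω', Y ω' ∂P) 2 P := by
  obtain ⟨h0, _, h2⟩ := hY
  refine memLp_of_mem_interior_integrableExpSet (p := 2) ?_
  rw [mem_interior]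
  refine ⟨Set.Ioo (-(1 / h)) (1 / h), fun s hs => (h2 s (abs_lt.2 hs)).1, isOpen_Ioo, ?_⟩
  have : 0 < 1 / h := by positivity
  exact ⟨by linarith, this⟩

theorem noise_memLp [IsProbabilityMeasure P] {x : Fin m → Fin (q + 1) → Ω → ℝ}
    {h : Fin m → Fin (q + 1) → ℝ} (hsub : ∀ i j, IsSubExponential (x i j) (h i j) P) (i : Fin m)
    (j : Fin (q + 1)) : MemLp (fun ω => noise x P ω i j) 2 P :=
  (hsub i j).memLp

theorem integral_noise [IsProbabilityMeasure P] {x : Fin m → Fin (q + 1) → Ω → ℝ}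
    (hint : ∀ i j, Integrable (x i j) P) (i : Fin m)
    (j : Fin (q + 1)) : ∫ ω, noise x P ω i j ∂P = 0 := by
  simp only [noise]
  rw [integral_sub (hint i j) (integrable_const _)]
  simp

theorem measurable_noise {x : Fin m → Fin (q + 1) → Ω → ℝ}
    (hx : ∀ i j, Measurable (x i j)) (i : Fin m) (j : Fin (q + 1)) :
    Measurable (fun ω => noise x P ω i j) :=
  (hx i j).sub_const _

theorem degreeAt_sub_meanDegree {x : Fin m → Fin (q + 1) → Ω → ℝ}
    (hint : ∀ i j, Integrable (x i j) P) (ω : Ω) :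
    degreeAt x ω - meanDegree x P = degreeVec (noise x P ω) := by
  ext (i | j)
  · simp only [Pi.sub_apply, degreeAt, meanDegree, degreeVec, noise, Finset.sum_sub_distrib]
    rw [integral_finsetSum _ fun j _ => hint i j]
  · simp only [Pi.sub_apply, degreeAt, meanDegree, degreeVec, noise, Finset.sum_sub_distrib]
    rw [integral_finsetSum _ fun i _ => hint i j.castSucc]

theorem lastDegreeCentered_eq {x : Fin m → Fin (q + 1) → Ω → ℝ}
    (hint : ∀ i j, Integrable (x i j) P) (ω : Ω) :
    lastDegreeCentered x P ω = ∑ i, noise x P ω i (Fin.last q) := by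
  simp only [lastDegreeCentered, lastDegree, noise, Finset.sum_sub_distrib]
  rw [integral_finsetSum _ fun i _ => hint i (Fin.last q)]

theorem iIndepFun_noise {x : Fin m → Fin (q + 1) → Ω → ℝ}
    (hindep : iIndepFun (fun (ij : Fin m × Fin (q + 1)) => x ij.1 ij.2) P) :
    iIndepFun (fun (ij : Fin m × Fin (q + 1)) ω => noise x P ω ij.1 ij.2) P :=
  hindep.comp (fun ij t => t - ∫ ω', x ij.1 ij.2 ω' ∂P) fun _ => measurable_id.sub_const _

/-- Chernoff bound for sums of at most `m` of the centered weights. -/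
theorem measure_abs_sum_noise_gt [IsProbabilityMeasure P] {x : Fin m → Fin (q + 1) → Ω → ℝ}
    (hx : ∀ i j, Measurable (x i j))
    (hindep : iIndepFun (fun (ij : Fin m × Fin (q + 1)) => x ij.1 ij.2) P)
    {h : Fin m → Fin (q + 1) → ℝ} (hsub : ∀ i j, IsSubExponential (x i j) (h i j) P) {H : ℝ}
    (hH : ∀ i j, h i j ≤ H) (hH0 : 0 < H) (hm : 0 < m) (hlog : 4 * Real.log m < m)
    (T : Finset (Fin m × Fin (q + 1))) (hT : T.card ≤ m) :
    P {ω | 2 * H * Real.sqrt (m * Real.log m) < |∑ ij ∈ T, noise x P ω ij.1 ij.2|} ≤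
      ENNReal.ofReal (2 / (m : ℝ) ^ 2) := by
  have hm0 : (0 : ℝ) < m := by exact_mod_cast hm
  have hl0 : 0 ≤ Real.log m := Real.log_natCast_nonneg m
  -- the optimal exponent
  set s := 2 * Real.sqrt (Real.log m / m) / H with hs
  have hs0 : 0 ≤ s := by positivity
  have hsq : Real.sqrt (Real.log m / m) ^ 2 = Real.log m / m := Real.sq_sqrt (by positivity)
  have hs1 : s < 1 / H := by
    rw [hs]
    refine div_lt_div_of_pos_right ?_ hH0
    have h1 : Real.sqrt (Real.log m / m) < 1 / 2 := by
      rw [Real.sqrt_lt' (by norm_num), div_lt_iff₀ hm0]; linarith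
    linarith
  have hst : s * (2 * H * Real.sqrt (m * Real.log m)) = 4 * Real.log m := by
    have h1 : Real.sqrt (Real.log m / m) * Real.sqrt (m * Real.log m) = Real.log m := by
      rw [← Real.sqrt_mul (by positivity)]
      have : Real.log m / m * (m * Real.log m) = Real.log m ^ 2 := by field_simp
      rw [this, Real.sqrt_sq hl0]
    rw [hs]
    calc _ = 4 * (Real.sqrt (Real.log m / m) * Real.sqrt (m * Real.log m)) := by field_simp; ring
      _ = _ := by rw [h1]
  have hmgf : ∀ t : ℝ, |t| = s → ∀ i j,
      Integrable (fun ω => Real.exp (t * noise x P ω i j)) P ∧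
      mgf (fun ω => noise x P ω i j) P t ≤ Real.exp (s ^ 2 * H ^ 2 / 2) := by
    intro t ht i j
    obtain ⟨h0, -, h2⟩ := hsub i j
    have h3 := h2 t (by
      rw [ht]
      exact hs1.trans_le (one_div_le_one_div_of_le h0 (hH i j)))
    refine ⟨h3.1, h3.2.trans (Real.exp_le_exp.2 ?_)⟩
    rw [← sq_abs t, ht]
    have : h i j ^ 2 ≤ H ^ 2 := pow_le_pow_left₀ h0.le (hH i j) 2
    have := mul_le_mul_of_nonneg_left this (sq_nonneg s)
    linarith
  have hindep' := iIndepFun_noise hindep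
  have htail : ∀ t : ℝ, |t| = s → Integrable (fun ω => Real.exp (t * ∑ ij ∈ T,
      noise x P ω ij.1 ij.2)) P ∧
      mgf (fun ω => ∑ ij ∈ T, noise x P ω ij.1 ij.2) P t ≤ Real.exp (2 * Real.log m) := by
    intro t ht
    have e : (fun ω => ∑ ij ∈ T, noise x P ω ij.1 ij.2) =
        ∑ ij ∈ T, (fun (ij : Fin m × Fin (q + 1)) ω => noise x P ω ij.1 ij.2) ij := by
      ext ω; rw [Finset.sum_apply]
    constructor
    · have := hindep'.integrable_exp_mul_sum (t := t) (s := T)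
        (fun ij => measurable_noise hx ij.1 ij.2) (fun ij _ => (hmgf t ht ij.1 ij.2).1)
      rw [← e] at this
      exact this
    · rw [e, hindep'.mgf_sum (fun ij => measurable_noise hx ij.1 ij.2)]
      refine (Finset.prod_le_prod (g := fun _ => Real.exp (s ^ 2 * H ^ 2 / 2))
        (fun ij _ => mgf_nonneg) (fun ij _ => (hmgf t ht ij.1 ij.2).2)).trans ?_
      · rw [Finset.prod_const, ← Real.exp_nat_mul]
        refine Real.exp_le_exp.2 ?_
        have h1 : s ^ 2 * H ^ 2 = 4 * (Real.log m / m) := by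
          rw [hs, div_pow, mul_pow, hsq]; field_simp; ring
        rw [h1]
        calc (T.card : ℝ) * (4 * (Real.log m / m) / 2) ≤ m * (4 * (Real.log m / m) / 2) :=
              mul_le_mul_of_nonneg_right (by exact_mod_cast hT) (by positivity)
          _ = 2 * Real.log m := by field_simp; ring
  have hexp : Real.exp (-(2 * Real.log m)) = 1 / (m : ℝ) ^ 2 := by
    rw [Real.exp_neg, one_div, mul_comm, Real.exp_mul, Real.exp_log hm0]
    norm_num
  have hfin : Real.exp (-s * (2 * H * Real.sqrt (m * Real.log m))) * Real.exp (2 * Real.log m) =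
      1 / (m : ℝ) ^ 2 := by
    rw [neg_mul, hst, ← Real.exp_add, ← hexp]; congr 1; ring
  have hup : P.real {ω | 2 * H * Real.sqrt (m * Real.log m) ≤ ∑ ij ∈ T, noise x P ω ij.1 ij.2} ≤
      1 / (m : ℝ) ^ 2 := by
    obtain ⟨h1, h2⟩ := htail s (abs_of_nonneg hs0)
    refine (measure_ge_le_exp_mul_mgf _ hs0 h1).trans ?_
    rw [← hfin]
    exact mul_le_mul_of_nonneg_left h2 (Real.exp_pos _).le
  have hlow : P.real {ω | ∑ ij ∈ T, noise x P ω ij.1 ij.2 ≤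
      -(2 * H * Real.sqrt (m * Real.log m))} ≤ 1 / (m : ℝ) ^ 2 := by
    obtain ⟨h1, h2⟩ := htail (-s) (by rw [abs_neg, abs_of_nonneg hs0])
    refine (measure_le_le_exp_mul_mgf _ (neg_nonpos.2 hs0) h1).trans ?_
    rw [← hfin, neg_neg, mul_neg, ← neg_mul]
    exact mul_le_mul_of_nonneg_left h2 (Real.exp_pos _).le
  rw [← ofReal_measureReal]
  refine ENNReal.ofReal_le_ofReal ?_
  have hsubset : {ω | 2 * H * Real.sqrt (m * Real.log m) < |∑ ij ∈ T, noise x P ω ij.1 ij.2|} ⊆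
      {ω | 2 * H * Real.sqrt (m * Real.log m) ≤ ∑ ij ∈ T, noise x P ω ij.1 ij.2} ∪
      {ω | ∑ ij ∈ T, noise x P ω ij.1 ij.2 ≤ -(2 * H * Real.sqrt (m * Real.log m))} := by
    intro ω hω
    have hω' : 2 * H * Real.sqrt (m * Real.log m) < |∑ ij ∈ T, noise x P ω ij.1 ij.2| := hω
    rcases lt_abs.1 hω' with h | h
    · exact Or.inl h.le
    · exact Or.inr (by simp only [Set.mem_ofPred_eq]; linarith)
  refine (measureReal_mono hsubset).trans ((measureReal_union_le _ _).trans ?_)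
  calc _ ≤ 1 / (m : ℝ) ^ 2 + 1 / (m : ℝ) ^ 2 := add_le_add hup hlow
    _ = _ := by ring

/-- With high probability all centered row and column sums are `O(h √(m log m))`. -/
theorem measure_not_degrees_le [IsProbabilityMeasure P] {x : Fin m → Fin (q + 1) → Ω → ℝ}
    (hx : ∀ i j, Measurable (x i j))
    (hindep : iIndepFun (fun (ij : Fin m × Fin (q + 1)) => x ij.1 ij.2) P)
    {h : Fin m → Fin (q + 1) → ℝ} (hsub : ∀ i j, IsSubExponential (x i j) (h i j) P) {H : ℝ}
    (hH : ∀ i j, h i j ≤ H) (hH0 : 0 < H) (hm : 0 < m) (hlog : 4 * Real.log m < m)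
    (hqm : q + 1 ≤ m) :
    P {ω | ¬ ((∀ i, |∑ j, noise x P ω i j| ≤ 2 * H * Real.sqrt (m * Real.log m)) ∧
      ∀ j, |∑ i, noise x P ω i j| ≤ 2 * H * Real.sqrt (m * Real.log m))} ≤
      ENNReal.ofReal (4 / m) := by
  have hm0 : (0 : ℝ) < m := by exact_mod_cast hm
  set t := 2 * H * Real.sqrt (m * Real.log m) with ht
  have hr : ∀ i, P {ω | t < |∑ j, noise x P ω i j|} ≤ ENNReal.ofReal (2 / (m : ℝ) ^ 2) := by
    intro i
    have := measure_abs_sum_noise_gt hx hindep hsub hH hH0 hm hlog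
      (({i} : Finset (Fin m)) ×ˢ (Finset.univ : Finset (Fin (q + 1)))) (by simpa using hqm)
    simpa only [Finset.sum_product, Finset.sum_singleton] using this
  have hc : ∀ j, P {ω | t < |∑ i, noise x P ω i j|} ≤ ENNReal.ofReal (2 / (m : ℝ) ^ 2) := by
    intro j
    have := measure_abs_sum_noise_gt hx hindep hsub hH hH0 hm hlog
      ((Finset.univ : Finset (Fin m)) ×ˢ ({j} : Finset (Fin (q + 1)))) (by simp)
    simpa only [Finset.sum_product, Finset.sum_singleton] using this
  have hsubset : {ω | ¬ ((∀ i, |∑ j, noise x P ω i j| ≤ t) ∧ ∀ j, |∑ i, noise x P ω i j| ≤ t)} ⊆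
      (⋃ i, {ω | t < |∑ j, noise x P ω i j|}) ∪ ⋃ j, {ω | t < |∑ i, noise x P ω i j|} := by
    intro ω hω
    simp only [Set.mem_ofPred_eq, not_and_or, not_forall, not_le] at hω
    rcases hω with ⟨i, hi⟩ | ⟨j, hj⟩
    · exact Or.inl (Set.mem_iUnion.2 ⟨i, hi⟩)
    · exact Or.inr (Set.mem_iUnion.2 ⟨j, hj⟩)
  refine (measure_mono hsubset).trans ((measure_union_le _ _).trans ?_)
  have h1 : P (⋃ i, {ω | t < |∑ j, noise x P ω i j|}) ≤ m * ENNReal.ofReal (2 / (m : ℝ) ^ 2) := by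
    refine (measure_iUnion_fintype_le _ _).trans ((Finset.sum_le_sum fun i _ => hr i).trans ?_)
    simp
  have h2 : P (⋃ j, {ω | t < |∑ i, noise x P ω i j|}) ≤
      m * ENNReal.ofReal (2 / (m : ℝ) ^ 2) := by
    refine (measure_iUnion_fintype_le _ _).trans ((Finset.sum_le_sum fun j _ => hc j).trans ?_)
    simp only [Finset.sum_const, Finset.card_univ, Fintype.card_fin, nsmul_eq_mul]
    gcongr
  refine (add_le_add h1 h2).trans (le_of_eq ?_)
  rw [← ENNReal.ofReal_natCast, ← ENNReal.ofReal_mul hm0.le, ← ENNReal.ofReal_add (by positivity)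
    (by positivity)]
  congr 1; field_simp; ring

/-- Chebyshev's inequality in terms of the second moment, including the degenerate case. -/
theorem measure_abs_gt_le [IsProbabilityMeasure P] {X : Ω → ℝ} (hX : MemLp X 2 P) {v K : ℝ}
    (hv : ∫ ω, X ω ^ 2 ∂P ≤ v) (hK : 0 < K) :
    P {ω | K * Real.sqrt v < |X ω|} ≤ ENNReal.ofReal (1 / K ^ 2) := by
  have hint : Integrable (fun ω => X ω ^ 2) P := hX.integrable_sq
  have hv0 : 0 ≤ v := (integral_nonneg fun ω => sq_nonneg (X ω)).trans hv
  rcases hv0.eq_or_lt with h0 | h0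
  · have h1 : ∫ ω, X ω ^ 2 ∂P = 0 :=
      le_antisymm (hv.trans_eq h0.symm) (integral_nonneg fun ω => sq_nonneg (X ω))
    rw [integral_eq_zero_iff_of_nonneg (fun ω => sq_nonneg (X ω)) hint] at h1
    have h2 : P {ω | K * Real.sqrt v < |X ω|} = 0 := by
      rw [← h0, Real.sqrt_zero, mul_zero]
      refine measure_mono_null (fun ω hω => ?_) (ae_iff.1 h1)
      simpa using hω
    rw [h2]; exact zero_le
  · have h1 := mul_meas_ge_le_integral_of_nonneg (μ := P) (f := fun ω => X ω ^ 2)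
      (Filter.Eventually.of_forall fun ω => sq_nonneg (X ω)) hint (K ^ 2 * v)
    have h2 : P.real {ω | K ^ 2 * v ≤ X ω ^ 2} ≤ 1 / K ^ 2 := by
      rw [le_div_iff₀ (by positivity)]
      refine le_of_mul_le_mul_right ?_ h0
      linarith
    rw [← ofReal_measureReal]
    refine ENNReal.ofReal_le_ofReal (le_trans (measureReal_mono fun ω hω => ?_) h2)
    have h3 : K * Real.sqrt v < |X ω| := hω
    have h4 : (K * Real.sqrt v) ^ 2 ≤ |X ω| ^ 2 := pow_le_pow_left₀ (by positivity) h3.le 2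
    rw [mul_pow, Real.sq_sqrt hv0, sq_abs] at h4
    exact h4

theorem memLp_total_mul_noise [IsProbabilityMeasure P] {x : Fin m → Fin (q + 1) → Ω → ℝ}
    (hL : ∀ i j, MemLp (fun ω => noise x P ω i j) 2 P) (c : Fin m → Fin (q + 1) → ℝ) :
    MemLp (fun ω => total (c * noise x P ω)) 2 P := by
  simp only [total_apply, Pi.mul_apply]
  exact memLp_finsetSum _ fun i _ => memLp_finsetSum _ fun j _ => (hL i j).const_mul _

/-- Independent centered weights are orthogonal. -/
theorem integral_sq_total_mul_noise [IsProbabilityMeasure P] {x : Fin m → Fin (q + 1) → Ω → ℝ}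
    (hint : ∀ i j, Integrable (x i j) P) (hL : ∀ i j, MemLp (fun ω => noise x P ω i j) 2 P)
    (hindep : iIndepFun (fun (ij : Fin m × Fin (q + 1)) => x ij.1 ij.2) P)
    (c : Fin m → Fin (q + 1) → ℝ) :
    ∫ ω, total (c * noise x P ω) ^ 2 ∂P =
      total fun i j => c i j ^ 2 * ∫ ω, noise x P ω i j ^ 2 ∂P := by
  have hL' : ∀ ij : Fin m × Fin (q + 1), MemLp (fun ω => c ij.1 ij.2 * noise x P ω ij.1 ij.2) 2 P :=
    fun ij => (hL ij.1 ij.2).const_mul _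
  have hmean : ∀ ij : Fin m × Fin (q + 1), ∫ ω, c ij.1 ij.2 * noise x P ω ij.1 ij.2 ∂P = 0 :=
    fun ij => by rw [integral_const_mul, integral_noise hint, mul_zero]
  have e' : ∀ ω, total (c * noise x P ω) =
      ∑ ij : Fin m × Fin (q + 1), c ij.1 ij.2 * noise x P ω ij.1 ij.2 := fun ω => by
    rw [total_apply, Fintype.sum_prod_type]; rfl
  have e : (fun ω => total (c * noise x P ω)) =
      ∑ ij : Fin m × Fin (q + 1), fun ω => c ij.1 ij.2 * noise x P ω ij.1 ij.2 := by
    ext ω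
    rw [Finset.sum_apply, e']
  have hm0 : ∫ ω, total (c * noise x P ω) ∂P = 0 := by
    simp_rw [e']
    rw [integral_finsetSum _ fun ij _ => (hL' ij).integrable one_le_two]
    exact Finset.sum_eq_zero fun ij _ => hmean ij
  have h1 := variance_of_integral_eq_zero (memLp_total_mul_noise hL c).aemeasurable hm0
  rw [← h1, e, IndepFun.variance_sum (fun ij _ => hL' ij), total_apply, Fintype.sum_prod_type]
  · refine Finset.sum_congr rfl fun i _ => Finset.sum_congr rfl fun j _ => ?_
    rw [variance_of_integral_eq_zero (hL' (i, j)).aemeasurable (hmean (i, j)),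
      ← integral_const_mul]
    simp only [mul_pow]
  · intro ij _ kl _ hne
    exact ((iIndepFun_noise hindep).indepFun hne).comp (measurable_const_mul (c ij.1 ij.2))
      (measurable_const_mul (c kl.1 kl.2))

end Noise

/-! ### The edge variances are bounded by `σ²` -/

theorem lastDiag_smul (s : ℝ) (V : Matrix (Fin m ⊕ Fin q) (Fin m ⊕ Fin q) ℝ) :
    lastDiag (s • V) = s * lastDiag V := by
  simp only [lastDiag, lastEntry, Matrix.smul_apply, smul_eq_mul, ← Finset.mul_sum, ← mul_sub]

theorem matS_smul {s : ℝ} (hs : s * s = 1) (V : Matrix (Fin m ⊕ Fin q) (Fin m ⊕ Fin q) ℝ) :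
    matS (s • V) = s • matS V := by
  have hinv : s⁻¹ = s := inv_eq_of_mul_eq_one_left hs
  ext (i | i) (j | j) <;>
    simp only [matS, Matrix.of_apply, Matrix.smul_apply, smul_eq_mul, lastDiag_smul,
      div_eq_mul_inv, mul_inv, hinv] <;> ring

section Noise

variable {Ω : Type*} [MeasurableSpace Ω] {P : Measure Ω}

theorem degreeVec_memLp [IsProbabilityMeasure P] {x : Fin m → Fin (q + 1) → Ω → ℝ}
    (hL : ∀ i j, MemLp (fun ω => noise x P ω i j) 2 P) (a : Fin m ⊕ Fin q) :
    MemLp (fun ω => degreeVec (noise x P ω) a) 2 P := by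
  rcases a with i | j
  · exact memLp_finsetSum _ fun j _ => hL i j
  · exact memLp_finsetSum _ fun i _ => hL i j.castSucc

theorem mulVec_degreeVec_memLp [IsProbabilityMeasure P] {x : Fin m → Fin (q + 1) → Ω → ℝ}
    (hL : ∀ i j, MemLp (fun ω => noise x P ω i j) 2 P)
    (W : Matrix (Fin m ⊕ Fin q) (Fin m ⊕ Fin q) ℝ) (l : Fin m ⊕ Fin q) :
    MemLp (fun ω => (W *ᵥ degreeVec (noise x P ω)) l) 2 P := by
  simp only [Matrix.mulVec, dotProduct]
  exact memLp_finsetSum _ fun a _ => (degreeVec_memLp hL a).const_mul (W l a)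

theorem covDegree_apply {x : Fin m → Fin (q + 1) → Ω → ℝ}
    (hint : ∀ i j, Integrable (x i j) P) (a b : Fin m ⊕ Fin q) :
    covDegree x P a b = ∫ ω, degreeVec (noise x P ω) a * degreeVec (noise x P ω) b ∂P := by
  simp only [covDegree, Matrix.of_apply, covariance, ← degreeAt_sub_meanDegree hint]
  rfl

theorem integral_sq_mulVec [IsProbabilityMeasure P] {x : Fin m → Fin (q + 1) → Ω → ℝ}
    (hint : ∀ i j, Integrable (x i j) P) (hL : ∀ i j, MemLp (fun ω => noise x P ω i j) 2 P)
    {W : Matrix (Fin m ⊕ Fin q) (Fin m ⊕ Fin q) ℝ} (hW : W.IsSymm) (l : Fin m ⊕ Fin q) :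
    ∫ ω, (W *ᵥ degreeVec (noise x P ω)) l ^ 2 ∂P = (W * covDegree x P * W) l l := by
  have hG := degreeVec_memLp hL
  have e : ∀ ω, (W *ᵥ degreeVec (noise x P ω)) l ^ 2 =
      ∑ b, ∑ a, W l a * W l b * (degreeVec (noise x P ω) a * degreeVec (noise x P ω) b) := by
    intro ω
    rw [sq, Matrix.mulVec, dotProduct, Finset.sum_mul_sum, Finset.sum_comm]
    exact Finset.sum_congr rfl fun b _ => Finset.sum_congr rfl fun a _ => by ring
  simp_rw [e]
  have hI : ∀ a b, Integrable (fun ω => W l a * W l b *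
      (degreeVec (noise x P ω) a * degreeVec (noise x P ω) b)) P := fun a b =>
    ((hG a).integrable_mul (hG b)).const_mul _
  rw [integral_finsetSum _ fun b _ => integrable_finsetSum _ fun a _ => hI a b, Matrix.mul_apply]
  refine Finset.sum_congr rfl fun b _ => ?_
  rw [integral_finsetSum _ fun a _ => hI a b, Matrix.mul_apply, Finset.sum_mul]
  refine Finset.sum_congr rfl fun a _ => ?_
  rw [integral_const_mul, covDegree_apply hint, ← hW.apply b l]
  ring

theorem inv_sub_matS_isSymm {V : Matrix (Fin m ⊕ Fin q) (Fin m ⊕ Fin q) ℝ} (hV : V.IsSymm) :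
    (V⁻¹ - matS V).IsSymm := by
  rw [Matrix.IsSymm, Matrix.transpose_sub, Matrix.transpose_nonsing_inv, hV.eq,
    (matS_isSymm V).eq]

/-- Each coordinate of `(V⁻¹ - S)(g - E g)` has variance at most `σ² / (m + n - 1)²`, a diagonal
entry of the matrix in the definition of `σ`. -/
theorem sq_mul_integral_sq_le_sigma_sq [IsProbabilityMeasure P]
    {x : Fin m → Fin (q + 1) → Ω → ℝ} (hint : ∀ i j, Integrable (x i j) P)
    (hL : ∀ i j, MemLp (fun ω => noise x P ω i j) 2 P)
    {V : Matrix (Fin m ⊕ Fin q) (Fin m ⊕ Fin q) ℝ} (hV : V.IsSymm) (l : Fin m ⊕ Fin q) :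
    ((m : ℝ) + q) ^ 2 * ∫ ω, ((V⁻¹ - matS V) *ᵥ degreeVec (noise x P ω)) l ^ 2 ∂P ≤
      sigma V x P ^ 2 := by
  have h0 : 0 ≤ maxNorm ((V⁻¹ - matS V) * covDegree x P * (V⁻¹ - matS V)) :=
    Real.iSup_nonneg fun _ => abs_nonneg _
  rw [sigma, Real.sq_sqrt (by positivity), integral_sq_mulVec hint hL (inv_sub_matS_isSymm hV)]
  refine mul_le_mul_of_nonneg_left ((le_abs_self _).trans ?_) (by positivity)
  exact le_ciSup (f := fun ij : (Fin m ⊕ Fin q) × (Fin m ⊕ Fin q) =>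
    |((V⁻¹ - matS V) * covDegree x P * (V⁻¹ - matS V)) ij.1 ij.2|) (Set.finite_range _).bddAbove
    (l, l)

/-- The sum of the edge variances is controlled by `σ²`.  By `total_mul_addArr_error` the sum of
all the noise is a weighted sum of the coordinates of `(V⁻¹ - S)(g - E g)`. -/
theorem total_variance_le [IsProbabilityMeasure P] (hm : 0 < m)
    {x : Fin m → Fin (q + 1) → Ω → ℝ} (hint : ∀ i j, Integrable (x i j) P)
    (hL : ∀ i j, MemLp (fun ω => noise x P ω i j) 2 P)
    (hindep : iIndepFun (fun (ij : Fin m × Fin (q + 1)) => x ij.1 ij.2) P)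
    {w : Fin m → Fin (q + 1) → ℝ} {b₁ s : ℝ} (hs : s * s = 1) (hw : ∀ i j, 0 < (s • w) i j)
    (hw₁ : ∀ i j, (s • w) i j ≤ b₁) :
    (total fun i j => ∫ ω, noise x P ω i j ^ 2 ∂P) ≤
      4 * b₁ ^ 2 * ((m : ℝ) * ((q + 1 : ℕ) : ℝ)) ^ 2 *
        (sigma (lapMat w) x P ^ 2 / ((m : ℝ) + q) ^ 2) := by
  set V := lapMat w with hV
  set W := V⁻¹ - matS V with hW
  set v := sigma V x P ^ 2 / ((m : ℝ) + q) ^ 2 with hv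
  have hmq : (0 : ℝ) < (m : ℝ) + q := by positivity
  have hv0 : 0 ≤ v := by positivity
  have hU : ∀ l, ∫ ω, (W *ᵥ degreeVec (noise x P ω)) l ^ 2 ∂P ≤ v := fun l => by
    rw [hv, le_div_iff₀ (by positivity), mul_comm]
    exact sq_mul_integral_sq_le_sigma_sq hint hL (lapMat_isSymm w) l
  have hUL := mulVec_degreeVec_memLp hL W
  have hWs : (lapMat (s • w))⁻¹ - matS (lapMat (s • w)) = s • W := by
    rw [lapMat_smul_inv hs, lapMat_smul, matS_smul hs, hW, smul_sub]
  have hid : ∀ ω, total (noise x P ω) ^ 2 ≤ (m : ℝ) * ((q + 1 : ℕ) : ℝ) * b₁ ^ 2 *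
      total fun i j => addArr (W *ᵥ degreeVec (noise x P ω)) i j ^ 2 := fun ω => by
    have h1 := total_mul_addArr_error hm hw (noise x P ω)
    rw [hWs, Matrix.smul_mulVec, map_smul, mul_smul_comm, map_smul, smul_eq_mul] at h1
    have h2 : total (noise x P ω) ^ 2 =
        total ((s • w) * addArr (W *ᵥ degreeVec (noise x P ω))) ^ 2 := by
      have h3 : (s * total ((s • w) * addArr (W *ᵥ degreeVec (noise x P ω)))) ^ 2 =
          total (noise x P ω) ^ 2 := by rw [h1]; ring
      rw [← h3, mul_pow, sq s, hs, one_mul]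
    rw [h2]
    set y := addArr (W *ᵥ degreeVec (noise x P ω)) with hy
    have h4 := sq_sum_le_card_mul_sum_sq (s := (Finset.univ : Finset (Fin m × Fin (q + 1))))
      (f := fun ij => ((s • w) * y) ij.1 ij.2)
    simp only [Fintype.sum_prod_type, Finset.card_univ, Fintype.card_prod, Fintype.card_fin] at h4
    rw [total_apply]
    refine h4.trans ?_
    have h5 : ∑ i, ∑ j, ((s • w) * y) i j ^ 2 ≤ b₁ ^ 2 * total fun i j => y i j ^ 2 := by
      rw [total_apply, Finset.mul_sum]
      refine Finset.sum_le_sum fun i _ => ?_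
      rw [Finset.mul_sum]
      refine Finset.sum_le_sum fun j _ => ?_
      rw [Pi.mul_apply, Pi.mul_apply, mul_pow]
      exact mul_le_mul_of_nonneg_right (pow_le_pow_left₀ (hw i j).le (hw₁ i j) 2) (sq_nonneg _)
    calc _ ≤ ((m * (q + 1) : ℕ) : ℝ) * (b₁ ^ 2 * total fun i j => y i j ^ 2) :=
          mul_le_mul_of_nonneg_left h5 (Nat.cast_nonneg _)
      _ = _ := by push_cast; ring
  have hyL : ∀ i j, MemLp (fun ω => addArr (W *ᵥ degreeVec (noise x P ω)) i j) 2 P ∧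
      ∫ ω, addArr (W *ᵥ degreeVec (noise x P ω)) i j ^ 2 ∂P ≤ 4 * v := by
    intro i j
    refine Fin.lastCases ?_ (fun j => ?_) j
    · simp only [addArr_last]
      exact ⟨hUL _, (hU _).trans (by linarith)⟩
    · simp only [addArr_castSucc]
      refine ⟨(hUL _).add (hUL _), ?_⟩
      have h1 : ∫ ω, ((W *ᵥ degreeVec (noise x P ω)) (Sum.inl i) +
          (W *ᵥ degreeVec (noise x P ω)) (Sum.inr j)) ^ 2 ∂P ≤
          ∫ ω, (2 * (W *ᵥ degreeVec (noise x P ω)) (Sum.inl i) ^ 2 +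
            2 * (W *ᵥ degreeVec (noise x P ω)) (Sum.inr j) ^ 2) ∂P := by
        refine integral_mono ((hUL (Sum.inl i)).add (hUL (Sum.inr j))).integrable_sq
          (((hUL _).integrable_sq.const_mul 2).add ((hUL _).integrable_sq.const_mul 2))
          fun ω => ?_
        have := sq_nonneg ((W *ᵥ degreeVec (noise x P ω)) (Sum.inl i) -
          (W *ᵥ degreeVec (noise x P ω)) (Sum.inr j))
        simp only
        linarith
      rw [integral_add ((hUL _).integrable_sq.const_mul 2) ((hUL _).integrable_sq.const_mul 2),
        integral_const_mul, integral_const_mul] at h1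
      linarith [hU (Sum.inl i), hU (Sum.inr j)]
  have hsum := integral_sq_total_mul_noise hint hL hindep 1
  simp only [one_mul, Pi.one_apply, one_pow] at hsum
  have hyint : Integrable (fun ω => total fun i j =>
      addArr (W *ᵥ degreeVec (noise x P ω)) i j ^ 2) P := by
    simp only [total_apply]
    exact integrable_finsetSum _ fun i _ => integrable_finsetSum _ fun j _ => (hyL i j).1.integrable_sq
  have hnL : MemLp (fun ω => total (noise x P ω)) 2 P := by
    simpa only [one_mul] using memLp_total_mul_noise hL 1
  rw [← hsum]
  refine (integral_mono hnL.integrable_sq (hyint.const_mul _) hid).trans ?_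
  rw [integral_const_mul]
  have hy2 : ∫ ω, (total fun i j => addArr (W *ᵥ degreeVec (noise x P ω)) i j ^ 2) ∂P ≤
      (m : ℝ) * ((q + 1 : ℕ) : ℝ) * (4 * v) := by
    simp only [total_apply]
    rw [integral_finsetSum _ fun i _ => integrable_finsetSum _ fun j _ =>
      (hyL i j).1.integrable_sq]
    have h3 : ∀ i, ∫ ω, ∑ j, addArr (W *ᵥ degreeVec (noise x P ω)) i j ^ 2 ∂P ≤
        ((q + 1 : ℕ) : ℝ) * (4 * v) := fun i => by
      rw [integral_finsetSum _ fun j _ => (hyL i j).1.integrable_sq]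
      refine (Finset.sum_le_sum fun j _ => (hyL i j).2).trans (le_of_eq ?_)
      simp
    refine (Finset.sum_le_sum fun i _ => h3 i).trans (le_of_eq ?_)
    simp; ring
  refine (mul_le_mul_of_nonneg_left hy2 (by positivity)).trans (le_of_eq ?_)
  ring

/-- With high probability the scores `∑ (z_{ij} - proj z_{ij})_a (x_{ij} - E x_{ij})` are of the
order `(b₁² / b₀) m n σ / m`. -/
theorem measure_score_gt [IsProbabilityMeasure P] (hm : 0 < m)
    {x : Fin m → Fin (q + 1) → Ω → ℝ} (hint : ∀ i j, Integrable (x i j) P)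
    (hL : ∀ i j, MemLp (fun ω => noise x P ω i j) 2 P)
    (hindep : iIndepFun (fun (ij : Fin m × Fin (q + 1)) => x ij.1 ij.2) P)
    {w : Fin m → Fin (q + 1) → ℝ} {b₀ b₁ s : ℝ} (hb₀ : 0 < b₀) (hs : s * s = 1)
    (hw : ∀ i j, b₀ ≤ (s • w) i j ∧ (s • w) i j ≤ b₁)
    {z : Fin m → Fin (q + 1) → Fin p → ℝ} {Cz : ℝ} (hz : ∀ i j, ‖z i j‖ ≤ Cz) {K : ℝ} (hK : 0 < K)
    (a : Fin p) :
    P {ω | (m : ℝ) * ((q + 1 : ℕ) : ℝ) *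
        (22 * K * (b₁ / b₀) * Cz * b₁ * (sigma (lapMat w) x P / m)) <
          |total (resid (s • w) (covArr z a) * noise x P ω)|} ≤ ENNReal.ofReal (1 / K ^ 2) := by
  have hm0 : (0 : ℝ) < m := by exact_mod_cast hm
  have hwp : ∀ i j, 0 < (s • w) i j := fun i j => hb₀.trans_le (hw i j).1
  have hCz : 0 ≤ Cz := (norm_nonneg _).trans (hz ⟨0, hm⟩ 0)
  have hb₁ : 0 ≤ b₁ := (hwp ⟨0, hm⟩ 0).le.trans (hw ⟨0, hm⟩ 0).2
  set c := resid (s • w) (covArr z a) with hc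
  have hcb : ∀ i j, |c i j| ≤ 11 * (b₁ / b₀) * Cz :=
    abs_resid_le hm hb₀ (fun i j => (hw i j).1) (fun i j => (hw i j).2) (abs_covArr_le hz a)
  have hσ0 : 0 ≤ sigma (lapMat w) x P := Real.sqrt_nonneg _
  set t := (m : ℝ) * ((q + 1 : ℕ) : ℝ) * (22 * (b₁ / b₀) * Cz * b₁ * (sigma (lapMat w) x P / m))
    with ht
  have ht0 : 0 ≤ t := by positivity
  have hvar : ∫ ω, total (c * noise x P ω) ^ 2 ∂P ≤ t ^ 2 := by
    rw [integral_sq_total_mul_noise hint hL hindep]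
    have h1 : (total fun i j => c i j ^ 2 * ∫ ω, noise x P ω i j ^ 2 ∂P) ≤
        (11 * (b₁ / b₀) * Cz) ^ 2 * total fun i j => ∫ ω, noise x P ω i j ^ 2 ∂P := by
      rw [← smul_eq_mul, ← map_smul]
      refine total_le_total fun i j => ?_
      simp only [Pi.smul_apply, smul_eq_mul]
      refine mul_le_mul_of_nonneg_right ?_ (integral_nonneg fun ω => sq_nonneg _)
      rw [← sq_abs]
      exact pow_le_pow_left₀ (abs_nonneg _) (hcb i j) 2
    refine h1.trans ((mul_le_mul_of_nonneg_left (total_variance_le hm hint hL hindep hs hwp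
      fun i j => (hw i j).2) (sq_nonneg _)).trans ?_)
    have h2 : sigma (lapMat w) x P ^ 2 / ((m : ℝ) + q) ^ 2 ≤
        sigma (lapMat w) x P ^ 2 / (m : ℝ) ^ 2 := by
      refine div_le_div_of_nonneg_left (sq_nonneg _) (by positivity) ?_
      exact pow_le_pow_left₀ hm0.le (by linarith [Nat.cast_nonneg (α := ℝ) q]) 2
    have h3 := mul_le_mul_of_nonneg_left h2 (show 0 ≤ (11 * (b₁ / b₀) * Cz) ^ 2 *
      (4 * b₁ ^ 2 * ((m : ℝ) * ((q + 1 : ℕ) : ℝ)) ^ 2) by positivity)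
    rw [← mul_assoc]
    refine h3.trans (le_of_eq ?_)
    rw [ht]; ring
  have h := measure_abs_gt_le (memLp_total_mul_noise hL c) hvar hK
  rw [Real.sqrt_sq ht0] at h
  refine le_trans (le_of_eq ?_) h
  congr 1
  ext ω
  simp only [Set.mem_ofPred_eq]
  rw [show K * t = (m : ℝ) * ((q + 1 : ℕ) : ℝ) *
    (22 * K * (b₁ / b₀) * Cz * b₁ * (sigma (lapMat w) x P / m)) by rw [ht]; ring]

/-- With high probability a given coordinate of `(V⁻¹ - S)(g - E g)` is of the order `σ / m`. -/
theorem measure_error_gt [IsProbabilityMeasure P] (hm : 0 < m)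
    {x : Fin m → Fin (q + 1) → Ω → ℝ} (hint : ∀ i j, Integrable (x i j) P)
    (hL : ∀ i j, MemLp (fun ω => noise x P ω i j) 2 P)
    {V : Matrix (Fin m ⊕ Fin q) (Fin m ⊕ Fin q) ℝ} (hV : V.IsSymm) {K : ℝ} (hK : 0 < K)
    (l : Fin m ⊕ Fin q) :
    P {ω | K * (sigma V x P / m) < |((V⁻¹ - matS V) *ᵥ degreeVec (noise x P ω)) l|} ≤
      ENNReal.ofReal (1 / K ^ 2) := by
  have hm0 : (0 : ℝ) < m := by exact_mod_cast hm
  have hσ0 : 0 ≤ sigma V x P := Real.sqrt_nonneg _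
  have h1 := sq_mul_integral_sq_le_sigma_sq hint hL hV l
  have h2 : ∫ ω, ((V⁻¹ - matS V) *ᵥ degreeVec (noise x P ω)) l ^ 2 ∂P ≤
      (sigma V x P / m) ^ 2 := by
    rw [div_pow, le_div_iff₀ (by positivity), mul_comm]
    refine le_trans (mul_le_mul_of_nonneg_right ?_ (integral_nonneg fun ω => sq_nonneg _)) h1
    exact pow_le_pow_left₀ hm0.le (by linarith [Nat.cast_nonneg (α := ℝ) q]) 2
  have h := measure_abs_gt_le (mulVec_degreeVec_memLp hL (V⁻¹ - matS V) l) h2 hK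
  rwa [Real.sqrt_sq (by positivity)] at h

end Noise

/-! ### Existence and uniqueness of the moment estimator -/

/-- Testing an array against the additive arrays and the covariates. -/
def momentLin (z : Fin m → Fin (q + 1) → Fin p → ℝ) :
    (Fin m → Fin (q + 1) → ℝ) →ₗ[ℝ] (Fin m ⊕ Fin q → ℝ) × (Fin p → ℝ) :=
  degreeLin.prod (LinearMap.pi fun a => total ∘ₗ LinearMap.mulRight ℝ (covArr z a))

theorem momentLin_eq_zero_iff {z : Fin m → Fin (q + 1) → Fin p → ℝ}
    {X : Fin m → Fin (q + 1) → ℝ} :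
    momentLin z X = 0 ↔ degreeVec X = 0 ∧ ∀ a, total (X * covArr z a) = 0 := by
  rw [Prod.ext_iff]
  exact and_congr Iff.rfl funext_iff

theorem isMomentSolution_iff {μ : ℝ → ℝ} {z : Fin m → Fin (q + 1) → Fin p → ℝ}
    {X : Fin m → Fin (q + 1) → ℝ} {θ : Fin m ⊕ Fin q → ℝ} {γ : Fin p → ℝ} :
    IsMomentSolution μ z X θ γ ↔ momentLin z (meanMatrix μ z θ γ - X) = 0 := by
  rw [momentLin_eq_zero_iff, IsMomentSolution, momentF, ← degreeLin_apply, ← degreeLin_apply,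
    ← degreeLin_apply, map_sub]
  refine and_congr Iff.rfl ?_
  rw [funext_iff]
  exact forall_congr' fun a => by rw [momentQ_apply]; rfl

section Box

variable {μ : ℝ → ℝ} {z : Fin m → Fin (q + 1) → Fin p → ℝ} {θs : Fin m ⊕ Fin q → ℝ}
  {γs : Fin p → ℝ} {ε₁ ε₂ b₀ b₁ b₂ b₃ s κ : ℝ} {w : Fin m → Fin (q + 1) → ℝ}

/-- By the mean value theorem the difference of two solutions lies in the kernel of a full weighted
Gram matrix, which is positive definite. -/
theorem moment_unique (hm : 0 < m) (hb₀ : 0 < b₀) (hκ0 : 0 ≤ κ)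
    (h : DerivBounds μ z θs γs ε₁ ε₂ b₀ b₁ b₂ b₃) (hs : s * s = 1)
    (hsign : ∀ i j, ∀ t ∈ predRange z θs γs ε₁ ε₂ i j, b₀ ≤ s * deriv μ t ∧ s * deriv μ t ≤ b₁)
    (hw : ∀ i j, 0 < w i j)
    (hκ : ∀ (e : Fin p → ℝ) (a : Fin p), (m : ℝ) * ((q + 1 : ℕ) : ℝ) * e a ^ 2 ≤
      κ * total (w * resid w (covLin z e) * resid w (covLin z e)))
    {η η' : (Fin m ⊕ Fin q → ℝ) × (Fin p → ℝ)}
    (hη : η ∈ Metric.closedBall θs ε₁ ×ˢ Metric.closedBall γs ε₂)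
    (hη' : η' ∈ Metric.closedBall θs ε₁ ×ˢ Metric.closedBall γs ε₂)
    (heq : momentLin z (meanMatrix μ z η.1 η.2) = momentLin z (meanMatrix μ z η'.1 η'.2)) :
    η = η' := by
  obtain ⟨wb, hwb, hmean, -⟩ := h.exists_weights hs hsign hη hη'
  have h0 : momentLin z (wb * predLin z (η - η')) = 0 := by
    rw [← hmean, map_smul, map_sub, heq, sub_self, smul_zero]
  obtain ⟨h1, h2⟩ := momentLin_eq_zero_iff.1 h0
  have h3 := predLin_eq_zero (fun i j => hb₀.trans_le (hwb i j).1) h1 h2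
  exact sub_eq_zero.1 (predLin_injective hm hκ0 hw hκ h3)

theorem predRange_mem_nhds {η : (Fin m ⊕ Fin q → ℝ) × (Fin p → ℝ)}
    (hη : η ∈ Metric.ball θs ε₁ ×ˢ Metric.ball γs ε₂) (i : Fin m) (j : Fin (q + 1)) :
    predRange z θs γs ε₁ ε₂ i j ∈ 𝓝 (predLin z η i j) := by
  -- move `α_i` only
  let f : ℝ → (Fin m ⊕ Fin q → ℝ) × (Fin p → ℝ) := fun t =>
    η + (t - predLin z η i j) • (Pi.single (Sum.inl i) 1, 0)
  have hf : Continuous f := by fun_prop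
  have hf0 : f (predLin z η i j) = η := by simp [f]
  have hnb : Metric.ball θs ε₁ ×ˢ Metric.ball γs ε₂ ∈ 𝓝 (f (predLin z η i j)) := by
    rw [hf0]
    exact (Metric.isOpen_ball.prod Metric.isOpen_ball).mem_nhds hη
  filter_upwards [hf.continuousAt hnb] with t ht
  refine ⟨f t, Set.prod_mono Metric.ball_subset_closedBall Metric.ball_subset_closedBall ht, ?_⟩
  have h1 : predLin z ((Pi.single (Sum.inl i) 1, 0) : (Fin m ⊕ Fin q → ℝ) × (Fin p → ℝ)) i j =
      1 := by
    rw [predLin_apply, linPred_eq]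
    refine Fin.lastCases ?_ (fun j => ?_) j
    · rw [addArr_last]; simp
    · rw [addArr_castSucc]; simp
  simp only [f, map_add, map_smul, Pi.add_apply, Pi.smul_apply, h1, smul_eq_mul]
  ring

theorem DerivBounds.hasStrictDerivAt (h : DerivBounds μ z θs γs ε₁ ε₂ b₀ b₁ b₂ b₃)
    {η : (Fin m ⊕ Fin q → ℝ) × (Fin p → ℝ)}
    (hη : η ∈ Metric.ball θs ε₁ ×ˢ Metric.ball γs ε₂) (i : Fin m) (j : Fin (q + 1)) :
    HasStrictDerivAt μ (deriv μ (predLin z η i j)) (predLin z η i j) := by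
  refine hasStrictDerivAt_of_hasDerivAt_of_continuousAt (f' := deriv μ) ?_ ?_
  · filter_upwards [predRange_mem_nhds hη i j]
    rintro _ ⟨η', ⟨h1, h2⟩, rfl⟩
    exact ((h η'.1 h1 η'.2 h2).1 i j 0 (by norm_num)).hasDerivAt
  · have := (h η.1 (Metric.ball_subset_closedBall hη.1) η.2
      (Metric.ball_subset_closedBall hη.2)).1 i j 1 (by norm_num)
    rw [iteratedDeriv_one] at this
    exact this.continuousAt

/-- At interior points of the box the moment map is open, by the inverse function theorem. -/
theorem map_nhds_momentMap (hm : 0 < m) (hb₀ : 0 < b₀) (hκ0 : 0 ≤ κ)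
    (h : DerivBounds μ z θs γs ε₁ ε₂ b₀ b₁ b₂ b₃)
    (hsign : ∀ i j, ∀ t ∈ predRange z θs γs ε₁ ε₂ i j, b₀ ≤ s * deriv μ t ∧ s * deriv μ t ≤ b₁)
    (hw : ∀ i j, 0 < w i j)
    (hκ : ∀ (e : Fin p → ℝ) (a : Fin p), (m : ℝ) * ((q + 1 : ℕ) : ℝ) * e a ^ 2 ≤
      κ * total (w * resid w (covLin z e) * resid w (covLin z e)))
    {η : (Fin m ⊕ Fin q → ℝ) × (Fin p → ℝ)}
    (hη : η ∈ Metric.ball θs ε₁ ×ˢ Metric.ball γs ε₂) :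
    Filter.map (fun η : (Fin m ⊕ Fin q → ℝ) × (Fin p → ℝ) =>
      momentLin z (meanMatrix μ z η.1 η.2)) (𝓝 η) =
      𝓝 (momentLin z (meanMatrix μ z η.1 η.2)) := by
  set w' : Fin m → Fin (q + 1) → ℝ := derivArr μ z η.1 η.2 with hw'
  set A := LinearMap.mulLeft ℝ w' ∘ₗ predLin z with hA
  have hM : HasStrictFDerivAt (fun η : (Fin m ⊕ Fin q → ℝ) × (Fin p → ℝ) =>
      meanMatrix μ z η.1 η.2) A.toContinuousLinearMap η := by
    refine hasStrictFDerivAt_pi'.2 fun i => hasStrictFDerivAt_pi'.2 fun j => ?_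
    let ℓ : (Fin m ⊕ Fin q → ℝ) × (Fin p → ℝ) →ₗ[ℝ] ℝ :=
      (LinearMap.proj j : (Fin (q + 1) → ℝ) →ₗ[ℝ] ℝ) ∘ₗ
        (LinearMap.proj i : (Fin m → Fin (q + 1) → ℝ) →ₗ[ℝ] _) ∘ₗ predLin z
    have h1 := (h.hasStrictDerivAt hη i j).comp_hasStrictFDerivAt η
      (f := fun η => predLin z η i j) (f' := ℓ.toContinuousLinearMap)
      ℓ.toContinuousLinearMap.hasStrictFDerivAt
    exact h1
  have hΦ : HasStrictFDerivAt (fun η : (Fin m ⊕ Fin q → ℝ) × (Fin p → ℝ) =>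
      momentLin z (meanMatrix μ z η.1 η.2)) (momentLin z ∘ₗ A).toContinuousLinearMap η :=
    (momentLin z).toContinuousLinearMap.hasStrictFDerivAt.comp η hM
  refine hΦ.map_nhds_eq_of_surj ?_
  have hηb := Set.prod_mono Metric.ball_subset_closedBall Metric.ball_subset_closedBall hη
  have hsw' : ∀ i j, 0 < (s • w') i j := fun i j =>
    hb₀.trans_le (hsign i j _ ⟨η, hηb, rfl⟩).1
  have hinj : Function.Injective (momentLin z ∘ₗ A) := by
    rw [← LinearMap.ker_eq_bot, LinearMap.ker_eq_bot']
    intro v hv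
    have h0 : momentLin z ((s • w') * predLin z v) = 0 := by
      rw [smul_mul_assoc, map_smul]
      have : momentLin z (w' * predLin z v) = 0 := hv
      rw [this, smul_zero]
    obtain ⟨h1, h2⟩ := momentLin_eq_zero_iff.1 h0
    exact predLin_injective hm hκ0 hw hκ (predLin_eq_zero hsw' h1 h2)
  exact LinearMap.range_eq_top.2 (LinearMap.injective_iff_surjective.1 hinj)

/-- Existence by continuation: if for all `t ∈ [0, 1]` the solutions for the noise `t • n` stay in
the open box, then the set of `t` for which there is one is open and closed in `[0, 1]`. -/
theorem exists_moment_solution (hm : 0 < m) (hb₀ : 0 < b₀) (hκ0 : 0 ≤ κ)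
    (hε₁ : 0 ≤ ε₁) (hε₂ : 0 ≤ ε₂)
    (h : DerivBounds μ z θs γs ε₁ ε₂ b₀ b₁ b₂ b₃)
    (hsign : ∀ i j, ∀ t ∈ predRange z θs γs ε₁ ε₂ i j, b₀ ≤ s * deriv μ t ∧ s * deriv μ t ≤ b₁)
    (hw : ∀ i j, 0 < w i j)
    (hκ : ∀ (e : Fin p → ℝ) (a : Fin p), (m : ℝ) * ((q + 1 : ℕ) : ℝ) * e a ^ 2 ≤
      κ * total (w * resid w (covLin z e) * resid w (covLin z e)))
    (n : Fin m → Fin (q + 1) → ℝ)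
    (hloc : ∀ t ∈ Set.Icc (0 : ℝ) 1, ∀ η ∈ Metric.closedBall θs ε₁ ×ˢ Metric.closedBall γs ε₂,
      momentLin z (meanMatrix μ z η.1 η.2 - meanMatrix μ z θs γs - t • n) = 0 →
        η ∈ Metric.ball θs ε₁ ×ˢ Metric.ball γs ε₂) :
    ∃ η ∈ Metric.closedBall θs ε₁ ×ˢ Metric.closedBall γs ε₂,
      momentLin z (meanMatrix μ z η.1 η.2 - meanMatrix μ z θs γs - n) = 0 := by
  set K := Metric.closedBall θs ε₁ ×ˢ Metric.closedBall γs ε₂ with hK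
  set Φ : (Fin m ⊕ Fin q → ℝ) × (Fin p → ℝ) → (Fin m ⊕ Fin q → ℝ) × (Fin p → ℝ) :=
    fun η => momentLin z (meanMatrix μ z η.1 η.2) with hΦ
  set c : ℝ → (Fin m ⊕ Fin q → ℝ) × (Fin p → ℝ) := fun t =>
    Φ (θs, γs) + t • momentLin z n with hc
  have hcc : Continuous c := by fun_prop
  have hiff : ∀ t η, momentLin z (meanMatrix μ z η.1 η.2 - meanMatrix μ z θs γs - t • n) = 0 ↔
      Φ η = c t := fun t η => by
    rw [map_sub, map_sub, map_smul, sub_sub, sub_eq_zero]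
  have hKc : IsCompact K := (isCompact_closedBall _ _).prod (isCompact_closedBall _ _)
  have hΦc : ContinuousOn Φ K := by
    refine (momentLin z).toContinuousLinearMap.continuous.comp_continuousOn ?_
    refine continuousOn_pi.2 fun i => continuousOn_pi.2 fun j => fun η hη => ?_
    let ℓ : (Fin m ⊕ Fin q → ℝ) × (Fin p → ℝ) →ₗ[ℝ] ℝ :=
      (LinearMap.proj j : (Fin (q + 1) → ℝ) →ₗ[ℝ] ℝ) ∘ₗ
        (LinearMap.proj i : (Fin m → Fin (q + 1) → ℝ) →ₗ[ℝ] _) ∘ₗ predLin z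
    have h1 : ContinuousAt μ (ℓ η) :=
      ((h η.1 hη.1 η.2 hη.2).1 i j 0 (by norm_num)).continuousAt
    exact (ContinuousAt.comp (f := ℓ) h1
      ℓ.toContinuousLinearMap.continuous.continuousAt).continuousWithinAt
  have hclosed : IsClosed (c ⁻¹' (Φ '' K)) := (hKc.image_of_continuousOn hΦc).isClosed.preimage hcc
  have hsub : Set.Icc (0 : ℝ) 1 ⊆ c ⁻¹' (Φ '' K) := by
    refine (hclosed.inter isClosed_Icc).Icc_subset_of_forall_mem_nhdsWithin ?_ ?_
    · refine ⟨(θs, γs), ⟨Metric.mem_closedBall_self hε₁, Metric.mem_closedBall_self hε₂⟩, ?_⟩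
      simp [hc]
    · rintro t ⟨⟨η, hη, hηt⟩, ht⟩
      have hint := hloc t ⟨ht.1, ht.2.le⟩ η hη ((hiff t η).2 hηt)
      have hopen := map_nhds_momentMap hm hb₀ hκ0 h hsign hw hκ hint
      have hKn : K ∈ 𝓝 η :=
        Filter.mem_of_superset ((Metric.isOpen_ball.prod Metric.isOpen_ball).mem_nhds hint)
          (Set.prod_mono Metric.ball_subset_closedBall Metric.ball_subset_closedBall)
      have himg : Φ '' K ∈ 𝓝 (c t) := by
        rw [← hηt, hΦ, ← hopen]
        exact Filter.image_mem_map hKn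
      exact nhdsWithin_le_nhds (hcc.continuousAt himg)
  obtain ⟨η, hη, hη1⟩ := hsub (Set.right_mem_Icc.2 zero_le_one)
  refine ⟨η, hη, ?_⟩
  have := (hiff 1 η).2 hη1
  rwa [one_smul] at this

end Box

section Box

variable {μ : ℝ → ℝ} {z : Fin m → Fin (q + 1) → Fin p → ℝ} {θs : Fin m ⊕ Fin q → ℝ}
  {γs : Fin p → ℝ} {ε₁ ε₂ b₀ b₁ b₂ b₃ s κ Cz τ ν : ℝ}

/-- The deterministic bounds for a solution of the moment equations with noise `t • n`, in terms of
bounds for the row sums, the column sums and the scores of `n`. -/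
theorem solution_bounds (hm : 0 < m) (hb₀ : 0 < b₀) (hb₂ : 0 ≤ b₂) (hκ0 : 0 ≤ κ)
    (hε₁ : 0 ≤ ε₁) (hε₂ : 0 ≤ ε₂) (h : DerivBounds μ z θs γs ε₁ ε₂ b₀ b₁ b₂ b₃) (hs : s * s = 1)
    (hsign : ∀ i j, ∀ t ∈ predRange z θs γs ε₁ ε₂ i j, b₀ ≤ s * deriv μ t ∧ s * deriv μ t ≤ b₁)
    (hz : ∀ i j, ‖z i j‖ ≤ Cz)
    (hκ : ∀ (e : Fin p → ℝ) (a : Fin p), (m : ℝ) * ((q + 1 : ℕ) : ℝ) * e a ^ 2 ≤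
      κ * total ((s • derivArr μ z θs γs) * resid (s • derivArr μ z θs γs) (covLin z e) *
        resid (s • derivArr μ z θs γs) (covLin z e)))
    {n : Fin m → Fin (q + 1) → ℝ} (hτ : 0 ≤ τ)
    (hnr : ∀ i, |∑ j, n i j| ≤ ((q + 1 : ℕ) : ℝ) * τ) (hnc : ∀ j, |∑ i, n i j| ≤ (m : ℝ) * τ)
    (hν0 : 0 ≤ ν) (hν : ∀ a, |total (resid (s • derivArr μ z θs γs) (covArr z a) * n)| ≤
      (m : ℝ) * ((q + 1 : ℕ) : ℝ) * ν)
    (hsmall : 1210 * p ^ 2 * Cz ^ 2 * κ * (b₁ / b₀) ^ 4 * b₂ * τ / b₀ ≤ 1 / 2)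
    {t : ℝ} (ht : t ∈ Set.Icc (0 : ℝ) 1) {η : (Fin m ⊕ Fin q → ℝ) × (Fin p → ℝ)}
    (hη : η ∈ Metric.closedBall θs ε₁ ×ˢ Metric.closedBall γs ε₂)
    (hsol : momentLin z (meanMatrix μ z η.1 η.2 - meanMatrix μ z θs γs - t • n) = 0) {E : ℝ}
    (hE : E = 2 * p * κ * (b₁ / b₀) * ν +
      2420 * p * Cz * κ * (b₁ / b₀) ^ 4 * b₂ * τ ^ 2 / b₀ ^ 2) :
    ‖η.2 - γs‖ ≤ E ∧ (∀ l, |η.1 l - θs l| ≤ 5 * (b₁ / b₀) * (p * Cz * E + τ / b₀)) ∧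
      ∀ l, |η.1 l - θs l - ((lapMat (derivArr μ z θs γs))⁻¹ *ᵥ degreeVec (t • n)) l| ≤
        5 * (b₁ / b₀) * (p * Cz * E +
          b₂ * (11 * (b₁ / b₀) * (p * Cz * E + τ / b₀)) ^ 2 / b₀) := by
  have hηs : ((θs, γs) : (Fin m ⊕ Fin q → ℝ) × (Fin p → ℝ)) ∈
      Metric.closedBall θs ε₁ ×ˢ Metric.closedBall γs ε₂ :=
    ⟨Metric.mem_closedBall_self hε₁, Metric.mem_closedBall_self hε₂⟩
  have hCz : 0 ≤ Cz := (norm_nonneg _).trans (hz ⟨0, hm⟩ 0)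
  have habs : |s| = 1 := by
    rcases mul_self_eq_one_iff.1 hs with h | h <;> simp [h]
  obtain ⟨wb, hwb, hmean, hdiff⟩ := h.exists_weights hs hsign hη hηs
  set w := s • derivArr μ z θs γs with hw
  set v := η - (θs, γs) with hv
  set ε := s • (t • n) with hε
  have hwpos : ∀ i j, b₀ ≤ w i j ∧ w i j ≤ b₁ := fun i j => hsign i j _ ⟨_, hηs, rfl⟩
  have hB : 0 ≤ b₁ / b₀ :=
    div_nonneg (hb₀.le.trans ((hwpos ⟨0, hm⟩ 0).1.trans (hwpos ⟨0, hm⟩ 0).2)) hb₀.le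
  have hsol' : momentLin z (wb * predLin z v - ε) = 0 := by
    rw [← hmean, hε, ← smul_sub, map_smul, hsol, smul_zero]
  obtain ⟨hdeg, hcov⟩ := momentLin_eq_zero_iff.1 hsol'
  have hst : |s * t| ≤ 1 := by
    rw [abs_mul, habs, one_mul, abs_of_nonneg ht.1]; exact ht.2
  have hscale : ∀ r, |s * t * r| ≤ |r| := fun r => by
    rw [abs_mul]; exact mul_le_of_le_one_left (abs_nonneg _) hst
  have hεe : ε = (s * t) • n := by rw [hε, smul_smul]
  have hεr : ∀ i, |∑ j, ε i j| ≤ ((q + 1 : ℕ) : ℝ) * τ := fun i => by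
    rw [hεe]
    simp only [Pi.smul_apply, smul_eq_mul, ← Finset.mul_sum]
    exact (hscale _).trans (hnr i)
  have hεc : ∀ j, |∑ i, ε i j| ≤ (m : ℝ) * τ := fun j => by
    rw [hεe]
    simp only [Pi.smul_apply, smul_eq_mul, ← Finset.mul_sum]
    exact (hscale _).trans (hnc j)
  have hεν : ∀ a, |total (resid w (covArr z a) * ε)| ≤ (m : ℝ) * ((q + 1 : ℕ) : ℝ) * ν :=
    fun a => by
      rw [hεe, mul_smul_comm, map_smul, smul_eq_mul]
      exact (hscale _).trans (hν a)
  have h1 : ‖v.2‖ ≤ E := by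
    rw [hE]
    exact norm_snd_le hm hb₀ hb₂ hκ0 hwpos hwb hz hκ hdeg hcov hdiff hτ hεr hεc hν0 hεν hsmall
  have hEC : p * Cz * ‖v.2‖ ≤ p * Cz * E := mul_le_mul_of_nonneg_left h1 (by positivity)
  refine ⟨h1, fun l => ?_, fun l => ?_⟩
  · refine (abs_fst_le hm hb₀ hwb hz hdeg hτ hεr hεc l).trans ?_
    gcongr
  · have h2 : ∀ i j, |predLin z v i j| ≤ 11 * (b₁ / b₀) * (p * Cz * E + τ / b₀) := fun i j =>
      (abs_predLin_le hm hb₀ hwb hz hdeg hτ hεr hεc i j).trans (by gcongr)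
    have h3 := abs_fst_sub_le hm hb₀ hb₂ hwpos hz hdeg hdiff h2 l
    have h4 : (lapMat w)⁻¹ *ᵥ degreeVec ε =
        (lapMat (derivArr μ z θs γs))⁻¹ *ᵥ degreeVec (t • n) := by
      rw [hw, hε, lapMat_smul_inv hs, ← degreeLin_apply, map_smul, Matrix.smul_mulVec,
        Matrix.mulVec_smul, smul_smul, hs, one_smul]; rfl
    rw [h4] at h3
    refine h3.trans ?_
    gcongr

end Box

/-! ### Comparison with the rate `R` -/

section Rates

variable {m n L b₀ b₁ b₂ κ H σ Cz C₀ c K τ : ℝ}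

/-- The contribution of the scores to `γ - γ*` is of order `R`; the missing powers of `b₁` are
supplied by `b₁ ≥ c` and the missing logarithm by `log m ≥ 1`. -/
theorem score_rate_le (hm : 0 < m) (hL : 1 ≤ L) (hb₀ : 0 < b₀) (hb₂ : 0 ≤ b₂) (hκ : 0 ≤ κ)
    (hσ : 0 ≤ σ) (hc : 0 < c) (hcb : c ≤ b₁) :
    κ * (b₁ / b₀) ^ 3 * b₁ * (σ / m) ≤
      1 / c ^ 6 * (κ * b₁ ^ 10 * L / (b₀ ^ 3 * m) * (b₂ * H ^ 2 / b₀ ^ 9 + σ)) := by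
  have hb₁ : 0 < b₁ := hc.trans_le hcb
  have h1 : 1 ≤ (b₁ / c) ^ 6 := one_le_pow₀ ((one_le_div hc).2 hcb)
  have h2 : 1 ≤ (b₁ / c) ^ 6 * L := one_le_mul_of_one_le_of_one_le h1 hL
  calc κ * (b₁ / b₀) ^ 3 * b₁ * (σ / m)
      ≤ κ * (b₁ / b₀) ^ 3 * b₁ * (σ / m) * ((b₁ / c) ^ 6 * L) :=
        le_mul_of_one_le_right (by positivity) h2
    _ = 1 / c ^ 6 * (κ * b₁ ^ 10 * L / (b₀ ^ 3 * m) * σ) := by field_simp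
    _ ≤ _ := by gcongr; exact le_add_of_nonneg_left (by positivity)

/-- The size of `(V⁻¹ - S)(g - E g)` is of order `R`, since `κ` is at least of order `1 / b₁`. -/
theorem error_rate_le (hm : 0 < m) (hL : 1 ≤ L) (hb₀ : 0 < b₀) (hb₂ : 0 ≤ b₂) (hκ : 0 ≤ κ)
    (hσ : 0 ≤ σ) (hc : 0 < c) (hcb : c ≤ b₁) (hb : b₀ ≤ b₁) (hκb : 1 ≤ κ * b₁ * Cz ^ 2) :
    σ / m ≤
      Cz ^ 2 / c ^ 6 * (κ * b₁ ^ 10 * L / (b₀ ^ 3 * m) * (b₂ * H ^ 2 / b₀ ^ 9 + σ)) := by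
  have hb₁ : 0 < b₁ := hc.trans_le hcb
  have h1 : 1 ≤ (b₁ / b₀) ^ 3 := one_le_pow₀ ((one_le_div hb₀).2 hb)
  calc σ / m ≤ σ / m * (κ * b₁ * Cz ^ 2 * (b₁ / b₀) ^ 3) :=
        le_mul_of_one_le_right (by positivity) (one_le_mul_of_one_le_of_one_le hκb h1)
    _ = Cz ^ 2 * (κ * (b₁ / b₀) ^ 3 * b₁ * (σ / m)) := by ring
    _ ≤ Cz ^ 2 * _ := mul_le_mul_of_nonneg_left
        (score_rate_le (H := H) hm hL hb₀ hb₂ hκ hσ hc hcb) (sq_nonneg _)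
    _ = _ := by ring

/-- The contribution to `γ - γ*` of the perturbation of the weights is of order `R`. -/
theorem noise_sq_rate_le (hm : 0 < m) (hL : 1 ≤ L) (hb₀ : 0 < b₀) (hb₂ : 0 ≤ b₂) (hκ : 0 ≤ κ)
    (hσ : 0 ≤ σ) (hb : b₀ ≤ b₁) (hτ : τ ^ 2 ≤ 4 * C₀ ^ 2 * H ^ 2 * (L / m)) :
    κ * (b₁ / b₀) ^ 5 * b₂ * τ ^ 2 / b₀ ^ 2 ≤
      4 * C₀ ^ 2 * (κ * b₁ ^ 10 * L / (b₀ ^ 3 * m) * (b₂ * H ^ 2 / b₀ ^ 9 + σ)) := by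
  have hb₁ : 0 < b₁ := hb₀.trans_le hb
  have h1 : 1 ≤ (b₁ / b₀) ^ 5 := one_le_pow₀ ((one_le_div hb₀).2 hb)
  calc κ * (b₁ / b₀) ^ 5 * b₂ * τ ^ 2 / b₀ ^ 2
      ≤ κ * (b₁ / b₀) ^ 5 * b₂ * (4 * C₀ ^ 2 * H ^ 2 * (L / m)) / b₀ ^ 2 := by gcongr
    _ ≤ κ * (b₁ / b₀) ^ 5 * b₂ * (4 * C₀ ^ 2 * H ^ 2 * (L / m)) / b₀ ^ 2 * (b₁ / b₀) ^ 5 :=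
        le_mul_of_one_le_right (by positivity) h1
    _ = 4 * C₀ ^ 2 * (κ * b₁ ^ 10 * L / (b₀ ^ 3 * m) * (b₂ * H ^ 2 / b₀ ^ 9)) := by
        field_simp
    _ ≤ _ := by gcongr; exact le_add_of_nonneg_right hσ

/-- The quadratic remainder of the degree equations is of order `R`. -/
theorem quadratic_rate_le (hm : 0 < m) (hL : 1 ≤ L) (hb₀ : 0 < b₀) (hb₂ : 0 ≤ b₂) (hκ : 0 ≤ κ)
    (hσ : 0 ≤ σ) (hb : b₀ ≤ b₁) (hκb : 1 ≤ κ * b₁ * Cz ^ 2)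
    (hτ : τ ^ 2 ≤ 4 * C₀ ^ 2 * H ^ 2 * (L / m)) :
    b₂ * (b₁ / b₀) ^ 3 * τ ^ 2 / b₀ ^ 3 ≤ 4 * C₀ ^ 2 * Cz ^ 2 *
      (κ * b₁ ^ 10 * L / (b₀ ^ 3 * m) * (b₂ * H ^ 2 / b₀ ^ 9 + σ)) := by
  have hb₁ : 0 < b₁ := hb₀.trans_le hb
  have h1 : 1 ≤ b₁ / b₀ := (one_le_div hb₀).2 hb
  calc b₂ * (b₁ / b₀) ^ 3 * τ ^ 2 / b₀ ^ 3
      ≤ b₂ * (b₁ / b₀) ^ 3 * τ ^ 2 / b₀ ^ 3 * (κ * b₁ * Cz ^ 2 * (b₁ / b₀)) :=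
        le_mul_of_one_le_right (by positivity) (one_le_mul_of_one_le_of_one_le hκb h1)
    _ = Cz ^ 2 * (κ * (b₁ / b₀) ^ 5 * b₂ * τ ^ 2 / b₀ ^ 2) := by field_simp
    _ ≤ Cz ^ 2 * _ := mul_le_mul_of_nonneg_left
        (noise_sq_rate_le hm hL hb₀ hb₂ hκ hσ hb hτ) (sq_nonneg _)
    _ = _ := by ring

/-- The first growth condition makes the a priori bound applicable. -/
theorem smallness_sq_le (hm : 0 < m) (hL : 1 ≤ L) (hb₀ : 0 < b₀) (hb₂ : 0 ≤ b₂)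
    (hσ : 0 ≤ σ) (hb : b₀ ≤ b₁) (hτ : τ ^ 2 ≤ 4 * C₀ ^ 2 * H ^ 2 * (L / m)) :
    (κ * (b₁ / b₀) ^ 4 * b₂ * τ / b₀) ^ 2 ≤ 4 * C₀ ^ 2 *
      (κ ^ 2 * b₁ ^ 16 * b₂ / b₀ ^ 9 * (b₂ * H ^ 2 / b₀ ^ 9 + σ) * (L / m)) := by
  have hb₁ : 0 < b₁ := hb₀.trans_le hb
  have h1 : 1 ≤ (b₁ / b₀) ^ 8 := one_le_pow₀ ((one_le_div hb₀).2 hb)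
  calc (κ * (b₁ / b₀) ^ 4 * b₂ * τ / b₀) ^ 2
      = (κ * (b₁ / b₀) ^ 4 * b₂ / b₀) ^ 2 * τ ^ 2 := by ring
    _ ≤ (κ * (b₁ / b₀) ^ 4 * b₂ / b₀) ^ 2 * (4 * C₀ ^ 2 * H ^ 2 * (L / m)) := by gcongr
    _ ≤ (κ * (b₁ / b₀) ^ 4 * b₂ / b₀) ^ 2 * (4 * C₀ ^ 2 * H ^ 2 * (L / m)) * (b₁ / b₀) ^ 8 :=
        le_mul_of_one_le_right (by positivity) h1
    _ = 4 * C₀ ^ 2 * (κ ^ 2 * b₁ ^ 16 * b₂ / b₀ ^ 9 * (b₂ * H ^ 2 / b₀ ^ 9) * (L / m)) := by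
        field_simp
    _ ≤ _ := by gcongr; exact le_add_of_nonneg_right hσ

/-- The first growth condition also makes the remainder `R` small compared to `b₀² / (b₁ b₂)`. -/
theorem rate_mul_le (hm : 0 < m) (hL : 1 ≤ L) (hb₀ : 0 < b₀) (hb₂ : 0 ≤ b₂) (hκ : 0 ≤ κ)
    (hσ : 0 ≤ σ) (hb : b₀ ≤ b₁) (hκb : 1 ≤ κ * b₁ * Cz ^ 2)
    (hG : κ ^ 2 * b₁ ^ 16 * b₂ / b₀ ^ 9 * (b₂ * H ^ 2 / b₀ ^ 9 + σ) * (L / m) ≤ 1) :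
    b₁ * b₂ / b₀ ^ 2 * (κ * b₁ ^ 10 * L / (b₀ ^ 3 * m) * (b₂ * H ^ 2 / b₀ ^ 9 + σ)) ≤ Cz ^ 2 := by
  have hb₁ : 0 < b₁ := hb₀.trans_le hb
  have h1 : 1 ≤ (b₁ / b₀) ^ 4 := one_le_pow₀ ((one_le_div hb₀).2 hb)
  calc b₁ * b₂ / b₀ ^ 2 * (κ * b₁ ^ 10 * L / (b₀ ^ 3 * m) * (b₂ * H ^ 2 / b₀ ^ 9 + σ))
      ≤ b₁ * b₂ / b₀ ^ 2 * (κ * b₁ ^ 10 * L / (b₀ ^ 3 * m) * (b₂ * H ^ 2 / b₀ ^ 9 + σ)) *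
          (κ * b₁ * Cz ^ 2 * (b₁ / b₀) ^ 4) :=
        le_mul_of_one_le_right (by positivity) (one_le_mul_of_one_le_of_one_le hκb h1)
    _ = Cz ^ 2 * (κ ^ 2 * b₁ ^ 16 * b₂ / b₀ ^ 9 * (b₂ * H ^ 2 / b₀ ^ 9 + σ) * (L / m)) := by
        field_simp
    _ ≤ Cz ^ 2 * 1 := mul_le_mul_of_nonneg_left hG (sq_nonneg _)
    _ = _ := mul_one _

theorem noise_rate_le (hb₀ : 0 < b₀) (hb : b₀ ≤ b₁) (hτ : τ ≤ 2 * C₀ * H * Real.sqrt (L / m))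
    (hC₀ : 0 ≤ C₀) (hH : 0 ≤ H) :
    b₁ / b₀ * (τ / b₀) ≤ 2 * C₀ * (b₁ ^ 2 * H / b₀ ^ 3 * Real.sqrt (L / m)) := by
  have hb₁ : 0 < b₁ := hb₀.trans_le hb
  have h1 : 1 ≤ b₁ / b₀ := (one_le_div hb₀).2 hb
  calc b₁ / b₀ * (τ / b₀) ≤ b₁ / b₀ * (2 * C₀ * H * Real.sqrt (L / m) / b₀) := by gcongr
    _ ≤ b₁ / b₀ * (2 * C₀ * H * Real.sqrt (L / m) / b₀) * (b₁ / b₀) :=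
        le_mul_of_one_le_right (by positivity) h1
    _ = _ := by field_simp

end Rates

section Rates

variable {m L b₀ b₁ b₂ κ H σ Cz C₀ c K τ E R r : ℝ}

theorem covariate_rate_le (hm : 0 < m) (hL : 1 ≤ L) (hb₀ : 0 < b₀) (hb₂ : 0 ≤ b₂) (hκ : 0 ≤ κ)
    (hσ : 0 ≤ σ) (hc : 0 < c) (hcb : c ≤ b₁) (hb : b₀ ≤ b₁) (hr : 0 ≤ r) (hK : 0 ≤ K)
    (hCz : 0 ≤ Cz) (hτ : τ ^ 2 ≤ 4 * C₀ ^ 2 * H ^ 2 * (L / m))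
    (hE : E = 2 * r * κ * (b₁ / b₀) * (22 * K * (b₁ / b₀) * Cz * b₁ * (σ / m)) +
      2420 * r * Cz * κ * (b₁ / b₀) ^ 4 * b₂ * τ ^ 2 / b₀ ^ 2)
    (hR : R = κ * b₁ ^ 10 * L / (b₀ ^ 3 * m) * (b₂ * H ^ 2 / b₀ ^ 9 + σ)) :
    b₁ / b₀ * E ≤ (44 * r * K * Cz / c ^ 6 + 9680 * r * Cz * C₀ ^ 2) * R := by
  have h1 := mul_le_mul_of_nonneg_left (score_rate_le (H := H) hm hL hb₀ hb₂ hκ hσ hc hcb)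
    (show 0 ≤ 44 * r * K * Cz by positivity)
  have h2 := mul_le_mul_of_nonneg_left (noise_sq_rate_le hm hL hb₀ hb₂ hκ hσ hb hτ)
    (show 0 ≤ 2420 * r * Cz by positivity)
  rw [← hR] at h1 h2
  calc b₁ / b₀ * E = 44 * r * K * Cz * (κ * (b₁ / b₀) ^ 3 * b₁ * (σ / m)) +
        2420 * r * Cz * (κ * (b₁ / b₀) ^ 5 * b₂ * τ ^ 2 / b₀ ^ 2) := by rw [hE]; ring
    _ ≤ _ := add_le_add h1 h2
    _ = _ := by ring

theorem remainder_rate_le {M : ℝ} (hm : 0 < m) (hL : 1 ≤ L) (hb₀ : 0 < b₀) (hb₂ : 0 ≤ b₂)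
    (hκ : 0 ≤ κ) (hσ : 0 ≤ σ) (hb : b₀ ≤ b₁) (hr : 0 ≤ r)
    (hCz : 0 ≤ Cz) (hκb : 1 ≤ κ * b₁ * Cz ^ 2) (hτ : τ ^ 2 ≤ 4 * C₀ ^ 2 * H ^ 2 * (L / m))
    (hR : R = κ * b₁ ^ 10 * L / (b₀ ^ 3 * m) * (b₂ * H ^ 2 / b₀ ^ 9 + σ))
    (hG : κ ^ 2 * b₁ ^ 16 * b₂ / b₀ ^ 9 * (b₂ * H ^ 2 / b₀ ^ 9 + σ) * (L / m) ≤ 1)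
    (hE0 : 0 ≤ E) (hE : b₁ / b₀ * E ≤ M * R) :
    5 * (b₁ / b₀) * (r * Cz * E + b₂ * (11 * (b₁ / b₀) * (r * Cz * E + τ / b₀)) ^ 2 / b₀) ≤
      (5 * r * Cz * M + 1210 * (r ^ 2 * Cz ^ 4 * M ^ 2 + 4 * C₀ ^ 2 * Cz ^ 2)) * R := by
  have hb₁ : 0 < b₁ := hb₀.trans_le hb
  have hR0 : 0 ≤ R := by rw [hR]; positivity
  have h1 := quadratic_rate_le hm hL hb₀ hb₂ hκ hσ hb hκb hτ
  have h2 := rate_mul_le hm hL hb₀ hb₂ hκ hσ hb hκb hG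
  rw [← hR] at h1 h2
  have h3 : b₂ * (b₁ / b₀) / b₀ * (b₁ / b₀ * E) ^ 2 ≤ M ^ 2 * Cz ^ 2 * R := by
    calc b₂ * (b₁ / b₀) / b₀ * (b₁ / b₀ * E) ^ 2 ≤ b₂ * (b₁ / b₀) / b₀ * (M * R) ^ 2 := by gcongr
      _ = M ^ 2 * R * (b₁ * b₂ / b₀ ^ 2 * R) := by field_simp
      _ ≤ M ^ 2 * R * Cz ^ 2 := by gcongr
      _ = _ := by ring
  have h4 : (r * Cz * E + τ / b₀) ^ 2 ≤ 2 * ((r * Cz * E) ^ 2 + (τ / b₀) ^ 2) := by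
    nlinarith [sq_nonneg (r * Cz * E - τ / b₀)]
  have h5 : 5 * r * Cz * (b₁ / b₀ * E) ≤ 5 * r * Cz * (M * R) := by gcongr
  have h6 : r ^ 2 * Cz ^ 2 * (b₂ * (b₁ / b₀) / b₀ * (b₁ / b₀ * E) ^ 2) ≤
      r ^ 2 * Cz ^ 2 * (M ^ 2 * Cz ^ 2 * R) := by gcongr
  calc 5 * (b₁ / b₀) * (r * Cz * E + b₂ * (11 * (b₁ / b₀) * (r * Cz * E + τ / b₀)) ^ 2 / b₀)
      = 5 * r * Cz * (b₁ / b₀ * E) +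
          605 * (b₁ / b₀) ^ 3 * b₂ / b₀ * (r * Cz * E + τ / b₀) ^ 2 := by ring
    _ ≤ 5 * r * Cz * (b₁ / b₀ * E) +
          605 * (b₁ / b₀) ^ 3 * b₂ / b₀ * (2 * ((r * Cz * E) ^ 2 + (τ / b₀) ^ 2)) := by gcongr
    _ = 5 * r * Cz * (b₁ / b₀ * E) +
          1210 * (r ^ 2 * Cz ^ 2 * (b₂ * (b₁ / b₀) / b₀ * (b₁ / b₀ * E) ^ 2) +
            b₂ * (b₁ / b₀) ^ 3 * τ ^ 2 / b₀ ^ 3) := by field_simp; ring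
    _ ≤ 5 * r * Cz * (M * R) +
          1210 * (r ^ 2 * Cz ^ 2 * (M ^ 2 * Cz ^ 2 * R) + 4 * C₀ ^ 2 * Cz ^ 2 * R) := by gcongr
    _ = _ := by ring

end Rates

/-! ### High-probability bounds for a single network -/

section Single

variable {Ω : Type*} [MeasurableSpace Ω] {P : Measure Ω}
  {μ : ℝ → ℝ} {z : Fin m → Fin (q + 1) → Fin p → ℝ} {θs : Fin m ⊕ Fin q → ℝ}
  {γs : Fin p → ℝ} {ε₁ ε₂ b₀ b₁ b₂ b₃ Cz : ℝ} {x : Fin m → Fin (q + 1) → Ω → ℝ}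

theorem noise_eq_sub_meanMatrix {ν : ℝ → Measure ℝ} (hμ : μ = meanFun ν)
    (hx : ∀ i j, Measurable (x i j))
    (hlaw : ∀ i j, P.map (x i j) = ν (linPred z θs γs i j)) (ω : Ω) :
    noise x P ω = (fun i j => x i j ω) - meanMatrix μ z θs γs := by
  ext i j
  have h1 : ∫ ω, x i j ω ∂P = μ (linPred z θs γs i j) := by
    rw [hμ, meanFun, ← hlaw]
    exact (integral_map (hx i j).aemeasurable measurable_id.aestronglyMeasurable).symm
  simp only [noise, h1, Pi.sub_apply, meanMatrix]

variable [IsProbabilityMeasure P]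

/-- After multiplication by a sign `s` the derivatives lie in `[b₀, b₁]`; moreover `κ` controls the
quadratic form of the projected covariates, and is at least of order `1 / b₁`. -/
theorem exists_sign_and_kappa (hm : 0 < m) (hp : 0 < p) (hε₁ : 0 < ε₁) (hε₂ : 0 < ε₂)
    (hb₀ : 0 < b₀) (hz : ∀ i j, ‖z i j‖ ≤ Cz)
    (hder : DerivBounds μ z θs γs ε₁ ε₂ b₀ b₁ b₂ b₃)
    (hH : ∀ θ ∈ Metric.closedBall θs ε₁, IsUnit (matH μ z θ γs).det) :
    ∃ s : ℝ, s * s = 1 ∧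
      (∀ i j, ∀ t ∈ predRange z θs γs ε₁ ε₂ i j, b₀ ≤ s * deriv μ t ∧ s * deriv μ t ≤ b₁) ∧
      (∀ i j, b₀ ≤ (s • derivArr μ z θs γs) i j ∧ (s • derivArr μ z θs γs) i j ≤ b₁) ∧
      (∀ (e : Fin p → ℝ) (a : Fin p), (m : ℝ) * ((q + 1 : ℕ) : ℝ) * e a ^ 2 ≤
        kappa μ z θs γs ε₁ * total ((s • derivArr μ z θs γs) *
          resid (s • derivArr μ z θs γs) (covLin z e) *
          resid (s • derivArr μ z θs γs) (covLin z e))) ∧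
      1 ≤ kappa μ z θs γs ε₁ * b₁ * Cz ^ 2 := by
  obtain ⟨s, hs, hsign⟩ := hder.exists_sign hm hε₁.le hε₂.le hb₀
  have hγs : γs ∈ Metric.closedBall γs ε₂ := Metric.mem_closedBall_self hε₂.le
  have hwθ : ∀ θ ∈ Metric.closedBall θs ε₁, ∀ i j,
      b₀ ≤ (s • derivArr μ z θ γs) i j ∧ (s • derivArr μ z θ γs) i j ≤ b₁ :=
    fun θ hθ i j => hsign i j _ ⟨(θ, γs), ⟨hθ, hγs⟩, rfl⟩
  have hw := hwθ θs (Metric.mem_closedBall_self hε₁.le)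
  have hκ := sq_le_kappa_mul hm hb₀ hs hε₁.le
    (fun θ hθ i j => (hder θ hθ γs hγs).1 i j 0 (by norm_num)) hwθ hH
  refine ⟨s, hs, hsign, hw, hκ, ?_⟩
  exact one_le_of_sq_le_mul hm hp hz (kappa_nonneg μ z θs γs ε₁)
    (fun i j => hb₀.trans_le (hw i j).1) (fun i j => (hw i j).2) hκ

/-- Outside an event of small probability, all solutions of the moment equations in the box, also
for noise scaled down by `t ∈ [0, 1]`, satisfy the bounds of the theorem.  The parameter `K` is the number of
standard deviations allowed in Chebyshev's inequality for the scores. -/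
theorem exists_bad_event (hm : 0 < m) (hp : 0 < p) (hqm : q + 1 ≤ m)
    (hL : 1 ≤ Real.log m) (hlog : 4 * Real.log m < m) {C₀ c K H κ σ R : ℝ}
    (hC₀ : (m : ℝ) / ((q + 1 : ℕ) : ℝ) ≤ C₀)
    (hε₁ : 0 < ε₁) (hε₂ : 0 < ε₂) (hb₀ : 0 < b₀) (hb₂ : 0 < b₂) (hc : 0 < c) (hcb : c ≤ b₁)
    (hK : 0 < K) (hz : ∀ i j, ‖z i j‖ ≤ Cz)
    (hder : DerivBounds μ z θs γs ε₁ ε₂ b₀ b₁ b₂ b₃)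
    (hx : ∀ i j, Measurable (x i j))
    (hindep : iIndepFun (fun (ij : Fin m × Fin (q + 1)) => x ij.1 ij.2) P)
    {h : Fin m → Fin (q + 1) → ℝ} (hsub : ∀ i j, IsSubExponential (x i j) (h i j) P)
    (hhH : ∀ i j, h i j ≤ H)
    (hH : ∀ θ ∈ Metric.closedBall θs ε₁, IsUnit (matH μ z θ γs).det)
    (hκ : κ = kappa μ z θs γs ε₁) (hσ : σ = sigma (lapMat (derivArr μ z θs γs)) x P)
    (hR : R = κ * b₁ ^ 10 * Real.log m / (b₀ ^ 3 * m) * (b₂ * H ^ 2 / b₀ ^ 9 + σ))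
    (hG : κ ^ 2 * b₁ ^ 16 * b₂ / b₀ ^ 9 * (b₂ * H ^ 2 / b₀ ^ 9 + σ) * (Real.log m / m) ≤ 1)
    (hG' : (1210 * p ^ 2 * Cz ^ 2) ^ 2 * (4 * C₀ ^ 2 *
      (κ ^ 2 * b₁ ^ 16 * b₂ / b₀ ^ 9 * (b₂ * H ^ 2 / b₀ ^ 9 + σ) * (Real.log m / m))) ≤ 1 / 4)
    {M₁ M₂ : ℝ} (hM₁ : M₁ = 44 * p * K * Cz / c ^ 6 + 9680 * p * Cz * C₀ ^ 2)
    (hM₂ : M₂ = 5 * p * Cz * M₁ + 1210 * (p ^ 2 * Cz ^ 4 * M₁ ^ 2 + 4 * C₀ ^ 2 * Cz ^ 2)) :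
    ∃ bad : Set Ω, P bad ≤ ENNReal.ofReal (4 / m) + p * ENNReal.ofReal (1 / K ^ 2) ∧
      σ / m ≤ Cz ^ 2 / c ^ 6 * R ∧ ∀ ω ∉ bad, ∀ t ∈ Set.Icc (0 : ℝ) 1,
        ∀ η ∈ Metric.closedBall θs ε₁ ×ˢ Metric.closedBall γs ε₂,
        momentLin z (meanMatrix μ z η.1 η.2 - meanMatrix μ z θs γs - t • noise x P ω) = 0 →
        ‖η.2 - γs‖ ≤ M₁ * R ∧
        (∀ l, |η.1 l - θs l| ≤ 5 * p * Cz * M₁ * R +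
          10 * C₀ * (b₁ ^ 2 * H / b₀ ^ 3 * Real.sqrt (Real.log m / m))) ∧
        ∀ l, |η.1 l - θs l - ((lapMat (derivArr μ z θs γs))⁻¹ *ᵥ
          degreeVec (t • noise x P ω)) l| ≤ M₂ * R := by
  obtain ⟨s, hs, hsign, hw, hκq, hκb⟩ := exists_sign_and_kappa hm hp hε₁ hε₂ hb₀ hz hder hH
  rw [← hκ] at hκq hκb
  have hm0 : (0 : ℝ) < m := by exact_mod_cast hm
  have hn0 : (0 : ℝ) < ((q + 1 : ℕ) : ℝ) := by positivity
  have hκ0 : 0 ≤ κ := hκ ▸ kappa_nonneg μ z θs γs ε₁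
  have hσ0 : 0 ≤ σ := hσ ▸ Real.sqrt_nonneg _
  have hb : b₀ ≤ b₁ := (hw ⟨0, hm⟩ 0).1.trans (hw ⟨0, hm⟩ 0).2
  have hB1 : 1 ≤ b₁ / b₀ := (one_le_div hb₀).2 hb
  have hb₁ : 0 < b₁ := hb₀.trans_le hb
  have hCz : 0 ≤ Cz := (norm_nonneg _).trans (hz ⟨0, hm⟩ 0)
  have hC₀0 : 0 ≤ C₀ := le_trans (by positivity) hC₀
  have hH0 : 0 < H := (hsub ⟨0, hm⟩ 0).1.trans_le (hhH ⟨0, hm⟩ 0)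
  have hint : ∀ i j, Integrable (x i j) P := fun i j => (hsub i j).2.1
  have hNL := noise_memLp hsub
  -- `ν` bounds the scores over `mn`, `T` the row and column sums, and `τ` the degree noise per edge
  set ν := 22 * K * (b₁ / b₀) * Cz * b₁ * (σ / m) with hν
  set T := 2 * H * Real.sqrt (m * Real.log m) with hT
  set τ := T / ((q + 1 : ℕ) : ℝ) with hτ
  have hT0 : 0 ≤ T := by positivity
  have hτ0 : 0 ≤ τ := by positivity
  have hτT : ((q + 1 : ℕ) : ℝ) * τ = T := by rw [hτ]; field_simp
  have hTm : T ≤ m * τ := by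
    rw [← hτT]
    exact mul_le_mul_of_nonneg_right (by exact_mod_cast hqm) hτ0
  have hsqrt : Real.sqrt (m * Real.log m) = m * Real.sqrt (Real.log m / m) := by
    have : (m : ℝ) * Real.log m = (m : ℝ) ^ 2 * (Real.log m / m) := by field_simp
    rw [this, Real.sqrt_mul (sq_nonneg _), Real.sqrt_sq hm0.le]
  have hτle : τ ≤ 2 * C₀ * H * Real.sqrt (Real.log m / m) := by
    calc τ = 2 * H * Real.sqrt (Real.log m / m) * (m / ((q + 1 : ℕ) : ℝ)) := by
          rw [hτ, hT, hsqrt]; ring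
      _ ≤ 2 * H * Real.sqrt (Real.log m / m) * C₀ := by gcongr
      _ = _ := by ring
  have hτsq : τ ^ 2 ≤ 4 * C₀ ^ 2 * H ^ 2 * (Real.log m / m) := by
    calc τ ^ 2 ≤ (2 * C₀ * H * Real.sqrt (Real.log m / m)) ^ 2 := pow_le_pow_left₀ hτ0 hτle 2
      _ = 4 * C₀ ^ 2 * H ^ 2 * Real.sqrt (Real.log m / m) ^ 2 := by ring
      _ = _ := by rw [Real.sq_sqrt (by positivity)]
  have hsmall : 1210 * p ^ 2 * Cz ^ 2 * κ * (b₁ / b₀) ^ 4 * b₂ * τ / b₀ ≤ 1 / 2 := by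
    have h1 := smallness_sq_le (κ := κ) hm0 hL hb₀ hb₂.le hσ0 hb hτsq
    have h2 := mul_le_mul_of_nonneg_left h1 (sq_nonneg (1210 * (p : ℝ) ^ 2 * Cz ^ 2))
    refine abs_le_of_sq_le_sq' (b := 1 / 2) ?_ (by norm_num) |>.2
    calc _ = (1210 * (p : ℝ) ^ 2 * Cz ^ 2) ^ 2 * (κ * (b₁ / b₀) ^ 4 * b₂ * τ / b₀) ^ 2 := by ring
      _ ≤ 1 / 4 := h2.trans hG'
      _ = _ := by norm_num
  set E := 2 * p * κ * (b₁ / b₀) * ν +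
    2420 * p * Cz * κ * (b₁ / b₀) ^ 4 * b₂ * τ ^ 2 / b₀ ^ 2 with hE
  have hν0 : 0 ≤ ν := by positivity
  have hE0 : 0 ≤ E := by positivity
  have hEr : b₁ / b₀ * E ≤ M₁ * R := by
    rw [hM₁]
    exact covariate_rate_le hm0 hL hb₀ hb₂.le hκ0 hσ0 hc hcb hb (Nat.cast_nonneg p) hK.le hCz hτsq
      hE hR
  refine ⟨{ω | ¬ ((∀ i, |∑ j, noise x P ω i j| ≤ T) ∧ ∀ j, |∑ i, noise x P ω i j| ≤ T)} ∪
    ⋃ a, {ω | (m : ℝ) * ((q + 1 : ℕ) : ℝ) * ν <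
      |total (resid (s • derivArr μ z θs γs) (covArr z a) * noise x P ω)|}, ?_, ?_, ?_⟩
  · refine (measure_union_le _ _).trans (add_le_add
      (measure_not_degrees_le hx hindep hsub hhH hH0 hm hlog hqm) ?_)
    refine (measure_iUnion_fintype_le _ _).trans ((Finset.sum_le_sum fun a _ => ?_).trans
      (b := ∑ _a : Fin p, ENNReal.ofReal (1 / K ^ 2)) (by simp))
    rw [hν, hσ]
    exact measure_score_gt hm hint hNL hindep hb₀ hs hw hz hK a
  · rw [hR]
    exact error_rate_le hm0 hL hb₀ hb₂.le hκ0 hσ0 hc hcb hb hκb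
  · intro ω hω t ht η hη hsol
    simp only [Set.mem_union, Set.mem_iUnion, Set.mem_ofPred_eq, not_or, not_not, not_exists,
      not_lt] at hω
    obtain ⟨⟨hr, hcol⟩, hscore⟩ := hω
    obtain ⟨h1, h2, h3⟩ := solution_bounds hm hb₀ hb₂.le hκ0 hε₁.le hε₂.le hder hs hsign hz hκq hτ0
      (fun i => (hr i).trans_eq hτT.symm) (fun j => (hcol j).trans hTm) hν0 hscore hsmall ht hη
      hsol hE
    refine ⟨h1.trans ((le_mul_of_one_le_left hE0 hB1).trans hEr), fun l => (h2 l).trans ?_,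
      fun l => (h3 l).trans ?_⟩
    · have h4 := noise_rate_le hb₀ hb hτle hC₀0 hH0.le
      calc 5 * (b₁ / b₀) * (p * Cz * E + τ / b₀)
          = 5 * p * Cz * (b₁ / b₀ * E) + 5 * (b₁ / b₀ * (τ / b₀)) := by ring
        _ ≤ 5 * p * Cz * (M₁ * R) +
            5 * (2 * C₀ * (b₁ ^ 2 * H / b₀ ^ 3 * Real.sqrt (Real.log m / m))) := by gcongr
        _ = _ := by ring
    · rw [hM₂]
      exact remainder_rate_le hm0 hL hb₀ hb₂.le hκ0 hσ0 hb (Nat.cast_nonneg p) hCz hκb hτsq hR hG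
        hE0 hEr

/-- If the solutions for all scaled-down noises stay in the open box, then there is exactly one
solution in the closed box. -/
theorem existsUnique_isLocalMomentSolution (hm : 0 < m) (hp : 0 < p) (hε₁ : 0 < ε₁)
    (hε₂ : 0 < ε₂) (hb₀ : 0 < b₀) (hz : ∀ i j, ‖z i j‖ ≤ Cz)
    (hder : DerivBounds μ z θs γs ε₁ ε₂ b₀ b₁ b₂ b₃)
    (hH : ∀ θ ∈ Metric.closedBall θs ε₁, IsUnit (matH μ z θ γs).det)
    {X n : Fin m → Fin (q + 1) → ℝ} (hX : n = X - meanMatrix μ z θs γs)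
    (hloc : ∀ t ∈ Set.Icc (0 : ℝ) 1, ∀ η ∈ Metric.closedBall θs ε₁ ×ˢ Metric.closedBall γs ε₂,
      momentLin z (meanMatrix μ z η.1 η.2 - meanMatrix μ z θs γs - t • n) = 0 →
        η ∈ Metric.ball θs ε₁ ×ˢ Metric.ball γs ε₂) :
    ∃! η : (Fin m ⊕ Fin q → ℝ) × (Fin p → ℝ),
      IsLocalMomentSolution μ z θs γs ε₁ ε₂ X η.1 η.2 := by
  obtain ⟨s, hs, hsign, hw, hκ, -⟩ := exists_sign_and_kappa hm hp hε₁ hε₂ hb₀ hz hder hH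
  have hκ0 := kappa_nonneg μ z θs γs ε₁
  have hwp : ∀ i j, 0 < (s • derivArr μ z θs γs) i j := fun i j => hb₀.trans_le (hw i j).1
  obtain ⟨η, hη, hsol⟩ := exists_moment_solution hm hb₀ hκ0 hε₁.le hε₂.le hder hsign hwp hκ n hloc
  have hXn : ∀ Y, Y - meanMatrix μ z θs γs - n = Y - X := fun Y => by rw [hX]; ring
  rw [hXn] at hsol
  refine ⟨η, ⟨isMomentSolution_iff.2 hsol, hη⟩, ?_⟩
  rintro η' ⟨hsol', hη'⟩
  refine moment_unique hm hb₀ hκ0 hder hs hsign hwp hκ hη' hη ?_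
  rw [isMomentSolution_iff, map_sub, sub_eq_zero] at hsol'
  rw [map_sub, sub_eq_zero] at hsol
  rw [hsol, hsol']

end Single

end BipartiteNetwork

theorem theorem2
    -- the sizes: `m k` actors and `n k = q k + 1` events
    (m q : ℕ → ℕ) (hm : Tendsto m atTop atTop) (hmn : ∀ k, q k + 1 ≤ m k)
    (hmnO : (fun k => (m k : ℝ) / ((q k + 1 : ℕ) : ℝ)) =O[atTop] fun _ => (1 : ℝ))
    -- the known family of edge distributions and its mean function
    (ν : ℝ → Measure ℝ) (hν : ∀ t, IsProbabilityMeasure (ν t))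
    (hνint : ∀ t, Integrable (fun y : ℝ => y) (ν t))
    (μ : ℝ → ℝ) (hμ : μ = meanFun ν)
    -- covariates, of fixed dimension and uniformly bounded, and true parameters
    (p : ℕ) (hp : 0 < p) (z : ∀ k, Fin (m k) → Fin (q k + 1) → Fin p → ℝ)
    (Cz : ℝ) (hz : ∀ k i j, ‖z k i j‖ ≤ Cz)
    (θs : ∀ k, Fin (m k) ⊕ Fin (q k) → ℝ) (γs : ℕ → Fin p → ℝ)
    -- independent edge weights drawn from the model
    (Ω : ℕ → Type*) [∀ k, MeasurableSpace (Ω k)] (P : ∀ k, Measure (Ω k))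
    [∀ k, IsProbabilityMeasure (P k)]
    (x : ∀ k, Fin (m k) → Fin (q k + 1) → Ω k → ℝ)
    (hx : ∀ k i j, Measurable (x k i j))
    (hlaw : ∀ k i j, (P k).map (x k i j) = ν (linPred (z k) (θs k) (γs k) i j))
    (hindep : ∀ k, iIndepFun (fun (ij : Fin (m k) × Fin (q k + 1)) => x k ij.1 ij.2) (P k))
    -- bounds on the derivatives of the mean function near the true parameters
    (ε₁ ε₂ b₀ b₁ b₂ b₃ : ℕ → ℝ)
    (hε₁ : ∀ k, 0 < ε₁ k) (hε₂ : ∀ k, 0 < ε₂ k)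
    (hε₁0 : Tendsto ε₁ atTop (𝓝 0)) (hε₂0 : Tendsto ε₂ atTop (𝓝 0))
    (hb₀ : ∀ k, 0 < b₀ k) (hb₂ : ∀ k, 0 < b₂ k) (hb₃ : ∀ k, 0 < b₃ k)
    (c : ℝ) (hc : 0 < c) (hb₁ : ∀ k, c ≤ b₁ k)
    (hder : ∀ k, DerivBounds μ (z k) (θs k) (γs k) (ε₁ k) (ε₂ k) (b₀ k) (b₁ k) (b₂ k) (b₃ k))
    -- sub-exponential weights
    (h : ∀ k, Fin (m k) → Fin (q k + 1) → ℝ)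
    (hsub : ∀ k i j, IsSubExponential (x k i j) (h k i j) (P k))
    (hmax : ℕ → ℝ) (hhmax : ∀ k, hmax k = ⨆ ij : Fin (m k) × Fin (q k + 1), h k ij.1 ij.2)
    -- nonsingularity of `H` and the quantities `κ`, `V`, `σ`
    (hH : ∀ k, ∀ θ ∈ Metric.closedBall (θs k) (ε₁ k), IsUnit (matH μ (z k) θ (γs k)).det)
    (κ : ℕ → ℝ) (hκ : ∀ k, κ k = kappa μ (z k) (θs k) (γs k) (ε₁ k))
    (V : ∀ k, Matrix (Fin (m k) ⊕ Fin (q k)) (Fin (m k) ⊕ Fin (q k)) ℝ)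
    (hV : ∀ k, V k = jacV μ (z k) (θs k) (γs k))
    (σ : ℕ → ℝ) (hσ : ∀ k, σ k = sigma (V k) (x k) (P k))
    -- the two growth conditions of the consistency theorem and the extra one
    (hgrow₁ : (fun k => κ k ^ 2 * b₁ k ^ 16 * b₂ k / b₀ k ^ 9 *
        (b₂ k * hmax k ^ 2 / b₀ k ^ 9 + σ k)) =o[atTop] fun k => (m k : ℝ) / Real.log (m k))
    (hgrow₂ : (fun k => b₁ k ^ 4 * b₂ k * hmax k / b₀ k ^ 6)
        =o[atTop] fun k => Real.sqrt ((m k : ℝ) / Real.log (m k)))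
    (hgrow₃ : (fun k => κ k ^ 2 * b₁ k ^ 14 * Real.log (m k) / (m k : ℝ) *
        (b₂ k * hmax k ^ 2 / b₀ k ^ 9 + σ k) ^ 2)
        =o[atTop] fun k => (m k : ℝ) / Real.log (m k))
    -- the rate of the remainder
    (R : ℕ → ℝ)
    (hR : ∀ k, R k = κ k * b₁ k ^ 10 * Real.log (m k) / (b₀ k ^ 3 * (m k : ℝ)) *
        (b₂ k * hmax k ^ 2 / b₀ k ^ 9 + σ k)) :
    -- existence and uniqueness of the moment estimator near the truth, with high probability
    (((fun k => b₁ k ^ 2 * hmax k / b₀ k ^ 3 * Real.sqrt (Real.log (m k) / (m k : ℝ)) + R k)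
          =o[atTop] ε₁ → R =o[atTop] ε₂ →
        Tendsto (fun k => P k {ω | ¬ ∃! η : (Fin (m k) ⊕ Fin (q k) → ℝ) × (Fin p → ℝ),
          IsLocalMomentSolution μ (z k) (θs k) (γs k) (ε₁ k) (ε₂ k) (fun i j => x k i j ω)
            η.1 η.2}) atTop (𝓝 0))) ∧
    -- the asymptotic representation, for every coordinate
    (∀ (θhat : ∀ k, Ω k → Fin (m k) ⊕ Fin (q k) → ℝ) (γhat : ∀ k, Ω k → Fin p → ℝ),
      Tendsto (fun k => P k {ω | ¬ IsLocalMomentSolution μ (z k) (θs k) (γs k) (ε₁ k) (ε₂ k)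
        (fun i j => x k i j ω) (θhat k ω) (γhat k ω)}) atTop (𝓝 0) →
      ∀ δ : ℝ, 0 < δ → ∃ M : ℝ, ∀ᶠ k in atTop, ∀ l : Fin (m k) ⊕ Fin (q k),
        P k {ω | M * R k < |θhat k ω l - θs k l -
          (matS (V k) *ᵥ (degreeAt (x k) ω - meanDegree (x k) (P k))) l|} ≤ ENNReal.ofReal δ) ∧
    -- the explicit form of the leading term
    (∀ k ω,
      (∀ i : Fin (m k),
        (matS (V k) *ᵥ (degreeAt (x k) ω - meanDegree (x k) (P k))) (Sum.inl i) =
          (degreeAt (x k) ω (Sum.inl i) - meanDegree (x k) (P k) (Sum.inl i)) /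
              V k (Sum.inl i) (Sum.inl i) +
            lastDegreeCentered (x k) (P k) ω / lastDiag (V k)) ∧
      (∀ j : Fin (q k),
        (matS (V k) *ᵥ (degreeAt (x k) ω - meanDegree (x k) (P k))) (Sum.inr j) =
          (degreeAt (x k) ω (Sum.inr j) - meanDegree (x k) (P k) (Sum.inr j)) /
              V k (Sum.inr j) (Sum.inr j) -
            lastDegreeCentered (x k) (P k) ω / lastDiag (V k))) := by
  -- elementary facts about the sizes
  have hmR : Tendsto (fun k => (m k : ℝ)) atTop atTop := tendsto_natCast_atTop_atTop.comp hm
  have hm0 : ∀ k, 0 < m k := fun k => (Nat.succ_pos _).trans_le (hmn k)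
  have hmR0 : ∀ k, (0 : ℝ) < m k := fun k => by exact_mod_cast hm0 k
  have hL : ∀ᶠ k in atTop, 1 ≤ Real.log (m k) :=
    (Real.tendsto_log_atTop.comp hmR).eventually_ge_atTop 1
  have hlog : ∀ᶠ k in atTop, 4 * Real.log (m k) < m k := by
    have h1 := (Real.isLittleO_log_id_atTop.comp_tendsto hmR).def (show (0 : ℝ) < 1 / 8 by norm_num)
    filter_upwards [h1] with k hk
    have h2 : |Real.log (m k)| ≤ 1 / 8 * |(m k : ℝ)| := hk
    rw [abs_of_pos (hmR0 k)] at h2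
    linarith [le_abs_self (Real.log (m k)), hmR0 k]
  have hsmall : ∀ δ : ℝ, 0 < δ → ∀ᶠ k in atTop, (4 : ℝ) / m k ≤ δ := fun δ hδ =>
    (hmR.const_div_atTop 4).eventually_le_const hδ
  obtain ⟨C₀, hC₀⟩ := hmnO.bound
  have hsubint : ∀ k i j, Integrable (x k i j) (P k) := fun k i j => (hsub k i j).2.1
  have hhH : ∀ k i j, h k i j ≤ hmax k := fun k i j => by
    rw [hhmax]
    exact le_ciSup (f := fun ij : Fin (m k) × Fin (q k + 1) => h k ij.1 ij.2)
      (Set.finite_range _).bddAbove (i, j)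
  have hVlap : ∀ k, V k = lapMat (derivArr μ (z k) (θs k) (γs k)) := fun k => by
    rw [hV]
    exact jacobian_momentF_left fun i j => (hder k (θs k)
      (Metric.mem_closedBall_self (hε₁ k).le) (γs k) (Metric.mem_closedBall_self (hε₂ k).le)).1
      i j 0 (by norm_num)
  have hnoise : ∀ k ω, noise (x k) (P k) ω =
      (fun i j => x k i j ω) - meanMatrix μ (z k) (θs k) (γs k) := fun k ω =>
    noise_eq_sub_meanMatrix hμ (hx k) (hlaw k) ω
  -- the first growth condition, in the form in which it is used
  have hG : ∀ δ : ℝ, 0 < δ → ∀ᶠ k in atTop, κ k ^ 2 * b₁ k ^ 16 * b₂ k / b₀ k ^ 9 *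
      (b₂ k * hmax k ^ 2 / b₀ k ^ 9 + σ k) * (Real.log (m k) / m k) ≤ δ := by
    intro δ hδ
    filter_upwards [hgrow₁.def hδ, hL] with k hk hLk
    have hlp : 0 < Real.log (m k) := by linarith
    have hq : 0 < (m k : ℝ) / Real.log (m k) := div_pos (hmR0 k) hlp
    rw [Real.norm_eq_abs, Real.norm_eq_abs, abs_of_pos hq] at hk
    have h1 := (le_abs_self _).trans hk
    have h2 : Real.log (m k) / m k = 1 / ((m k : ℝ) / Real.log (m k)) := by
      rw [one_div_div]
    rw [h2, mul_one_div, div_le_iff₀ hq]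
    exact h1
  -- the localization of all solutions, with high probability; the noise is scaled by `t` because the
  -- existence proof needs all `t ∈ [0, 1]` on one and the same event
  have hkey : ∀ K : ℝ, 0 < K → ∃ M₁ M₂ : ℝ, ∀ᶠ k in atTop, ∃ bad : Set (Ω k),
      P k bad ≤ ENNReal.ofReal (4 / m k) + p * ENNReal.ofReal (1 / K ^ 2) ∧
      σ k / m k ≤ Cz ^ 2 / c ^ 6 * R k ∧ ∀ ω ∉ bad, ∀ t ∈ Set.Icc (0 : ℝ) 1,
        ∀ η ∈ Metric.closedBall (θs k) (ε₁ k) ×ˢ Metric.closedBall (γs k) (ε₂ k),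
        momentLin (z k) (meanMatrix μ (z k) η.1 η.2 - meanMatrix μ (z k) (θs k) (γs k) -
          t • noise (x k) (P k) ω) = 0 →
        ‖η.2 - γs k‖ ≤ M₁ * R k ∧
        (∀ l, |η.1 l - θs k l| ≤ 5 * p * Cz * M₁ * R k + 10 * C₀ *
          (b₁ k ^ 2 * hmax k / b₀ k ^ 3 * Real.sqrt (Real.log (m k) / m k))) ∧
        ∀ l, |η.1 l - θs k l - ((lapMat (derivArr μ (z k) (θs k) (γs k)))⁻¹ *ᵥ
          degreeVec (t • noise (x k) (P k) ω)) l| ≤ M₂ * R k := by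
    intro K hK
    refine ⟨44 * p * K * Cz / c ^ 6 + 9680 * p * Cz * C₀ ^ 2,
      5 * p * Cz * (44 * p * K * Cz / c ^ 6 + 9680 * p * Cz * C₀ ^ 2) +
        1210 * (p ^ 2 * Cz ^ 4 * (44 * p * K * Cz / c ^ 6 + 9680 * p * Cz * C₀ ^ 2) ^ 2 +
          4 * C₀ ^ 2 * Cz ^ 2), ?_⟩
    have hD : (0 : ℝ) ≤ (1210 * p ^ 2 * Cz ^ 2) ^ 2 * (4 * C₀ ^ 2) := by positivity
    filter_upwards [hL, hlog, hC₀, hG 1 one_pos,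
      hG (1 / (4 * ((1210 * p ^ 2 * Cz ^ 2) ^ 2 * (4 * C₀ ^ 2) + 1))) (by positivity)]
      with k hLk hlogk hCk hGk hGk'
    refine exists_bad_event (hm0 k) hp (hmn k) hLk hlogk ?_ (hε₁ k) (hε₂ k) (hb₀ k) (hb₂ k) hc
      (hb₁ k) hK (hz k) (hder k) (hx k) (hindep k) (hsub k) (hhH k) (hH k) (hκ k) ?_ (hR k) hGk ?_
      rfl rfl
    · rw [norm_one, mul_one] at hCk
      exact (le_abs_self _).trans hCk
    · rw [hσ, hVlap]
    · rw [← mul_assoc]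
      refine (mul_le_mul_of_nonneg_left hGk' hD).trans ?_
      rw [mul_one_div, div_le_iff₀ (by positivity)]
      linarith
  have hσ0 : ∀ k, 0 ≤ σ k := fun k => by rw [hσ]; exact Real.sqrt_nonneg _
  have hκ0 : ∀ k, 0 ≤ κ k := fun k => by rw [hκ]; exact kappa_nonneg _ _ _ _ _
  have hR0 : ∀ k, 0 ≤ R k := fun k => by
    rw [hR]
    have h1 := hσ0 k
    have h2 := hκ0 k
    have h3 := hb₀ k
    have h4 := hb₂ k
    have h5 : 0 < b₁ k := hc.trans_le (hb₁ k)
    have h6 := Real.log_natCast_nonneg (m k)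
    positivity
  have hmax0 : ∀ k, 0 ≤ hmax k := fun k =>
    (hsub k ⟨0, hm0 k⟩ 0).1.le.trans (hhH k ⟨0, hm0 k⟩ 0)
  have hchoose : ∀ δ : ℝ, 0 < δ → ∃ K : ℝ, 0 < K ∧
      (p + 1 : ENNReal) * ENNReal.ofReal (1 / K ^ 2) ≤ ENNReal.ofReal δ := fun δ hδ => by
    refine ⟨Real.sqrt ((p + 1) / δ), by positivity, ?_⟩
    rw [Real.sq_sqrt (by positivity), one_div_div]
    have : ((p : ENNReal) + 1) = ENNReal.ofReal ((p : ℝ) + 1) := by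
      rw [ENNReal.ofReal_add (Nat.cast_nonneg p) zero_le_one, ENNReal.ofReal_natCast,
        ENNReal.ofReal_one]
    rw [this, ← ENNReal.ofReal_mul (by positivity), mul_div_cancel₀ _ (by positivity)]
  refine ⟨fun hrate₁ hrate₂ => ?_, fun θhat γhat hest δ hδ => ?_, fun k ω => ⟨fun i => ?_,
    fun j => ?_⟩⟩
  · -- existence and uniqueness
    rw [ENNReal.tendsto_nhds_zero]
    intro ε hε
    obtain ⟨δ, hδ0, hδε⟩ : ∃ δ : ℝ, 0 < δ ∧ ENNReal.ofReal (δ + δ) ≤ ε := by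
      obtain ⟨r, hr0, hr⟩ := ENNReal.lt_iff_exists_nnreal_btwn.1 hε
      have hr0' : (0 : ℝ) < r := by exact_mod_cast hr0
      refine ⟨r / 2, by positivity, ?_⟩
      rw [add_halves, ENNReal.ofReal_coe_nnreal]; exact hr.le
    obtain ⟨K, hK, hKδ⟩ := hchoose δ hδ0
    obtain ⟨M₁, M₂, hM⟩ := hkey K hK
    have hη₁ : (0 : ℝ) < 1 / (2 * (|5 * p * Cz * M₁| + |10 * C₀| + 1)) := by positivity
    have hη₂ : (0 : ℝ) < 1 / (2 * (|M₁| + 1)) := by positivity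
    filter_upwards [hM, hsmall δ hδ0, hrate₁.def hη₁, hrate₂.def hη₂] with k hk h4 hr₁ hr₂
    obtain ⟨bad, hbad, -, hgood⟩ := hk
    have hsub' : {ω | ¬ ∃! η : (Fin (m k) ⊕ Fin (q k) → ℝ) × (Fin p → ℝ),
        IsLocalMomentSolution μ (z k) (θs k) (γs k) (ε₁ k) (ε₂ k) (fun i j => x k i j ω)
          η.1 η.2} ⊆ bad := by
      intro ω hω
      by_contra hnb
      refine hω (existsUnique_isLocalMomentSolution (hm0 k) hp (hε₁ k) (hε₂ k) (hb₀ k) (hz k)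
        (hder k) (hH k) (hnoise k ω) fun t ht η hη hsol => ?_)
      obtain ⟨g1, g2, -⟩ := hgood ω hnb t ht η hη hsol
      set ρ := b₁ k ^ 2 * hmax k / b₀ k ^ 3 * Real.sqrt (Real.log (m k) / m k) with hρ
      have hρ0 : 0 ≤ ρ := by
        have := hmax0 k
        have := hb₀ k
        positivity
      rw [Real.norm_eq_abs, Real.norm_eq_abs, abs_of_pos (hε₁ k),
        abs_of_nonneg (add_nonneg hρ0 (hR0 k))] at hr₁
      rw [Real.norm_eq_abs, Real.norm_eq_abs, abs_of_pos (hε₂ k), abs_of_nonneg (hR0 k)] at hr₂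
      constructor
      · rw [Metric.mem_ball, dist_pi_lt_iff (hε₁ k)]
        intro l
        rw [Real.dist_eq]
        refine (g2 l).trans_lt ?_
        have e1 : 5 * p * Cz * M₁ * R k ≤ |5 * p * Cz * M₁| * R k :=
          mul_le_mul_of_nonneg_right (le_abs_self _) (hR0 k)
        have e2 : 10 * C₀ * ρ ≤ |10 * C₀| * ρ := mul_le_mul_of_nonneg_right (le_abs_self _) hρ0
        have e3 : (|5 * p * Cz * M₁| + |10 * C₀| + 1) * (ρ + R k) ≤ ε₁ k / 2 := by
          refine (mul_le_mul_of_nonneg_left hr₁ (by positivity)).trans (le_of_eq ?_)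
          field_simp
        have e4 : 0 ≤ |5 * p * Cz * M₁| * ρ := by positivity
        have e5 : 0 ≤ |10 * C₀| * R k := mul_nonneg (abs_nonneg _) (hR0 k)
        nlinarith [hR0 k, hε₁ k]
      · rw [Metric.mem_ball, dist_eq_norm]
        refine g1.trans_lt ?_
        have e1 : M₁ * R k ≤ |M₁| * R k := mul_le_mul_of_nonneg_right (le_abs_self _) (hR0 k)
        have e3 : (|M₁| + 1) * R k ≤ ε₂ k / 2 := by
          refine (mul_le_mul_of_nonneg_left hr₂ (by positivity)).trans (le_of_eq ?_)
          field_simp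
        nlinarith [hR0 k, hε₂ k]
    refine (measure_mono hsub').trans (hbad.trans (le_trans ?_ hδε))
    rw [ENNReal.ofReal_add hδ0.le hδ0.le]
    refine add_le_add (ENNReal.ofReal_le_ofReal h4) (le_trans ?_ hKδ)
    gcongr
    exact le_self_add
  · -- the asymptotic representation
    obtain ⟨K, hK, hKδ⟩ := hchoose (δ / 3) (by positivity)
    obtain ⟨M₁, M₂, hM⟩ := hkey K hK
    refine ⟨M₂ + K * (Cz ^ 2 / c ^ 6), ?_⟩
    have hδ3 : (0 : ENNReal) < ENNReal.ofReal (δ / 3) := ENNReal.ofReal_pos.2 (by positivity)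
    filter_upwards [hM, hsmall (δ / 3) (by positivity), ENNReal.tendsto_nhds_zero.1 hest _ hδ3]
      with k hk h4 hsol l
    obtain ⟨bad, hbad, hσR, hgood⟩ := hk
    have herr := measure_error_gt (hm0 k) (hsubint k) (noise_memLp (hsub k))
      (V := V k) (hVlap k ▸ lapMat_isSymm _) hK l
    rw [← hσ] at herr
    have hsub' : {ω | (M₂ + K * (Cz ^ 2 / c ^ 6)) * R k < |θhat k ω l - θs k l -
          (matS (V k) *ᵥ (degreeAt (x k) ω - meanDegree (x k) (P k))) l|} ⊆
        (bad ∪ {ω | K * (σ k / m k) <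
          |(((V k)⁻¹ - matS (V k)) *ᵥ degreeVec (noise (x k) (P k) ω)) l|}) ∪
        {ω | ¬ IsLocalMomentSolution μ (z k) (θs k) (γs k) (ε₁ k) (ε₂ k)
          (fun i j => x k i j ω) (θhat k ω) (γhat k ω)} := by
      intro ω hω
      by_contra hn
      simp only [Set.mem_union, Set.mem_ofPred_eq, not_or, not_not, not_lt] at hn
      obtain ⟨⟨hnb, he⟩, hs⟩ := hn
      have h1 := isMomentSolution_iff.1 hs.1
      have h2 : momentLin (z k) (meanMatrix μ (z k) (θhat k ω) (γhat k ω) -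
          meanMatrix μ (z k) (θs k) (γs k) - (1 : ℝ) • noise (x k) (P k) ω) = 0 := by
        rw [one_smul, hnoise, sub_sub, add_sub_cancel]; exact h1
      obtain ⟨-, -, g3⟩ := hgood ω hnb 1 (Set.right_mem_Icc.2 zero_le_one)
        (θhat k ω, γhat k ω) hs.2 h2
      have g := g3 l
      rw [one_smul, ← hVlap] at g
      have hlt : (M₂ + K * (Cz ^ 2 / c ^ 6)) * R k < |θhat k ω l - θs k l -
          (matS (V k) *ᵥ (degreeAt (x k) ω - meanDegree (x k) (P k))) l| := hω
      rw [degreeAt_sub_meanDegree (hsubint k)] at hlt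
      have hsplit : θhat k ω l - θs k l - (matS (V k) *ᵥ degreeVec (noise (x k) (P k) ω)) l =
          (θhat k ω l - θs k l - ((V k)⁻¹ *ᵥ degreeVec (noise (x k) (P k) ω)) l) +
          (((V k)⁻¹ - matS (V k)) *ᵥ degreeVec (noise (x k) (P k) ω)) l := by
        rw [Matrix.sub_mulVec, Pi.sub_apply]; ring
      rw [hsplit] at hlt
      have h3 := abs_add_le (θhat k ω l - θs k l -
        ((V k)⁻¹ *ᵥ degreeVec (noise (x k) (P k) ω)) l)
        ((((V k)⁻¹ - matS (V k)) *ᵥ degreeVec (noise (x k) (P k) ω)) l)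
      have h5 := mul_le_mul_of_nonneg_left hσR hK.le
      linarith
    refine (measure_mono hsub').trans ((measure_union_le _ _).trans ?_)
    have hsum : ENNReal.ofReal δ =
        ENNReal.ofReal (δ / 3) + ENNReal.ofReal (δ / 3) + ENNReal.ofReal (δ / 3) := by
      rw [← ENNReal.ofReal_add (by positivity) (by positivity),
        ← ENNReal.ofReal_add (by positivity) (by positivity)]
      congr 1; ring
    rw [hsum]
    refine add_le_add ((measure_union_le _ _).trans ((add_le_add hbad herr).trans ?_)) hsol
    rw [add_assoc]
    refine add_le_add (ENNReal.ofReal_le_ofReal h4) (le_trans (le_of_eq ?_) hKδ)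
    ring
  · rw [matS_mulVec_inl, degreeAt_sub_meanDegree (hsubint k), ← sum_last_col,
      ← lastDegreeCentered_eq (hsubint k), ← degreeAt_sub_meanDegree (hsubint k), Pi.sub_apply]
  · rw [matS_mulVec_inr, degreeAt_sub_meanDegree (hsubint k), ← sum_last_col,
      ← lastDegreeCentered_eq (hsubint k), ← degreeAt_sub_meanDegree (hsubint k), Pi.sub_apply]
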